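/- Let $n\ge 0$, let $J=\begin{pmatrix}0&-I\\ I&0\end{pmatrix}\in\mathbb C^{2n\times 2n}$, and let $H:(0,\infty)\to\mathbb C^{2n\times 2n}$ be locally integrable with $H(x)\ge 0$ for almost every $x$. Assume that $0$ is a regular endpoint ($H\in L^1(0,c)$ for some $c>0$) and that $H$ is definite on $(0,\infty)$: if $v\in\mathbb C^{2n}$ and $H(x)v=0$ for almost every $x>0$, then $v=0$. Let $L^2_H(0,\infty)$ be the space of measurable $f:(0,\infty)\to\mathbb C^{2n}$ with $\int_0^\infty f^*Hf\,dx<\infty$, modulo those for which this integral vanishes. Absolutely continuous means locally absolutely continuous. Let $$\mathcal T=\{(f,g)\in L^2_H\oplus L^2_H:\ f \text{ has an absolutely continuous representative } f_0 \text{ with } Jf_0'=-Hg \text{ a.e. on }(0,\infty)\},$$ and assume that the deficiency indices $\dim\ker(\mathcal T-i)$ and $\dim\ker(\mathcal T+i)$ are both equal to $n$. Let $\alpha\in\mathbb C^{n\times 2n}$ satisfy $\alpha\alpha^*=I$ and $\alpha J\alpha^*=0$, and let $\mathcal S=\{(f,g)\in\mathcal T:\ \alpha f_0(0)=0\}$,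 where $f_0(0)$ is the value at $0$ of the absolutely continuous extension of $f_0$ to $[0,\infty)$. The resolvent is the relation $(\mathcal S-z)^{-1}=\{(g-zf,f):(f,g)\in\mathcal S\}$. For $z\in\mathbb C$ let $u(\cdot,z),v(\cdot,z):[0,\infty)\to\mathbb C^{2n\times n}$ be absolutely continuous solutions of $Jy'=-zHy$ with $u(0,z)=-J\alpha^*$ and $v(0,z)=\alpha^*$. For $z\in\mathbb C\setminus\mathbb R$ let $m(z)\in\mathbb C^{n\times n}$ be a matrix such that the columns of $f_m(x,z)=v(x,z)+u(x,z)m(z)$ belong to $L^2_H(0,\infty)$. Such $u$, $v$, $m$ exist. For any such choice and $z\in\mathbb C\setminus\mathbb R$ define $$G(x,y,z)=\begin{cases}u(x,z)f_m(y,\overline z)^*, & x\le y,\\ f_m(x,z)u(y,\overline z)^*, & x>y.\end{cases}$$ **Theorem.** Let $z\in\mathbb C\setminus\mathbb R$ and $h\in L^2_H(0,\infty)$. The integral $$g(x)=\int_0^\infty G(x,y,z)H(y)h(y)\,dy$$ converges absolutely for every $x\ge 0$. There is exactly one element of $L^2_H(0,\infty)$ to which the relation $(\mathcal S-z)^{-1}$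 maps $h$, and $g$ represents it: $$((\mathcal S-z)^{-1}h)(x)=\int_0^\infty G(x,y,z)H(y)h(y)\,dy .$$ Moreover, $g$ is absolutely continuous on $[0,\infty)$ and satisfies $Jg'=-zHg-Hh$ almost everywhere, and it is the only absolutely continuous representative of $(\mathcal S-z)^{-1}h$ that does: every representative $k$ of $(\mathcal S-z)^{-1}h$ that is absolutely continuous on $(0,\infty)$ with $Jk'=-zHk-Hh$ almost everywhere equals $g$ on $(0,\infty)$. -/

import Mathlib

open MeasureTheory Set Matrix
open scoped ComplexOrder

noncomputable section

namespace CanonicalSystem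

/-! ### Linear relations -/

section Relations

variable {E : Type*} [AddCommGroup E] [Module ℂ E]

/-- The relation `R - z = {(f, g - z f) : (f, g) ∈ R}`. -/
def relSub (R : Submodule ℂ (E × E)) (z : ℂ) : Submodule ℂ (E × E) :=
  R.map ((LinearMap.fst ℂ E E).prod (LinearMap.snd ℂ E E - z • LinearMap.fst ℂ E E))

/-- The inverse relation `{(g, f) : (f, g) ∈ R}`. -/
def relInv (R : Submodule ℂ (E × E)) : Submodule ℂ (E × E) :=
  R.map ((LinearMap.snd ℂ E E).prod (LinearMap.fst ℂ E E))

/-- The kernel `{f : (f, 0) ∈ R}`. -/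
def relKer (R : Submodule ℂ (E × E)) : Submodule ℂ E :=
  R.comap (LinearMap.inl ℂ E E)

/-- The resolvent `(R - z)⁻¹`, as a relation. -/
def relResolvent (R : Submodule ℂ (E × E)) (z : ℂ) : Submodule ℂ (E × E) :=
  relInv (relSub R z)

end Relations

/-! ### Coefficient functions on the half line -/

/-- The vectors `ℂ²ⁿ`, written in two blocks of length `n`. -/
abbrev Vec (n : ℕ) : Type := Fin n ⊕ Fin n → ℂ

/-- Lebesgue measure on `(0, ∞)`. -/
abbrev halfLine : Measure ℝ := volume.restrict (Ioi (0 : ℝ))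

/-- The coefficient function of a canonical system on `(0, ∞)`: a locally integrable function
with positive semidefinite values. Only the values on `(0, ∞)` matter. -/
structure Hamiltonian (n : ℕ) where
  toFun : ℝ → Matrix (Fin n ⊕ Fin n) (Fin n ⊕ Fin n) ℂ
  posSemidef : ∀ᵐ x ∂halfLine, (toFun x).PosSemidef
  locallyIntegrable : ∀ i j, LocallyIntegrableOn (fun x => toFun x i j) (Ioi 0) volume

instance (n : ℕ) : CoeFun (Hamiltonian n)
    (fun _ => ℝ → Matrix (Fin n ⊕ Fin n) (Fin n ⊕ Fin n) ℂ) := ⟨Hamiltonian.toFun⟩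

variable {n : ℕ}

/-- `0` is a regular endpoint: `H` is integrable near `0`. -/
def Hamiltonian.RegularAtZero (H : Hamiltonian n) : Prop :=
  ∃ c > (0 : ℝ), ∀ i j, IntegrableOn (fun x => H x i j) (Ioo 0 c) volume

/-- `H` is definite on `(0, ∞)`. -/
def Hamiltonian.IsDefinite (H : Hamiltonian n) : Prop :=
  ∀ v : Vec n, (∀ᵐ x ∂halfLine, H x *ᵥ v = 0) → v = 0

/-! ### The space `L²_H(0, ∞)` -/

/-- The squared seminorm `∫₀^∞ f(x)* H(x) f(x) dx`, with values in `[0, ∞]`. -/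
def Hamiltonian.sqNorm (H : Hamiltonian n) (f : ℝ → Vec n) : ENNReal :=
  ∫⁻ x, ENNReal.ofReal (star (f x) ⬝ᵥ (H x *ᵥ f x)).re ∂halfLine

theorem re_form_add_le {M : Matrix (Fin n ⊕ Fin n) (Fin n ⊕ Fin n) ℂ} (hM : M.PosSemidef)
    (a b : Vec n) :
    (star (a + b) ⬝ᵥ (M *ᵥ (a + b))).re
      ≤ 2 * (star a ⬝ᵥ (M *ᵥ a)).re + 2 * (star b ⬝ᵥ (M *ᵥ b)).re := by
  have h : 0 ≤ (star (a - b) ⬝ᵥ (M *ᵥ (a - b))).re := hM.re_dotProduct_nonneg (a - b)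
  simp only [star_add, star_sub, mulVec_add, mulVec_sub, add_dotProduct, sub_dotProduct,
    dotProduct_add, dotProduct_sub, Complex.add_re, Complex.sub_re] at h ⊢
  linarith

theorem re_form_smul (M : Matrix (Fin n ⊕ Fin n) (Fin n ⊕ Fin n) ℂ) (c : ℂ) (a : Vec n) :
    (star (c • a) ⬝ᵥ (M *ᵥ (c • a))).re = ‖c‖ ^ 2 * (star a ⬝ᵥ (M *ᵥ a)).re := by
  rw [star_smul, mulVec_smul, smul_dotProduct, dotProduct_smul, smul_smul, smul_eq_mul,
    Complex.star_def, Complex.conj_mul']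
  norm_cast
  exact Complex.re_ofReal_mul _ _

theorem sqNorm_add_le (H : Hamiltonian n) (f g : ℝ → Vec n) :
    H.sqNorm (f + g) ≤
      ∫⁻ x, (2 * ENNReal.ofReal (star (f x) ⬝ᵥ (H x *ᵥ f x)).re
        + 2 * ENNReal.ofReal (star (g x) ⬝ᵥ (H x *ᵥ g x)).re) ∂halfLine := by
  refine lintegral_mono_ae ?_
  filter_upwards [H.posSemidef] with x hx
  refine (ENNReal.ofReal_le_ofReal (re_form_add_le hx (f x) (g x))).trans ?_
  refine ENNReal.ofReal_add_le.trans ?_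
  rw [ENNReal.ofReal_mul (by norm_num), ENNReal.ofReal_mul (by norm_num)]
  simp

theorem sqNorm_smul (H : Hamiltonian n) (c : ℂ) (f : ℝ → Vec n) :
    H.sqNorm (c • f) = ENNReal.ofReal (‖c‖ ^ 2) * H.sqNorm f := by
  unfold Hamiltonian.sqNorm
  rw [← lintegral_const_mul' _ _ ENNReal.ofReal_ne_top]
  refine lintegral_congr fun x => ?_
  rw [Pi.smul_apply, re_form_smul, ENNReal.ofReal_mul (by positivity)]

theorem aemeasurable_form (H : Hamiltonian n) {f : ℝ → Vec n}
    (hf : AEStronglyMeasurable f halfLine) :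
    AEMeasurable (fun x => ENNReal.ofReal (star (f x) ⬝ᵥ (H x *ᵥ f x)).re) halfLine := by
  have hH : ∀ i j, AEStronglyMeasurable (fun x => H x i j) halfLine := fun i j =>
    (H.locallyIntegrable i j).aestronglyMeasurable
  have hfi : ∀ i, AEMeasurable (fun x => f x i) halfLine := fun i =>
    (measurable_pi_apply i).comp_aemeasurable hf.aemeasurable
  refine ENNReal.measurable_ofReal.comp_aemeasurable (Complex.measurable_re.comp_aemeasurable ?_)
  simp only [dotProduct, mulVec, Pi.star_apply, Complex.star_def]
  refine Finset.aemeasurable_fun_sum _ fun i _ => ?_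
  refine (Complex.continuous_conj.measurable.comp_aemeasurable (hfi i)).mul ?_
  exact Finset.aemeasurable_fun_sum _ fun j _ => (hH i j).aemeasurable.mul (hfi j)

theorem sqNorm_add_le' (H : Hamiltonian n) {f : ℝ → Vec n} (g : ℝ → Vec n)
    (hf : AEStronglyMeasurable f halfLine) :
    H.sqNorm (f + g) ≤ 2 * H.sqNorm f + 2 * H.sqNorm g := by
  refine (sqNorm_add_le H f g).trans (le_of_eq ?_)
  rw [lintegral_add_left' ((aemeasurable_form H hf).const_mul 2),
    lintegral_const_mul' _ _ (by simp), lintegral_const_mul' _ _ (by simp)]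
  rfl

/-- The space of measurable functions with finite seminorm. -/
def Hamiltonian.preL2 (H : Hamiltonian n) : Submodule ℂ (ℝ → Vec n) where
  carrier := {f | AEStronglyMeasurable f halfLine ∧ H.sqNorm f < ⊤}
  zero_mem' := ⟨aestronglyMeasurable_const, by simp [Hamiltonian.sqNorm]⟩
  add_mem' := by
    rintro f g ⟨hf, hf'⟩ ⟨hg, hg'⟩
    refine ⟨hf.add hg, (sqNorm_add_le' H g hf).trans_lt ?_⟩
    exact ENNReal.add_lt_top.2 ⟨ENNReal.mul_lt_top (by simp) hf', ENNReal.mul_lt_top (by simp) hg'⟩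
  smul_mem' := by
    rintro c f ⟨hf, hf'⟩
    refine ⟨hf.const_smul c, ?_⟩
    rw [sqNorm_smul]
    exact ENNReal.mul_lt_top ENNReal.ofReal_lt_top hf'

/-- The functions of seminorm zero. -/
def Hamiltonian.null (H : Hamiltonian n) : Submodule ℂ H.preL2 where
  carrier := {f | H.sqNorm f = 0}
  zero_mem' := by simp [Hamiltonian.sqNorm]
  add_mem' := by
    intro f g hf hg
    have hf' : H.sqNorm (f : ℝ → Vec n) = 0 := hf
    have hg' : H.sqNorm (g : ℝ → Vec n) = 0 := hg
    have h := sqNorm_add_le' H (g : ℝ → Vec n) f.2.1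
    rw [hf', hg'] at h
    simpa using h
  smul_mem' := by
    intro c f hf
    have hf' : H.sqNorm (f : ℝ → Vec n) = 0 := hf
    have h := sqNorm_smul H c (f : ℝ → Vec n)
    rw [hf', mul_zero] at h
    exact h

/-- The space `L²_H(0, ∞)`. -/
abbrev Hamiltonian.L2 (H : Hamiltonian n) : Type := H.preL2 ⧸ H.null

/-- The function `f` represents the element `F` of `L²_H(0, ∞)`. -/
def Hamiltonian.Represents (H : Hamiltonian n) (f : ℝ → Vec n) (F : H.L2) : Prop :=
  ∃ hf : f ∈ H.preL2, H.null.mkQ ⟨f, hf⟩ = F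

theorem represents_zero (H : Hamiltonian n) : H.Represents 0 0 :=
  ⟨zero_mem _, map_zero _⟩

theorem Hamiltonian.Represents.add {H : Hamiltonian n} {f g : ℝ → Vec n} {F G : H.L2}
    (hf : H.Represents f F) (hg : H.Represents g G) : H.Represents (f + g) (F + G) := by
  obtain ⟨hf, rfl⟩ := hf
  obtain ⟨hg, rfl⟩ := hg
  exact ⟨add_mem hf hg, (map_add H.null.mkQ ⟨f, hf⟩ ⟨g, hg⟩)⟩

theorem Hamiltonian.Represents.smul {H : Hamiltonian n} {f : ℝ → Vec n} {F : H.L2} (c : ℂ)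
    (hf : H.Represents f F) : H.Represents (c • f) (c • F) := by
  obtain ⟨hf, rfl⟩ := hf
  exact ⟨Submodule.smul_mem _ c hf, (map_smul H.null.mkQ c ⟨f, hf⟩)⟩

/-! ### Absolutely continuous functions and the differential equation -/

/-- `f` is locally absolutely continuous on `s`: it is absolutely continuous on every compact
interval contained in `s`. -/
def LocACOn (f : ℝ → Vec n) (s : Set ℝ) : Prop :=
  ∀ a b : ℝ, a ≤ b → Icc a b ⊆ s → AbsolutelyContinuousOnInterval f a b

/-- `J f' = r` almost everywhere on `(0, ∞)`, where `J = (0, -I; I, 0)`. -/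
def JDerivEq (f r : ℝ → Vec n) : Prop :=
  ∀ᵐ x ∂halfLine, ∃ d : Vec n, HasDerivAt f d x ∧ Matrix.J (Fin n) ℂ *ᵥ d = r x

theorem LocACOn.add {f g : ℝ → Vec n} {s : Set ℝ} (hf : LocACOn f s) (hg : LocACOn g s) :
    LocACOn (f + g) s :=
  fun a b hab hs => (hf a b hab hs).add (hg a b hab hs)

theorem LocACOn.smul {f : ℝ → Vec n} {s : Set ℝ} (c : ℂ) (hf : LocACOn f s) :
    LocACOn (c • f) s :=
  fun a b hab hs => (hf a b hab hs).const_smul c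

theorem locACOn_zero (s : Set ℝ) : LocACOn (0 : ℝ → Vec n) s := by
  intro a b _ _
  rw [absolutelyContinuousOnInterval_iff]
  intro ε hε
  exact ⟨1, one_pos, fun E _ _ => by simpa using hε⟩

theorem JDerivEq.add {f g r s : ℝ → Vec n} (hf : JDerivEq f r) (hg : JDerivEq g s) :
    JDerivEq (f + g) (r + s) := by
  filter_upwards [hf, hg] with x ⟨d, hd, hd'⟩ ⟨e, he, he'⟩
  exact ⟨d + e, hd.add he, by rw [mulVec_add, hd', he']; rfl⟩

theorem JDerivEq.smul {f r : ℝ → Vec n} (c : ℂ) (hf : JDerivEq f r) :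
    JDerivEq (c • f) (c • r) := by
  filter_upwards [hf] with x ⟨d, hd, hd'⟩
  exact ⟨c • d, hd.const_smul c, by rw [mulVec_smul, hd']; rfl⟩

theorem jDerivEq_zero : JDerivEq (0 : ℝ → Vec n) 0 :=
  Filter.Eventually.of_forall fun x => ⟨0, hasDerivAt_const x 0, by simp⟩

/-! ### The maximal relation, deficiency indices, and the boundary condition -/

/-- The pairs `(F, G)` in `L²_H ⊕ L²_H` for which `F` has a representative `f₀` that is locally
absolutely continuous on `s`, satisfies `J f₀' = -H G` almost everywhere on `(0, ∞)`, and has its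
value `f₀(0)` in the subspace `B`. -/
def Hamiltonian.relationOn (H : Hamiltonian n) (s : Set ℝ) (B : Submodule ℂ (Vec n)) :
    Submodule ℂ (H.L2 × H.L2) where
  carrier := {p | ∃ f₀ g : ℝ → Vec n, H.Represents f₀ p.1 ∧ H.Represents g p.2 ∧
    LocACOn f₀ s ∧ JDerivEq f₀ (fun x => -(H x *ᵥ g x)) ∧ f₀ 0 ∈ B}
  zero_mem' := ⟨0, 0, represents_zero H, represents_zero H, locACOn_zero s,
    by simpa using! (jDerivEq_zero (n := n)), zero_mem B⟩
  add_mem' := by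
    rintro ⟨F, G⟩ ⟨F', G'⟩ ⟨f, g, h1, h2, h3, h4, h5⟩ ⟨f', g', h1', h2', h3', h4', h5'⟩
    refine ⟨f + f', g + g', h1.add h1', h2.add h2', h3.add h3', ?_, add_mem h5 h5'⟩
    convert h4.add h4' using 1
    funext x
    simp only [Pi.add_apply, mulVec_add, neg_add]
  smul_mem' := by
    rintro c ⟨F, G⟩ ⟨f, g, h1, h2, h3, h4, h5⟩
    refine ⟨c • f, c • g, h1.smul c, h2.smul c, h3.smul c, ?_, B.smul_mem c h5⟩
    convert h4.smul c using 1
    funext x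
    simp only [Pi.smul_apply, mulVec_smul, smul_neg]

/-- The maximal relation on `(0, ∞)`. -/
def Hamiltonian.maximalRelation (H : Hamiltonian n) : Submodule ℂ (H.L2 × H.L2) :=
  H.relationOn (Ioi 0) ⊤

/-- The deficiency indices `dim ker (T - i)` and `dim ker (T + i)` are both equal to `d`. -/
def Hamiltonian.DeficiencyIndicesEq (H : Hamiltonian n) (d : ℕ) : Prop :=
  Module.rank ℂ (relKer (relSub H.maximalRelation Complex.I)) = d ∧
  Module.rank ℂ (relKer (relSub H.maximalRelation (-Complex.I))) = d

/-- The relation `{(f, g) ∈ T : α f₀(0) = 0}` for the regular endpoint `0`. There the absolutely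
continuous representative `f₀` extends to an absolutely continuous function on `[0, ∞)`, and
`f₀(0)` is the value of that extension. -/
def Hamiltonian.boundaryRelation (H : Hamiltonian n) (α : Matrix (Fin n) (Fin n ⊕ Fin n) ℂ) :
    Submodule ℂ (H.L2 × H.L2) :=
  H.relationOn (Ici 0) (LinearMap.ker α.mulVecLin)

/-! ### Solutions, the Weyl solution, and the Green function -/

/-- Matrices with `2n` rows and `n` columns. -/
abbrev Mat (n : ℕ) : Type := Matrix (Fin n ⊕ Fin n) (Fin n) ℂ

/-- Each column of `U` is a solution of `J y' = -z H y` on `[0, ∞)`. -/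
def Hamiltonian.IsMatrixSolution (H : Hamiltonian n) (z : ℂ) (U : ℝ → Mat n) : Prop :=
  ∀ j, LocACOn (fun x => (U x).col j) (Ici 0) ∧
    JDerivEq (fun x => (U x).col j) (fun x => -(z • (H x *ᵥ (U x).col j)))

/-- The function `f_m(x, z) = v(x, z) + u(x, z) m(z)`, in the order of arguments `x`, `z`. -/
def weylSolution (u v : ℝ → ℂ → Mat n) (m : ℂ → Matrix (Fin n) (Fin n) ℂ) (x : ℝ) (z : ℂ) :
    Mat n :=
  v x z + u x z * m z

/-- `u` and `v` are the solutions of `J y' = -z H y` with `u(0, z) = -J α*` and `v(0, z) = α*`,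
and, for nonreal `z`, `m(z)` is a matrix for which the columns of `v + u m(z)` belong to
`L²_H(0, ∞)`. -/
structure Hamiltonian.IsWeylSystem (H : Hamiltonian n) (α : Matrix (Fin n) (Fin n ⊕ Fin n) ℂ)
    (u v : ℝ → ℂ → Mat n) (m : ℂ → Matrix (Fin n) (Fin n) ℂ) : Prop where
  u_solution : ∀ z, H.IsMatrixSolution z (fun x => u x z)
  u_zero : ∀ z, u 0 z = -(Matrix.J (Fin n) ℂ * αᴴ)
  v_solution : ∀ z, H.IsMatrixSolution z (fun x => v x z)
  v_zero : ∀ z, v 0 z = αᴴ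
  weyl : ∀ z : ℂ, z.im ≠ 0 → ∀ j, (fun x => (weylSolution u v m x z).col j) ∈ H.preL2

/-- The Green function
`G(x, y, z) = u(x, z) f_m(y, z̄)*` for `x ≤ y` and `f_m(x, z) u(y, z̄)*` for `x > y`. -/
def greenFunction (u v : ℝ → ℂ → Mat n) (m : ℂ → Matrix (Fin n) (Fin n) ℂ) (x y : ℝ) (z : ℂ) :
    Matrix (Fin n ⊕ Fin n) (Fin n ⊕ Fin n) ℂ :=
  if x ≤ y then u x z * (weylSolution u v m y (starRingEnd ℂ z))ᴴ
  else weylSolution u v m x z * (u y (starRingEnd ℂ z))ᴴ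

/-- The function `g(x) = ∫₀^∞ G(x, y, z) H(y) h(y) dy`. -/
def Hamiltonian.greenIntegral (H : Hamiltonian n) (u v : ℝ → ℂ → Mat n)
    (m : ℂ → Matrix (Fin n) (Fin n) ℂ) (z : ℂ) (h : ℝ → Vec n) (x : ℝ) : Vec n :=
  ∫ y in Ioi (0 : ℝ), greenFunction u v m x y z *ᵥ (H y *ᵥ h y)

end CanonicalSystem

end

/-! The Green integral is shown to solve the boundary value problem by variation of constants, to be
square integrable by an energy estimate, and to be unique because the boundary form `f* J k`
vanishes at infinity.

Everything rests on Lagrange's identity for the form `jform a b = a* J b`. At conjugate spectral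
parameters it makes `y'* J y` constant in `x`. The initial values then fix the Gram matrices of `u`,
`v` on the whole half line, and inverting them gives `V U'* - U V'* = J` (`frame_identity`), which
is what variation of constants needs. At one parameter it becomes the energy identity: `Im (y* J y)`
decreases by `2 Im z` times the energy `∫ y* H y` (`Hamiltonian.Pair.energy`).

The vanishing at infinity is not assumed; it has to be extracted from the deficiency indices. Weyl's
construction first yields, with no use of the indices, a matrix `m` for which the boundary forms of
`V + U m` and, at the conjugate parameter, of `V' + U' m*` have the sign of the imaginary part. It
is found in the intersection of a decreasing sequence of compact sets, each containing matrices from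
self-adjoint problems on bounded intervals (`exists_signDefinite`). For such an `m` the Green
operator maps `L²_H` to itself with norm at most `1 / |Im z|` (`greenSol_sqNorm_le`).

Since the deficiency indices equal `n`, the columns of `V + U m` at `±i` span all square integrable
solutions. Every element of the maximal relation is then a Green integral plus a Weyl solution. For
two Green integrals the form tends to zero, by a density argument from data of bounded support
(`tendsto_jform_greenSol`); the Weyl solutions contribute only terms that also tend to zero
(`limit_point`).

Once the form vanishes at infinity, any `m(z)` with square integrable columns has the right signs
and satisfies `m(z̄) = m(z)*` (`IsWeylSystem.weylData`). So the Green operator estimates apply to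
the given `m`. Two values of the resolvent differ by a square integrable homogeneous solution with
`α y(0) = 0`, and the energy identity gives it norm zero. Definiteness of `H` finally singles out
one representative. -/

noncomputable section

namespace CanonicalSystem

/-! ### Absolutely continuous functions with values in normed spaces -/

section AC

open Filter Topology AbsolutelyContinuousOnInterval

variable {E F : Type*} [NormedAddCommGroup E] [NormedAddCommGroup F]

/-- Each sum of increments of `f` is at most `K` times the corresponding sum for `g`. Comparing
increments covers linear images, components, Lipschitz compositions and primitives alike. -/
theorem ac_of_dist_le {X Y : Type*} [PseudoMetricSpace X] [PseudoMetricSpace Y]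
    {f : ℝ → X} {g : ℝ → Y} {a b K : ℝ}
    (hg : AbsolutelyContinuousOnInterval g a b)
    (h : ∀ x ∈ uIcc a b, ∀ y ∈ uIcc a b, dist (f x) (f y) ≤ K * dist (g x) (g y)) :
    AbsolutelyContinuousOnInterval f a b := by
  have h1 := Filter.Tendsto.const_mul K hg
  rw [mul_zero] at h1
  refine squeeze_zero' (Eventually.of_forall fun E => Finset.sum_nonneg fun _ _ => dist_nonneg)
    ?_ h1
  have h2 : ∀ᶠ E in totalLengthFilter ⊓ 𝓟 (disjWithin a b), E ∈ disjWithin a b :=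
    eventually_inf_principal.mpr (by simp)
  filter_upwards [h2] with E hE
  rw [Finset.mul_sum]
  exact Finset.sum_le_sum fun i hi => h _ (hE.1 i hi).1 _ (hE.1 i hi).2

theorem ac_congr {X : Type*} [PseudoMetricSpace X] {f g : ℝ → X} {a b : ℝ}
    (hg : AbsolutelyContinuousOnInterval g a b) (h : EqOn f g (uIcc a b)) :
    AbsolutelyContinuousOnInterval f a b :=
  ac_of_dist_le (K := 1) hg fun x hx y hy => by rw [h hx, h hy, one_mul]

theorem ac_clm {𝕜 : Type*} [NontriviallyNormedField 𝕜] [NormedSpace 𝕜 E] [NormedSpace 𝕜 F]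
    (L : E →L[𝕜] F) {f : ℝ → E} {a b : ℝ}
    (hf : AbsolutelyContinuousOnInterval f a b) :
    AbsolutelyContinuousOnInterval (fun x => L (f x)) a b :=
  ac_of_dist_le hf fun x _ y _ => L.lipschitz.dist_le_mul (f x) (f y)

theorem ac_const {X : Type*} [PseudoMetricSpace X] (c : X) (a b : ℝ) :
    AbsolutelyContinuousOnInterval (fun _ => c) a b := by
  rw [absolutelyContinuousOnInterval_iff]
  intro ε hε
  exact ⟨1, one_pos, fun E _ _ => by simpa using hε⟩

theorem ac_sum {ι : Type*} (s : Finset ι) {f : ι → ℝ → E} {a b : ℝ}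
    (hf : ∀ i ∈ s, AbsolutelyContinuousOnInterval (f i) a b) :
    AbsolutelyContinuousOnInterval (fun x => ∑ i ∈ s, f i x) a b := by
  classical
  induction s using Finset.induction_on with
  | empty => simpa using ac_const (0 : E) a b
  | insert i s hi ih =>
    simp only [Finset.sum_insert hi]
    exact (hf i (Finset.mem_insert_self _ _)).fun_add
      (ih fun j hj => hf j (Finset.mem_insert_of_mem hj))

variable [NormedSpace ℝ E]

/-- The increments of the primitive are bounded by those of the primitive of `‖f‖`, which reduces
the claim to real functions. -/
theorem ac_integral {f : ℝ → E} {a b c : ℝ} (h : IntervalIntegrable f volume a b)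
    (hc : c ∈ uIcc a b) :
    AbsolutelyContinuousOnInterval (fun x => ∫ v in c..x, f v) a b := by
  refine ac_of_dist_le (K := 1)
    (h.norm.absolutelyContinuousOnInterval_intervalIntegral hc) fun x hx y hy => ?_
  have hi : ∀ t ∈ uIcc a b, IntervalIntegrable f volume c t := fun t ht =>
    h.mono_set (uIcc_subset_uIcc hc ht)
  rw [dist_eq_norm, Real.dist_eq, one_mul,
    intervalIntegral.integral_interval_sub_left (hi x hx) (hi y hy),
    intervalIntegral.integral_interval_sub_left (hi x hx).norm (hi y hy).norm]
  exact intervalIntegral.norm_integral_le_abs_integral_norm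

/-- Subtracting the primitive of `f'` leaves an absolutely continuous function with derivative zero
almost everywhere, hence a constant. -/
theorem ac_ftc [CompleteSpace E] {f f' : ℝ → E} {a b : ℝ}
    (hf : AbsolutelyContinuousOnInterval f a b)
    (hd : ∀ᵐ x, x ∈ uIcc a b → HasDerivAt f (f' x) x)
    (hi : IntervalIntegrable f' volume a b) :
    ∫ x in a..b, f' x = f b - f a := by
  have hac := hf.fun_sub (ac_integral hi (left_mem_uIcc (a := a) (b := b)))
  have h0 : ∀ᵐ x, x ∈ uIcc a b → HasDerivAt (fun x => f x - ∫ t in a..x, f' t) 0 x := by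
    filter_upwards [hd, hi.ae_hasDerivAt_integral] with x hx₁ hx₂ hx₃
    convert! (hx₁ hx₃).sub (hx₂ hx₃ a (by simp)) using 1
    abel
  obtain ⟨C, hC⟩ := hac.const_of_ae_hasDerivAt_zero h0
  have h1 := hC a (by simp)
  have h2 := hC b (by simp)
  simp only [intervalIntegral.integral_same, sub_zero] at h1
  rw [h1, ← h2, sub_sub_cancel]

end AC

/-! ### Linear Volterra equations with locally integrable coefficients -/

section Volterra

open scoped BoundedContinuousFunction NNReal

variable {E : Type*} [NormedAddCommGroup E] [NormedSpace ℝ E] [CompleteSpace E]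

/-- The integrand is almost everywhere the derivative of `exp (2 A) / 2`, with `A` the primitive of
`a`. The factor 2 in the exponent becomes the contraction constant 1/2 for Volterra equations. -/
theorem integral_mul_exp_eq {a : ℝ → ℝ} (hi : ∀ p q, IntervalIntegrable a volume p q)
    (x : ℝ) :
    ∫ t in 0..x, a t * Real.exp (2 * ∫ s in 0..t, a s) =
      (Real.exp (2 * ∫ s in 0..x, a s) - 1) / 2 := by
  set A : ℝ → ℝ := fun t => ∫ s in 0..t, a s with hA
  have hAc : Continuous A := intervalIntegral.continuous_primitive hi 0
  have hAac : AbsolutelyContinuousOnInterval A 0 x := ac_integral (hi 0 x) left_mem_uIcc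
  -- The exponential is Lipschitz only on bounded sets, so the bound is taken on a ball containing
  -- the compact range of `A`.
  obtain ⟨K, hK⟩ : ∃ K, LipschitzOnWith K (fun s : ℝ => Real.exp (2 * s) / 2) (A '' uIcc 0 x) := by
    obtain ⟨M, hM⟩ := (isCompact_uIcc.image hAc).isBounded.subset_closedBall (0 : ℝ)
    have hsm : ContDiffOn ℝ 1 (fun s : ℝ => Real.exp (2 * s) / 2) (Metric.closedBall 0 M) := by
      fun_prop
    obtain ⟨K, hK⟩ := hsm.exists_lipschitzOnWith (by decide) (convex_closedBall _ _)
      (isCompact_closedBall _ _)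
    exact ⟨K, hK.mono hM⟩
  have hac : AbsolutelyContinuousOnInterval (fun t => Real.exp (2 * A t) / 2) 0 x :=
    ac_of_dist_le hAac fun s hs t ht =>
      hK.dist_le_mul _ (mem_image_of_mem _ hs) _ (mem_image_of_mem _ ht)
  have hd : ∀ᵐ t, t ∈ uIcc 0 x →
      HasDerivAt (fun t => Real.exp (2 * A t) / 2) (a t * Real.exp (2 * A t)) t := by
    filter_upwards [(hi 0 x).ae_hasDerivAt_integral] with t ht htx
    have h1 := ((ht htx 0 left_mem_uIcc).const_mul 2).exp.div_const 2
    convert! h1 using 1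
    simp only [hA]
    ring
  have hint : IntervalIntegrable (fun t => a t * Real.exp (2 * A t)) volume 0 x :=
    (hi 0 x).mul_continuousOn (by fun_prop)
  rw [ac_ftc hac hd hint]
  simp [hA]
  ring

/-- In the unknown `w = exp (-2ρ) y`, with `ρ` the primitive of `‖A‖`, the integral operator is a
contraction of the bounded continuous functions on the whole line, so one fixed point is a global
solution. The vanishing of `A` for `t ≤ 0` gives `ρ ≥ 0` there too. -/
theorem exists_volterra_solution {𝕜 : Type*} [NontriviallyNormedField 𝕜] [NormedSpace 𝕜 E]
    {A : ℝ → E →L[𝕜] E} (hAi : ∀ p q, IntervalIntegrable A volume p q)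
    (hA0 : ∀ t ≤ 0, A t = 0) (c : E) :
    ∃ y : ℝ → E, Continuous y ∧ ∀ x, y x = c + ∫ t in 0..x, A t (y t) := by
  set ρ : ℝ → ℝ := fun x => ∫ s in 0..x, ‖A s‖ with hρ
  have hρc : Continuous ρ :=
    intervalIntegral.continuous_primitive (fun p q => (hAi p q).norm) 0
  have hρneg : ∀ x ≤ 0, ρ x = 0 := fun x hx => by
    simp only [hρ]
    rw [intervalIntegral.integral_symm, intervalIntegral.integral_zero_ae, neg_zero]
    refine Filter.Eventually.of_forall fun t ht => ?_
    rw [uIoc_of_le hx] at ht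
    rw [hA0 t ht.2, norm_zero]
  have hρ0 : ∀ x, 0 ≤ ρ x := fun x => by
    rcases le_total 0 x with hx | hx
    · exact intervalIntegral.integral_nonneg hx fun _ _ => norm_nonneg _
    · rw [hρneg x hx]
  have hwi : ∀ (w : ℝ → E), Continuous w → ∀ p q,
      IntervalIntegrable (fun t => A t (w t)) volume p q := by
    intro w hw p q
    rw [intervalIntegrable_iff]
    obtain ⟨M, hM⟩ := isCompact_uIcc.exists_bound_of_continuousOn (s := uIcc p q) hw.continuousOn
    have h1 : Integrable A (volume.restrict (uIoc p q)) := intervalIntegrable_iff.1 (hAi p q)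
    refine Integrable.mono' (h1.norm.mul_const M) ?_ ?_
    · exact (isBoundedBilinearMap_apply (𝕜 := 𝕜)).continuous.comp_aestronglyMeasurable
        (h1.aestronglyMeasurable.prodMk hw.aestronglyMeasurable)
    · filter_upwards [ae_restrict_mem measurableSet_uIoc] with t ht
      exact ((A t).le_opNorm _).trans
        (mul_le_mul_of_nonneg_left (hM t (uIoc_subset_uIcc ht)) (norm_nonneg _))
  -- Since `∫ ‖A‖ exp (2ρ) = (exp (2ρ) - 1) / 2`, the weight `exp (-2ρ)` leaves at most half of the
  -- bound on `w`.
  have key : ∀ (w : ℝ → E), Continuous w → ∀ C, (∀ t, ‖w t‖ ≤ C) → ∀ x,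
      Real.exp (-(2 * ρ x)) * ‖∫ t in 0..x, A t (Real.exp (2 * ρ t) • w t)‖ ≤ C / 2 := by
    intro w hw C hC x
    have hC0 : 0 ≤ C := (norm_nonneg _).trans (hC 0)
    rcases le_total 0 x with hx | hx
    · have h1 : ‖∫ t in 0..x, A t (Real.exp (2 * ρ t) • w t)‖ ≤
          ∫ t in 0..x, C * (‖A t‖ * Real.exp (2 * ρ t)) := by
        refine intervalIntegral.norm_integral_le_of_norm_le hx
          (Filter.Eventually.of_forall fun t _ => ?_)
          (((hAi 0 x).norm.mul_continuousOn (by fun_prop)).const_mul C)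
        refine ((A t).le_opNorm _).trans ?_
        rw [norm_smul, Real.norm_of_nonneg (Real.exp_pos _).le]
        have := mul_le_mul_of_nonneg_left (hC t)
          (mul_nonneg (norm_nonneg (A t)) (Real.exp_pos (2 * ρ t)).le)
        linarith
      rw [intervalIntegral.integral_const_mul,
        integral_mul_exp_eq (fun p q => (hAi p q).norm) x] at h1
      have h2 := mul_le_mul_of_nonneg_left h1 (Real.exp_pos (-(2 * ρ x))).le
      refine h2.trans ?_
      have h3 : Real.exp (-(2 * ρ x)) * Real.exp (2 * ρ x) = 1 := by
        rw [← Real.exp_add, neg_add_cancel, Real.exp_zero]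
      have h4 := mul_nonneg hC0 (Real.exp_pos (-(2 * ρ x))).le
      calc _ = C * (Real.exp (-(2 * ρ x)) * Real.exp (2 * ρ x) - Real.exp (-(2 * ρ x))) / 2 := by
            simp only [hρ]; ring
        _ ≤ C / 2 := by rw [h3]; linarith
    · rw [intervalIntegral.integral_symm, intervalIntegral.integral_zero_ae]
      · simp; linarith
      · refine Filter.Eventually.of_forall fun t ht => ?_
        rw [uIoc_of_le hx] at ht
        rw [hA0 t ht.2]
        simp
  have hexpi : ∀ (w : ℝ → E), Continuous w → Continuous fun t => Real.exp (2 * ρ t) • w t :=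
    fun w hw => (Real.continuous_exp.comp (by fun_prop)).smul hw
  let T : (ℝ →ᵇ E) → (ℝ →ᵇ E) := fun w =>
    BoundedContinuousFunction.ofNormedAddCommGroup
      (fun x => Real.exp (-(2 * ρ x)) • (c + ∫ t in 0..x, A t (Real.exp (2 * ρ t) • w t)))
      ((Real.continuous_exp.comp (by fun_prop)).smul (continuous_const.add
        (intervalIntegral.continuous_primitive (hwi _ (hexpi w w.continuous)) 0)))
      (‖c‖ + ‖w‖ / 2) (fun x => by
        rw [norm_smul, Real.norm_of_nonneg (Real.exp_pos _).le]
        have h1 := key w w.continuous ‖w‖ w.norm_coe_le_norm x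
        have h2 : Real.exp (-(2 * ρ x)) ≤ 1 := Real.exp_le_one_iff.2 (by linarith [hρ0 x])
        have h3 := norm_add_le c (∫ t in 0..x, A t (Real.exp (2 * ρ t) • w t))
        have h4 := mul_le_mul_of_nonneg_left h3 (Real.exp_pos (-(2 * ρ x))).le
        have h5 := mul_le_mul_of_nonneg_right h2 (norm_nonneg c)
        linarith)
  have hT : ContractingWith (1 / 2 : ℝ≥0) T := by
    refine ⟨by norm_num, LipschitzWith.of_dist_le_mul fun w₁ w₂ => ?_⟩
    rw [BoundedContinuousFunction.dist_le (by positivity)]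
    intro x
    have h1 := key (fun t => w₁ t - w₂ t) (w₁.continuous.sub w₂.continuous) (dist w₁ w₂)
      (fun t => by rw [← dist_eq_norm]; exact BoundedContinuousFunction.dist_coe_le_dist t) x
    have h2 : T w₁ x - T w₂ x = Real.exp (-(2 * ρ x)) •
        ∫ t in 0..x, A t (Real.exp (2 * ρ t) • (w₁ t - w₂ t)) := by
      simp only [T, BoundedContinuousFunction.coe_ofNormedAddCommGroup]
      rw [← smul_sub, add_sub_add_left_eq_sub,
        ← intervalIntegral.integral_sub (hwi _ (hexpi w₁ w₁.continuous) 0 x)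
          (hwi _ (hexpi w₂ w₂.continuous) 0 x)]
      simp only [smul_sub, map_sub]
    rw [dist_eq_norm, h2, norm_smul, Real.norm_of_nonneg (Real.exp_pos _).le]
    refine h1.trans (le_of_eq ?_)
    push_cast
    ring
  have hfix := hT.fixedPoint_isFixedPt
  set w := ContractingWith.fixedPoint T hT
  refine ⟨fun x => Real.exp (2 * ρ x) • w x, hexpi w w.continuous, fun x => ?_⟩
  have h1 : w x = Real.exp (-(2 * ρ x)) • (c + ∫ t in 0..x, A t (Real.exp (2 * ρ t) • w t)) := by
    conv_lhs => rw [← hfix.eq]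
    rfl
  show Real.exp (2 * ρ x) • w x = _
  rw [h1, smul_smul, ← Real.exp_add, add_neg_cancel, Real.exp_zero, one_smul]

end Volterra

end CanonicalSystem

namespace CanonicalSystem

variable {n : ℕ}

/-! ### Sesquilinear forms -/

/-- The boundary form `a* J b`. -/
def jform (a b : Vec n) : ℂ := star a ⬝ᵥ (Matrix.J (Fin n) ℂ *ᵥ b)

/-- The density `f* H k` of the inner product of `L²_H`. -/
def Hamiltonian.ip (H : Hamiltonian n) (f k : ℝ → Vec n) (x : ℝ) : ℂ :=
  star (f x) ⬝ᵥ (H x *ᵥ k x)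

/-- Choose a unimodular `θ` with `θ (a* M b) = |a* M b|` and expand the nonnegative form at `a - θ
b`. -/
theorem norm_form_le {M : Matrix (Fin n ⊕ Fin n) (Fin n ⊕ Fin n) ℂ} (hM : M.PosSemidef)
    (a b : Vec n) :
    ‖star a ⬝ᵥ (M *ᵥ b)‖ ≤ ((star a ⬝ᵥ (M *ᵥ a)).re + (star b ⬝ᵥ (M *ᵥ b)).re) / 2 := by
  set w := star a ⬝ᵥ (M *ᵥ b) with hw
  have hsymm : star b ⬝ᵥ (M *ᵥ a) = star w := by
    rw [hw, star_dotProduct, star_mulVec, hM.isHermitian.eq, ← dotProduct_mulVec]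
  obtain ⟨θ, hθ, hθw⟩ : ∃ θ : ℂ, ‖θ‖ = 1 ∧ θ * w = ‖w‖ := by
    by_cases h0 : w = 0
    · exact ⟨1, by simp, by simp [h0]⟩
    · have h1 : (‖w‖ : ℂ) ≠ 0 := by simpa using h0
      refine ⟨star w / ‖w‖, by simp [h0], ?_⟩
      rw [div_mul_eq_mul_div, Complex.star_def, Complex.conj_mul', pow_two, mul_div_assoc,
        div_self h1, mul_one]
  have h := hM.re_dotProduct_nonneg (a - θ • b)
  have h2 : (star (a - θ • b) ⬝ᵥ (M *ᵥ (a - θ • b))) =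
      star a ⬝ᵥ (M *ᵥ a) - θ * w - star (θ * w) + (star θ * θ) * (star b ⬝ᵥ (M *ᵥ b)) := by
    simp only [star_sub, mulVec_sub, sub_dotProduct, dotProduct_sub, star_smul, mulVec_smul,
      smul_dotProduct, dotProduct_smul, smul_eq_mul, hsymm, ← hw, star_mul']
    ring
  have h3 : star θ * θ = 1 := by
    rw [Complex.star_def, Complex.conj_mul', hθ]; simp
  rw [h2, hθw, h3] at h
  simp at h
  linarith

theorem star_mulVec_dotProduct {M : Matrix (Fin n ⊕ Fin n) (Fin n ⊕ Fin n) ℂ}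
    (hM : M.IsHermitian) (a b : Vec n) : star (M *ᵥ a) ⬝ᵥ b = star a ⬝ᵥ (M *ᵥ b) := by
  rw [star_mulVec, hM.eq, ← dotProduct_mulVec]

theorem star_form {M : Matrix (Fin n ⊕ Fin n) (Fin n ⊕ Fin n) ℂ}
    (hM : M.IsHermitian) (a b : Vec n) :
    star (star a ⬝ᵥ (M *ᵥ b)) = star b ⬝ᵥ (M *ᵥ a) := by
  rw [← star_dotProduct, star_mulVec_dotProduct hM]

theorem J_mulVec_J_mulVec (a : Vec n) : Matrix.J (Fin n) ℂ *ᵥ (Matrix.J (Fin n) ℂ *ᵥ a) = -a := by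
  rw [mulVec_mulVec, Matrix.J_squared, neg_mulVec, one_mulVec]

theorem J_conjTranspose : (Matrix.J (Fin n) ℂ)ᴴ = -Matrix.J (Fin n) ℂ := by
  simp [Matrix.J, fromBlocks_conjTranspose, fromBlocks_neg]

theorem star_J_mulVec_dotProduct (a b : Vec n) :
    star (Matrix.J (Fin n) ℂ *ᵥ a) ⬝ᵥ b = -jform a b := by
  rw [star_mulVec, J_conjTranspose, ← dotProduct_mulVec, neg_mulVec, dotProduct_neg, jform]

theorem jform_add_left (a b c : Vec n) : jform (a + b) c = jform a c + jform b c := by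
  simp [jform, add_dotProduct]

theorem jform_add_right (a b c : Vec n) : jform a (b + c) = jform a b + jform a c := by
  simp [jform, mulVec_add]

/-! ### Almost everywhere statements on the half line -/

theorem ae_uIcc_of_ae_halfLine {p : ℝ → Prop} (h : ∀ᵐ x ∂halfLine, p x) {a b : ℝ} (ha : 0 ≤ a)
    (hb : 0 ≤ b) : ∀ᵐ x, x ∈ uIcc a b → p x := by
  have h1 := (ae_restrict_iff' measurableSet_Ioi).1 h
  filter_upwards [h1, Measure.ae_ne volume (0 : ℝ)] with x hx hx0 hxab
  exact hx (lt_of_le_of_ne ((le_min ha hb).trans hxab.1) hx0.symm)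

theorem ae_uIoc_of_ae_halfLine {p : ℝ → Prop} (h : ∀ᵐ x ∂halfLine, p x) {a b : ℝ} (ha : 0 ≤ a)
    (hb : 0 ≤ b) : ∀ᵐ x, x ∈ uIoc a b → p x := by
  filter_upwards [ae_uIcc_of_ae_halfLine h ha hb] with x hx hxab
  exact hx (uIoc_subset_uIcc hxab)

/-! ### The Lagrange identity -/

theorem LocACOn.ac {f : ℝ → Vec n} (hf : LocACOn f (Ici 0)) {a b : ℝ} (ha : 0 ≤ a) (hb : 0 ≤ b) :
    AbsolutelyContinuousOnInterval f a b :=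
  (hf _ _ (min_le_max (a := a) (b := b)) fun _ hx => (le_min ha hb).trans hx.1).mono (by
    rw [uIcc_of_le min_le_max]; exact subset_rfl)

theorem LocACOn.continuousOn {f : ℝ → Vec n} (hf : LocACOn f (Ici 0)) {b : ℝ} (hb : 0 ≤ b) :
    ContinuousOn f (Icc 0 b) := by
  have := (hf.ac le_rfl hb).continuousOn
  rwa [uIcc_of_le hb] at this

theorem ac_jform {f k : ℝ → Vec n} {a b : ℝ}
    (hf : AbsolutelyContinuousOnInterval f a b) (hk : AbsolutelyContinuousOnInterval k a b) :
    AbsolutelyContinuousOnInterval (fun x => jform (f x) (k x)) a b := by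
  simp only [jform, dotProduct, Pi.star_apply]
  refine ac_sum _ fun i _ => ?_
  have h1 : AbsolutelyContinuousOnInterval (fun x => star (f x i)) a b :=
    ac_of_dist_le (K := 1) hf fun x _ y _ => by
      rw [one_mul, Complex.star_def, Complex.dist_conj_conj]
      exact dist_le_pi_dist (f x) (f y) i
  have h2 : AbsolutelyContinuousOnInterval (fun x => (Matrix.J (Fin n) ℂ *ᵥ k x) i) a b :=
    ac_clm ((LinearMap.proj i ∘ₗ (Matrix.J (Fin n) ℂ).mulVecLin).toContinuousLinearMap) hk
  exact h1.fun_smul h2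

theorem hasDerivAt_jform {f k : ℝ → Vec n} {d e : Vec n} {x : ℝ} (hf : HasDerivAt f d x)
    (hk : HasDerivAt k e x) :
    HasDerivAt (fun x => jform (f x) (k x)) (jform d (k x) + jform (f x) e) x := by
  simp only [jform, dotProduct, Pi.star_apply]
  rw [← Finset.sum_add_distrib]
  refine HasDerivAt.fun_sum fun i _ => ?_
  have h1 : HasDerivAt (fun x => star (f x i)) (star (d i)) x := (hasDerivAt_pi.1 hf i).star
  have h2 : HasDerivAt (fun x => (Matrix.J (Fin n) ℂ *ᵥ k x) i) ((Matrix.J (Fin n) ℂ *ᵥ e) i) x :=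
    ((LinearMap.proj i ∘ₗ (Matrix.J (Fin n) ℂ).mulVecLin).toContinuousLinearMap.restrictScalars
      ℝ).hasFDerivAt.comp_hasDerivAt x hk
  exact h1.mul h2

/-- As `J* = -J`, the derivative of `f* J k` is `f* (J k') - (J f')* k` almost everywhere. -/
theorem lagrange_identity {f k r s : ℝ → Vec n} (hf : LocACOn f (Ici 0)) (hk : LocACOn k (Ici 0))
    (hfr : JDerivEq f r) (hks : JDerivEq k s) {a b : ℝ} (ha : 0 ≤ a) (hb : 0 ≤ b)
    (hi : IntervalIntegrable (fun x => star (f x) ⬝ᵥ s x - star (r x) ⬝ᵥ k x) volume a b) :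
    ∫ x in a..b, (star (f x) ⬝ᵥ s x - star (r x) ⬝ᵥ k x) =
      jform (f b) (k b) - jform (f a) (k a) := by
  refine ac_ftc (ac_jform (hf.ac ha hb) (hk.ac ha hb)) ?_ hi
  filter_upwards [ae_uIcc_of_ae_halfLine hfr ha hb, ae_uIcc_of_ae_halfLine hks ha hb]
    with x h1 h2 hx
  obtain ⟨d, hd, hd'⟩ := h1 hx
  obtain ⟨e, he, he'⟩ := h2 hx
  convert! hasDerivAt_jform hd he using 1
  rw [← hd', ← he', star_J_mulVec_dotProduct]
  simp only [jform]
  ring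

theorem LocACOn.eq_of_jDerivEq_zero {f r : ℝ → Vec n} (hf : LocACOn f (Ici 0))
    (hfr : JDerivEq f r) {b : ℝ} (hb : 0 ≤ b) (hr : ∀ᵐ x, x ∈ Ioc 0 b → r x = 0) :
    ∀ x ∈ Icc 0 b, f x = f 0 := by
  have h0 : ∀ᵐ x, x ∈ uIcc 0 b → HasDerivAt f 0 x := by
    filter_upwards [ae_uIcc_of_ae_halfLine hfr le_rfl hb, hr, Measure.ae_ne volume (0 : ℝ)]
      with x h1 h2 h3 hx
    obtain ⟨d, hd, hd'⟩ := h1 hx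
    rw [uIcc_of_le hb] at hx
    rw [h2 ⟨lt_of_le_of_ne hx.1 h3.symm, hx.2⟩] at hd'
    have h4 := J_mulVec_J_mulVec d
    rw [hd', mulVec_zero] at h4
    rwa [neg_eq_zero.1 h4.symm] at hd
  obtain ⟨C, hC⟩ := (hf.ac le_rfl hb).const_of_ae_hasDerivAt_zero h0
  rw [uIcc_of_le hb] at hC
  exact fun x hx => by rw [hC x hx, hC 0 ⟨le_rfl, hb⟩]

/-! ### Square integrable and locally square integrable functions -/

section L2

variable (H : Hamiltonian n)

theorem aestronglyMeasurable_ip {f k : ℝ → Vec n} (hf : AEStronglyMeasurable f halfLine)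
    (hk : AEStronglyMeasurable k halfLine) : AEStronglyMeasurable (H.ip f k) halfLine := by
  have hH : ∀ i j, AEStronglyMeasurable (fun x => H x i j) halfLine := fun i j =>
    (H.locallyIntegrable i j).aestronglyMeasurable
  have hc : ∀ {f : ℝ → Vec n}, AEStronglyMeasurable f halfLine →
      ∀ i, AEStronglyMeasurable (fun x => f x i) halfLine := fun hf i =>
    (continuous_apply i).comp_aestronglyMeasurable hf
  unfold Hamiltonian.ip
  simp only [dotProduct, mulVec, Pi.star_apply]
  refine Finset.aestronglyMeasurable_fun_sum _ fun i _ => (hc hf i).star.mul ?_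
  exact Finset.aestronglyMeasurable_fun_sum _ fun j _ => (hH i j).mul (hc hk j)

theorem ip_self_nonneg (f : ℝ → Vec n) : ∀ᵐ x ∂halfLine, 0 ≤ (H.ip f f x).re := by
  filter_upwards [H.posSemidef] with x hx
  exact hx.re_dotProduct_nonneg (f x)

theorem star_ip (f k : ℝ → Vec n) : ∀ᵐ x ∂halfLine, star (H.ip f k x) = H.ip k f x := by
  filter_upwards [H.posSemidef] with x hx
  exact star_form hx.isHermitian _ _

theorem ip_self_re (f : ℝ → Vec n) : ∀ᵐ x ∂halfLine, ((H.ip f f x).re : ℂ) = H.ip f f x := by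
  filter_upwards [star_ip H f f] with x hx
  exact Complex.conj_eq_iff_re.1 hx

theorem norm_ip_le (f k : ℝ → Vec n) :
    ∀ᵐ x ∂halfLine, ‖H.ip f k x‖ ≤ ((H.ip f f x).re + (H.ip k k x).re) / 2 := by
  filter_upwards [H.posSemidef] with x hx
  exact norm_form_le hx (f x) (k x)

theorem integrable_ip_self_re {f : ℝ → Vec n} (hf : f ∈ H.preL2) :
    Integrable (fun x => (H.ip f f x).re) halfLine := by
  refine ⟨(aestronglyMeasurable_ip H hf.1 hf.1).re, ?_⟩
  rw [hasFiniteIntegral_iff_ofReal (ip_self_nonneg H f)]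
  exact hf.2

theorem integrable_ip {f k : ℝ → Vec n} (hf : f ∈ H.preL2) (hk : k ∈ H.preL2) :
    Integrable (H.ip f k) halfLine :=
  (((integrable_ip_self_re H hf).add (integrable_ip_self_re H hk)).div_const 2).mono'
    (aestronglyMeasurable_ip H hf.1 hk.1) (norm_ip_le H f k)

theorem sqNorm_eq_ofReal {f : ℝ → Vec n} (hf : f ∈ H.preL2) :
    H.sqNorm f = ENNReal.ofReal (∫ x, (H.ip f f x).re ∂halfLine) :=
  (ofReal_integral_eq_lintegral_ofReal (integrable_ip_self_re H hf) (ip_self_nonneg H f)).symm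

theorem ae_mulVec_eq_zero_of_sqNorm {f : ℝ → Vec n} (hf : AEStronglyMeasurable f halfLine)
    (h : H.sqNorm f = 0) : ∀ᵐ x ∂halfLine, H x *ᵥ f x = 0 := by
  have h1 := (lintegral_eq_zero_iff' (aemeasurable_form H hf)).1 h
  filter_upwards [h1, H.posSemidef] with x hx hpos
  have h2 : (star (f x) ⬝ᵥ (H x *ᵥ f x)).re ≤ 0 := ENNReal.ofReal_eq_zero.1 hx
  have h3 := hpos.re_dotProduct_nonneg (f x)
  refine (hpos.dotProduct_mulVec_zero_iff (f x)).1 ?_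
  rw [← Complex.conj_eq_iff_re.1 (star_form hpos.isHermitian (f x) (f x)), le_antisymm h2 h3]
  simp

theorem sqNorm_eq_zero_of_ae {f : ℝ → Vec n} (h : ∀ᵐ x ∂halfLine, H x *ᵥ f x = 0) :
    H.sqNorm f = 0 := by
  unfold Hamiltonian.sqNorm
  rw [← lintegral_zero (μ := halfLine)]
  refine lintegral_congr_ae ?_
  filter_upwards [h] with x hx
  simp [hx]

/-- `f` is square integrable on every bounded interval. -/
def LocL2 (f : ℝ → Vec n) : Prop := ∀ R : ℝ, (Iic R).indicator f ∈ H.preL2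

theorem ip_indicator (f k : ℝ → Vec n) (R x : ℝ) :
    H.ip ((Iic R).indicator f) ((Iic R).indicator k) x = (Iic R).indicator (H.ip f k) x := by
  unfold Hamiltonian.ip
  by_cases hx : x ∈ Iic R <;> simp [hx]

theorem sqNorm_indicator_le (f : ℝ → Vec n) (R : ℝ) :
    H.sqNorm ((Iic R).indicator f) ≤ H.sqNorm f := by
  refine lintegral_mono fun x => ?_
  by_cases hx : x ∈ Iic R <;> simp [hx]

theorem locL2_of_mem {f : ℝ → Vec n} (hf : f ∈ H.preL2) : LocL2 H f := fun R =>
  ⟨hf.1.indicator measurableSet_Iic, (sqNorm_indicator_le H f R).trans_lt hf.2⟩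

variable {H}

theorem LocL2.add {f k : ℝ → Vec n} (hf : LocL2 H f) (hk : LocL2 H k) : LocL2 H (f + k) :=
  fun R => by rw [indicator_add']; exact add_mem (hf R) (hk R)

theorem LocL2.smul {f : ℝ → Vec n} (c : ℂ) (hf : LocL2 H f) : LocL2 H (c • f) :=
  fun R => by
    have := H.preL2.smul_mem c (hf R)
    rwa [show (Iic R).indicator (c • f) = c • (Iic R).indicator f from
      indicator_const_smul (Iic R) c f]

theorem LocL2.integrableOn_ip {f k : ℝ → Vec n} (hf : LocL2 H f) (hk : LocL2 H k) (R : ℝ) :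
    IntegrableOn (H.ip f k) (Ioc 0 R) volume := by
  have h1 := integrable_ip H (hf R) (hk R)
  simp only [funext (ip_indicator H f k R)] at h1
  rw [integrable_indicator_iff measurableSet_Iic, IntegrableOn,
    Measure.restrict_restrict measurableSet_Iic, Iic_inter_Ioi] at h1
  exact h1

theorem LocL2.intervalIntegrable_ip {f k : ℝ → Vec n} (hf : LocL2 H f) (hk : LocL2 H k) {a b : ℝ}
    (ha : 0 ≤ a) (hb : 0 ≤ b) : IntervalIntegrable (H.ip f k) volume a b := by
  rw [intervalIntegrable_iff]
  exact (hf.integrableOn_ip hk (max a b)).mono_set (Ioc_subset_Ioc_left (le_min ha hb))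

variable (H)

theorem integrableOn_entry (hreg : H.RegularAtZero) (i j : Fin n ⊕ Fin n) (R : ℝ) :
    IntegrableOn (fun x => H x i j) (Ioc 0 R) volume := by
  obtain ⟨c, hc, h⟩ := hreg
  have h1 := (H.locallyIntegrable i j).integrableOn_compact_subset (t := Icc (c / 2) R)
    (fun x hx => lt_of_lt_of_le (half_pos hc) hx.1) isCompact_Icc
  refine ((h i j).union h1).mono_set fun x hx => ?_
  rcases lt_or_ge x c with hxc | hxc
  · exact Or.inl ⟨hx.1, hxc⟩
  · exact Or.inr ⟨by linarith, hx.2⟩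

/-- On `[0, R]` the function is bounded and, by regularity of the endpoint, the entries of `H` are
integrable. -/
theorem LocACOn.locL2 (hreg : H.RegularAtZero) {f : ℝ → Vec n} (hf : LocACOn f (Ici 0)) :
    LocL2 H f := by
  intro R
  have hm : AEStronglyMeasurable ((Iic R).indicator f) halfLine := by
    rw [aestronglyMeasurable_indicator_iff measurableSet_Iic,
      Measure.restrict_restrict measurableSet_Iic, Iic_inter_Ioi]
    rcases le_or_gt 0 R with hR | hR
    · exact ((hf.continuousOn hR).aestronglyMeasurable measurableSet_Icc).mono_set
        Ioc_subset_Icc_self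
    · rw [Ioc_eq_empty (by linarith)]; simp
  refine ⟨hm, ?_⟩
  rcases le_or_gt 0 R with hR | hR
  · obtain ⟨C, hC⟩ := isCompact_Icc.exists_bound_of_continuousOn (hf.continuousOn hR)
    have hC0 : 0 ≤ C := (norm_nonneg _).trans (hC 0 ⟨le_rfl, hR⟩)
    have hint : Integrable (fun x => (Iic R).indicator
        (fun x => ∑ i, ∑ j, C * (‖H x i j‖ * C)) x) halfLine := by
      rw [integrable_indicator_iff measurableSet_Iic, IntegrableOn,
        Measure.restrict_restrict measurableSet_Iic, Iic_inter_Ioi]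
      exact integrable_finsetSum _ fun i _ => integrable_finsetSum _ fun j _ =>
        ((integrableOn_entry H hreg i j R).norm.mul_const C).const_mul C
    refine lt_of_le_of_lt ?_ hint.lintegral_lt_top
    refine lintegral_mono_ae ?_
    filter_upwards [ae_restrict_mem measurableSet_Ioi] with x hx0
    refine ENNReal.ofReal_le_ofReal ?_
    by_cases hx : x ∈ Iic R
    · simp only [indicator_of_mem hx]
      have hfx : ∀ i, ‖f x i‖ ≤ C := fun i =>
        (norm_le_pi_norm (f x) i).trans (hC x ⟨le_of_lt hx0, hx⟩)
      refine (Complex.re_le_norm _).trans ?_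
      simp only [dotProduct, mulVec, Pi.star_apply, Finset.mul_sum]
      refine (norm_sum_le _ _).trans (Finset.sum_le_sum fun i _ => ?_)
      refine (norm_sum_le _ _).trans (Finset.sum_le_sum fun j _ => ?_)
      rw [norm_mul, norm_mul, norm_star]
      gcongr <;> exact hfx _
    · simp [hx]
  · have h0 : H.sqNorm ((Iic R).indicator f) = 0 := by
      refine sqNorm_eq_zero_of_ae H ?_
      filter_upwards [ae_restrict_mem measurableSet_Ioi] with x hx0
      have : x ∉ Iic R := by simp only [mem_Iic, not_le]; exact hR.trans hx0
      simp [this]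
    rw [h0]; exact ENNReal.zero_lt_top

end L2

end CanonicalSystem

namespace CanonicalSystem

variable {n : ℕ}

/-! ### Solutions of the inhomogeneous equation -/

/-- `y` is locally absolutely continuous on `[0, ∞)` and `J y' = -H w` almost everywhere. -/
def Hamiltonian.Pair (H : Hamiltonian n) (y w : ℝ → Vec n) : Prop :=
  LocACOn y (Ici 0) ∧ JDerivEq y (fun x => -(H x *ᵥ w x))

section Pair

variable {H : Hamiltonian n}

theorem Hamiltonian.Pair.add {y w y' w' : ℝ → Vec n} (h : H.Pair y w) (h' : H.Pair y' w') :
    H.Pair (y + y') (w + w') := by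
  refine ⟨h.1.add h'.1, ?_⟩
  convert h.2.add h'.2 using 1
  funext x
  simp only [Pi.add_apply, mulVec_add, neg_add]

theorem Hamiltonian.Pair.smul {y w : ℝ → Vec n} (c : ℂ) (h : H.Pair y w) :
    H.Pair (c • y) (c • w) := by
  refine ⟨h.1.smul c, ?_⟩
  convert h.2.smul c using 1
  funext x
  simp only [Pi.smul_apply, mulVec_smul, smul_neg]

theorem Hamiltonian.Pair.sub {y w y' w' : ℝ → Vec n} (h : H.Pair y w) (h' : H.Pair y' w') :
    H.Pair (y - y') (w - w') := by
  have := h.add (h'.smul (-1))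
  rwa [neg_one_smul, neg_one_smul, ← sub_eq_add_neg, ← sub_eq_add_neg] at this

theorem Hamiltonian.Pair.congr {y w w' : ℝ → Vec n} (h : H.Pair y w)
    (hw : ∀ᵐ x ∂halfLine, H x *ᵥ w x = H x *ᵥ w' x) : H.Pair y w' := by
  refine ⟨h.1, ?_⟩
  filter_upwards [h.2, hw] with x ⟨d, hd, hd'⟩ hx
  exact ⟨d, hd, by rw [hd', hx]⟩

theorem Hamiltonian.Pair.locL2 {y w : ℝ → Vec n} (h : H.Pair y w) (hreg : H.RegularAtZero) :
    LocL2 H y := LocACOn.locL2 H hreg h.1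

theorem Hamiltonian.Pair.lagrange (hreg : H.RegularAtZero) {f w k l : ℝ → Vec n}
    (hf : H.Pair f w) (hk : H.Pair k l) (hw : LocL2 H w) (hl : LocL2 H l) {a b : ℝ} (ha : 0 ≤ a)
    (hb : 0 ≤ b) :
    ∫ x in a..b, (H.ip w k x - H.ip f l x) = jform (f b) (k b) - jform (f a) (k a) := by
  have h1 : ∀ᵐ x, x ∈ uIoc a b → H.ip w k x - H.ip f l x =
      star (f x) ⬝ᵥ (-(H x *ᵥ l x)) - star (-(H x *ᵥ w x)) ⬝ᵥ k x := by
    filter_upwards [ae_uIoc_of_ae_halfLine H.posSemidef ha hb] with x hx hxab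
    rw [star_neg, neg_dotProduct, star_mulVec_dotProduct (hx hxab).isHermitian, dotProduct_neg]
    simp only [Hamiltonian.ip]
    ring
  rw [intervalIntegral.integral_congr_ae h1]
  refine lagrange_identity hf.1 hk.1 hf.2 hk.2 ha hb ?_
  refine IntervalIntegrable.congr_ae ((hw.intervalIntegrable_ip (hk.locL2 hreg) ha hb).sub
    ((hf.locL2 hreg).intervalIntegrable_ip hl ha hb)) ?_
  exact (ae_restrict_iff' measurableSet_uIoc).2 h1

theorem Hamiltonian.Pair.eq_const {y w : ℝ → Vec n} (h : H.Pair y w) {b : ℝ} (hb : 0 ≤ b)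
    (hw : ∀ᵐ x, x ∈ Ioc 0 b → H x *ᵥ w x = 0) : ∀ x ∈ Icc 0 b, y x = y 0 := by
  refine h.1.eq_of_jDerivEq_zero h.2 hb ?_
  filter_upwards [hw] with x hx hxb
  rw [hx hxb, neg_zero]

/-- The vectors annihilated by `H` on `(0, k]` form a decreasing sequence of subspaces of a finite
dimensional space. It becomes stationary, and its final term is annihilated on the whole half line,
hence zero. -/
theorem exists_definite_interval (hdef : H.IsDefinite) :
    ∃ R : ℝ, 0 < R ∧ ∀ v : Vec n, (∀ᵐ x, x ∈ Ioc 0 R → H x *ᵥ v = 0) → v = 0 := by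
  let N : ℕ → Submodule ℂ (Vec n) := fun k =>
    { carrier := {v | ∀ᵐ x, x ∈ Ioc (0 : ℝ) k → H x *ᵥ v = 0}
      zero_mem' := by simp
      add_mem' := by
        intro a b ha hb
        show ∀ᵐ x, x ∈ Ioc (0 : ℝ) k → H x *ᵥ (a + b) = 0
        filter_upwards [ha, hb] with x hxa hxb hx
        rw [mulVec_add, hxa hx, hxb hx, add_zero]
      smul_mem' := by
        intro c a ha
        show ∀ᵐ x, x ∈ Ioc (0 : ℝ) k → H x *ᵥ (c • a) = 0
        filter_upwards [ha] with x hxa hx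
        rw [mulVec_smul, hxa hx, smul_zero] }
  have hN : ∀ k v, v ∈ N k ↔ ∀ᵐ x, x ∈ Ioc (0 : ℝ) k → H x *ᵥ v = 0 := fun k v => Iff.rfl
  let f : ℕ →o (Submodule ℂ (Vec n))ᵒᵈ :=
    { toFun := fun k => OrderDual.toDual (N k)
      monotone' := by
        intro k l hkl v hv
        filter_upwards [(hN l v).1 hv] with x hx hxk
        exact hx ⟨hxk.1, hxk.2.trans (by exact_mod_cast hkl)⟩ }
  obtain ⟨k, hk⟩ := IsArtinian.monotone_stabilizes f
  -- The index is raised by one only to make the interval nonempty.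
  refine ⟨k + 1, by positivity, fun v hv => hdef v ?_⟩
  have hvk : v ∈ N (k + 1) := (hN _ _).2 (by simpa using hv)
  have hall : ∀ m : ℕ, v ∈ N m := by
    intro m
    rcases le_total (k + 1) m with hm | hm
    · have h1 : N (k + 1) = N m := (hk (k + 1) (Nat.le_succ k)).symm.trans
        (hk m ((Nat.le_succ k).trans hm))
      rwa [← h1]
    · exact f.monotone hm hvk
  rw [ae_restrict_iff' measurableSet_Ioi]
  filter_upwards [ae_all_iff.2 fun m => (hN m v).1 (hall m)] with x hx hx0
  obtain ⟨m, hm⟩ := exists_nat_ge x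
  exact hx m ⟨hx0, hm⟩

theorem eq_zero_of_const (hdef : H.IsDefinite) {y w : ℝ → Vec n} (h : H.Pair y w)
    (hw : ∀ᵐ x ∂halfLine, H x *ᵥ w x = 0) (hy : ∀ᵐ x ∂halfLine, H x *ᵥ y x = 0) {x : ℝ}
    (hx : 0 ≤ x) : y x = 0 := by
  have hc : ∀ b : ℝ, 0 ≤ b → y b = y 0 := fun b hb => h.eq_const hb (by
    filter_upwards [ae_uIoc_of_ae_halfLine hw le_rfl hb] with x hx
    rwa [uIoc_of_le hb] at hx) b ⟨hb, le_rfl⟩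
  rw [hc x hx]
  refine hdef _ ?_
  filter_upwards [hy, ae_restrict_mem measurableSet_Ioi] with x hx hx0
  rwa [hc x (le_of_lt hx0)] at hx

theorem ae_mulVec_eq_zero_of_integral {y : ℝ → Vec n} (hy : LocL2 H y) {R : ℝ} (hR : 0 ≤ R)
    (h : ∫ x in 0..R, (H.ip y y x).re = 0) : ∀ᵐ x, x ∈ Ioc 0 R → H x *ᵥ y x = 0 := by
  have h0 : H.sqNorm ((Iic R).indicator y) = 0 := by
    rw [sqNorm_eq_ofReal H (hy R), ENNReal.ofReal_eq_zero, ← h,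
      intervalIntegral.integral_of_le hR]
    simp only [ip_indicator]
    have h1 : (fun x => ((Iic R).indicator (H.ip y y) x).re) =
        (Iic R).indicator fun x => (H.ip y y x).re := by
      funext x
      by_cases hx : x ∈ Iic R <;> simp [hx]
    rw [h1, integral_indicator measurableSet_Iic, Measure.restrict_restrict measurableSet_Iic,
      Iic_inter_Ioi]
  have h1 := ae_mulVec_eq_zero_of_sqNorm H (hy R).1 h0
  filter_upwards [ae_uIoc_of_ae_halfLine h1 le_rfl hR] with x hx hxR
  rw [uIoc_of_le hR] at hx
  simpa [hxR.2] using hx hxR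

/-- Zero energy means `H y = 0` on `(0, R]`. Then `y' = 0`, so `y` is a constant annihilated by `H`,
and definiteness on the interval applies. -/
theorem Hamiltonian.Pair.eq_zero_of_integral (hreg : H.RegularAtZero) {R : ℝ} (hR : 0 ≤ R)
    (hRd : ∀ v : Vec n, (∀ᵐ x, x ∈ Ioc 0 R → H x *ᵥ v = 0) → v = 0) {z : ℂ}
    {y : ℝ → Vec n} (hy : H.Pair y (z • y)) (h : ∫ x in 0..R, (H.ip y y x).re = 0) : y 0 = 0 := by
  have h1 := ae_mulVec_eq_zero_of_integral (hy.locL2 hreg) hR h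
  have h2 := hy.eq_const hR (by
    filter_upwards [h1] with x hx hxR
    rw [Pi.smul_apply, mulVec_smul, hx hxR, smul_zero])
  refine hRd _ ?_
  filter_upwards [h1] with x hx hxR
  rw [← h2 x ⟨hxR.1.le, hxR.2⟩]
  exact hx hxR

theorem Hamiltonian.Pair.eq_zero_of_sqNorm (hdef : H.IsDefinite) {z : ℂ} {y : ℝ → Vec n}
    (hy : H.Pair y (z • y)) (hm : y ∈ H.preL2) (h : H.sqNorm y = 0) {x : ℝ} (hx : 0 ≤ x) :
    y x = 0 := by
  have h1 := ae_mulVec_eq_zero_of_sqNorm H hm.1 h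
  refine eq_zero_of_const hdef hy ?_ h1 hx
  filter_upwards [h1] with x hx
  rw [Pi.smul_apply, mulVec_smul, hx, smul_zero]

end Pair

/-! ### Initial value problems and matrix solutions -/

section IVP

variable {H : Hamiltonian n}

theorem intervalIntegrable_sum_entry_smul (hreg : H.RegularAtZero) {E : Type*}
    [NormedAddCommGroup E] [NormedSpace ℂ E] (L : (Fin n ⊕ Fin n) → (Fin n ⊕ Fin n) → E)
    (p q : ℝ) :
    IntervalIntegrable
      (fun t => ∑ i, ∑ j, (Ioi (0 : ℝ)).indicator (fun t => H t i j) t • L i j) volume p q := by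
  rw [intervalIntegrable_iff]
  refine integrable_finsetSum _ fun i _ => integrable_finsetSum _ fun j _ => ?_
  have h1 : Integrable ((Ioi (0 : ℝ)).indicator fun t => H t i j)
      (volume.restrict (uIoc p q)) := by
    rw [integrable_indicator_iff measurableSet_Ioi, IntegrableOn,
      Measure.restrict_restrict measurableSet_Ioi]
    exact (integrableOn_entry H hreg i j (max p q)).mono_set fun x hx => ⟨hx.1, hx.2.2⟩
  exact h1.smul_const (L i j)

/-- Since `J² = -1`, the equation reads `y' = z J H y`, a Volterra equation once `H` is cut off at
`0`. -/
theorem exists_solution (hreg : H.RegularAtZero) (z : ℂ) (c : Vec n) :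
    ∃ y : ℝ → Vec n, H.Pair y (z • y) ∧ y 0 = c := by
  obtain ⟨L, hL⟩ : ∃ L : (Fin n ⊕ Fin n) → (Fin n ⊕ Fin n) → (Vec n →L[ℂ] Vec n),
      ∀ i j w, L i j w = w j • (z • (Matrix.J (Fin n) ℂ *ᵥ Pi.single i 1)) :=
    ⟨fun i j => LinearMap.toContinuousLinearMap ((LinearMap.proj j : Vec n →ₗ[ℂ] ℂ).smulRight
      (z • (Matrix.J (Fin n) ℂ *ᵥ Pi.single i 1))), fun i j w => rfl⟩
  -- The operator `z J H(t)` is expanded over the entries of `H`, since integrability is known entry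
  -- by entry.
  let A : ℝ → (Vec n →L[ℂ] Vec n) := fun t =>
    ∑ i, ∑ j, (Ioi (0 : ℝ)).indicator (fun t => H t i j) t • L i j
  have hAi : ∀ p q, IntervalIntegrable A volume p q := by
    intro p q
    exact intervalIntegrable_sum_entry_smul hreg L p q
  have hA0 : ∀ t ≤ 0, A t = 0 := fun t ht => by
    have : t ∉ Ioi (0 : ℝ) := not_lt.2 ht
    refine Finset.sum_eq_zero fun i _ => Finset.sum_eq_zero fun j _ => ?_
    rw [indicator_of_notMem this]
    exact zero_smul ℂ (L i j)
  have hAapp : ∀ t, 0 < t → ∀ w, A t w = z • (Matrix.J (Fin n) ℂ *ᵥ (H t *ᵥ w)) := by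
    intro t ht w
    have ht' : t ∈ Ioi (0 : ℝ) := ht
    have h1 : H t *ᵥ w = ∑ i, (∑ j, H t i j * w j) • (Pi.single i 1 : Vec n) := by
      funext k
      simp [mulVec, dotProduct, Finset.sum_apply, Pi.single_apply]
    have h2 : ∀ (s : Finset (Fin n ⊕ Fin n)) (g : Fin n ⊕ Fin n → Vec n),
        Matrix.J (Fin n) ℂ *ᵥ (∑ i ∈ s, g i) = ∑ i ∈ s, Matrix.J (Fin n) ℂ *ᵥ g i := fun s g =>
      map_sum (Matrix.J (Fin n) ℂ).mulVecLin g s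
    rw [h1, h2, Finset.smul_sum]
    simp only [A, _root_.sum_apply, indicator_of_mem ht']
    refine Finset.sum_congr rfl fun i _ => ?_
    rw [mulVec_smul, Finset.sum_smul, Finset.smul_sum]
    refine Finset.sum_congr rfl fun j _ => ?_
    rw [_root_.smul_apply, hL]
    simp only [smul_smul]
    congr 1
    ring
  obtain ⟨y, hyc, hy⟩ := exists_volterra_solution hAi hA0 c
  have hi : ∀ p q, IntervalIntegrable (fun t => A t (y t)) volume p q := by
    intro p q
    rw [intervalIntegrable_iff]
    obtain ⟨M, hM⟩ := isCompact_uIcc.exists_bound_of_continuousOn (s := uIcc p q) hyc.continuousOn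
    have h1 : Integrable A (volume.restrict (uIoc p q)) := intervalIntegrable_iff.1 (hAi p q)
    refine Integrable.mono' (h1.norm.mul_const M) ?_ ?_
    · exact (isBoundedBilinearMap_apply (𝕜 := ℂ)).continuous.comp_aestronglyMeasurable
        (h1.aestronglyMeasurable.prodMk hyc.aestronglyMeasurable)
    · filter_upwards [ae_restrict_mem measurableSet_uIoc] with t ht
      exact ((A t).le_opNorm _).trans
        (mul_le_mul_of_nonneg_left (hM t (uIoc_subset_uIcc ht)) (norm_nonneg _))
  refine ⟨y, ⟨fun a b hab hs => ?_, ?_⟩, by simpa using hy 0⟩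
  · have hb : 0 ≤ b := (hs (left_mem_Icc.2 hab) : (0:ℝ) ≤ a).trans hab
    have h1 := ac_integral (hi 0 b) (left_mem_uIcc (a := 0) (b := b))
    have h2 := (ac_const c 0 b).fun_add h1
    refine (ac_congr h2 fun x _ => hy x).mono ?_
    rw [uIcc_of_le hab, uIcc_of_le hb]
    exact fun x hx => ⟨hs hx, hx.2⟩
  · have h1 : ∀ᵐ x, ∀ m : ℕ, x ∈ uIcc (0 : ℝ) m →
        HasDerivAt (fun x => ∫ t in 0..x, A t (y t)) (A x (y x)) x := by
      refine ae_all_iff.2 fun m => ?_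
      filter_upwards [(hi 0 m).ae_hasDerivAt_integral] with x hx hxm
      exact hx hxm 0 left_mem_uIcc
    filter_upwards [ae_restrict_of_ae h1, ae_restrict_mem measurableSet_Ioi] with x hx hx0
    obtain ⟨m, hm⟩ := exists_nat_ge x
    refine ⟨A x (y x), ?_, ?_⟩
    · have h2 := (hx m (by rw [uIcc_of_le (by positivity)]; exact ⟨le_of_lt hx0, hm⟩)).const_add c
      exact h2.congr_of_eventuallyEq (Filter.Eventually.of_forall hy)
    · rw [hAapp x hx0, mulVec_smul, J_mulVec_J_mulVec, Pi.smul_apply, mulVec_smul, smul_neg]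

theorem Hamiltonian.IsMatrixSolution.pair {z : ℂ} {U : ℝ → Mat n} (h : H.IsMatrixSolution z U)
    (c : Fin n → ℂ) : H.Pair (fun x => U x *ᵥ c) (z • fun x => U x *ᵥ c) := by
  have h1 : ∀ j, H.Pair (fun x => (U x).col j) (z • fun x => (U x).col j) := fun j =>
    ⟨(h j).1, by simpa only [Pi.smul_apply, mulVec_smul] using (h j).2⟩
  have h2 : ∀ s : Finset (Fin n), H.Pair (fun x => ∑ j ∈ s, c j • (U x).col j)
      (z • fun x => ∑ j ∈ s, c j • (U x).col j) := by
    intro s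
    induction s using Finset.induction_on with
    | empty =>
      refine ⟨locACOn_zero _, ?_⟩
      simpa using! (jDerivEq_zero (n := n))
    | insert j s hj ih =>
      simp only [Finset.sum_insert hj]
      have h3 := ((h1 j).smul (c j)).add ih
      rwa [smul_comm, ← smul_add] at h3
  have h3 : (fun x => U x *ᵥ c) = fun x => ∑ j, c j • (U x).col j := by
    funext x i
    simp [mulVec, dotProduct, Finset.sum_apply, mul_comm]
  rw [h3]
  exact h2 _

theorem isMatrixSolution_of_pair {z : ℂ} {U : ℝ → Mat n}
    (h : ∀ j, H.Pair (fun x => (U x).col j) (z • fun x => (U x).col j)) :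
    H.IsMatrixSolution z U := fun j =>
  ⟨(h j).1, by simpa only [Pi.smul_apply, mulVec_smul] using (h j).2⟩

theorem exists_isMatrixSolution (hreg : H.RegularAtZero) (z : ℂ) (M : Mat n) :
    ∃ U : ℝ → Mat n, H.IsMatrixSolution z U ∧ U 0 = M := by
  choose y hy hy0 using fun j => exists_solution hreg z (M.col j)
  refine ⟨fun x => Matrix.of fun i j => y j x i, isMatrixSolution_of_pair hy, ?_⟩
  ext i j
  exact congrFun (hy0 j) i

end IVP

end CanonicalSystem

namespace CanonicalSystem

variable {n : ℕ}

/-! ### Algebra of the fundamental system -/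

section Algebra

theorem jform_mulVec (M N : Mat n) (a b : Fin n → ℂ) :
    jform (M *ᵥ a) (N *ᵥ b) = star a ⬝ᵥ ((Mᴴ * Matrix.J (Fin n) ℂ * N) *ᵥ b) := by
  simp only [jform, star_mulVec, ← mulVec_mulVec, ← dotProduct_mulVec]

theorem matrix_eq_of_forms {M N : Matrix (Fin n) (Fin n) ℂ}
    (h : ∀ a b, star a ⬝ᵥ (M *ᵥ b) = star a ⬝ᵥ (N *ᵥ b)) : M = N := by
  ext i j
  simpa [← Pi.single_star] using h (Pi.single i 1) (Pi.single j 1)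

/-- The four relations say that `(V' U')* J (V U) = -J`. A one-sided inverse of a square matrix is
two-sided, so the factors may be exchanged, which gives the identity. -/
theorem frame_identity {U V U' V' : Mat n} (h1 : U'ᴴ * Matrix.J (Fin n) ℂ * U = 0)
    (h2 : V'ᴴ * Matrix.J (Fin n) ℂ * U = 1) (h3 : U'ᴴ * Matrix.J (Fin n) ℂ * V = -1)
    (h4 : V'ᴴ * Matrix.J (Fin n) ℂ * V = 0) :
    V * U'ᴴ - U * V'ᴴ = Matrix.J (Fin n) ℂ := by
  have hJ := Matrix.J_squared (Fin n) ℂ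
  have e1 : fromRows V'ᴴ U'ᴴ * Matrix.J (Fin n) ℂ * fromCols V U = -Matrix.J (Fin n) ℂ := by
    rw [fromRows_mul, fromRows_mul_fromCols, h1, h2, h3, h4]
    simp [Matrix.J, fromBlocks_neg]
  have e2 : (Matrix.J (Fin n) ℂ * fromRows V'ᴴ U'ᴴ * Matrix.J (Fin n) ℂ) * fromCols V U = 1 := by
    rw [Matrix.mul_assoc, Matrix.mul_assoc, ← Matrix.mul_assoc (fromRows V'ᴴ U'ᴴ), e1,
      Matrix.mul_neg, hJ, neg_neg]
  have e3 := mul_eq_one_comm.1 e2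
  have e4 : fromCols V U * Matrix.J (Fin n) ℂ * fromRows V'ᴴ U'ᴴ = U * V'ᴴ - V * U'ᴴ := by
    rw [Matrix.J, fromCols_mul_fromBlocks, fromCols_mul_fromRows]
    simp [sub_eq_add_neg]
  have e5 : (U * V'ᴴ - V * U'ᴴ) * Matrix.J (Fin n) ℂ = 1 := by
    rw [← e4, ← e3]
    simp only [Matrix.mul_assoc]
  have e6 := congrArg (· * Matrix.J (Fin n) ℂ) e5
  simp only [Matrix.mul_assoc, hJ, Matrix.mul_neg, Matrix.mul_one, Matrix.one_mul] at e6
  rw [← e6, neg_sub]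

variable {α : Matrix (Fin n) (Fin n ⊕ Fin n) ℂ}

theorem conjTranspose_neg_J_mul :
    (-(Matrix.J (Fin n) ℂ * αᴴ))ᴴ = α * Matrix.J (Fin n) ℂ := by
  rw [conjTranspose_neg, conjTranspose_mul, J_conjTranspose, conjTranspose_conjTranspose,
    Matrix.mul_neg, neg_neg]

theorem initial_uu (hαJ : α * Matrix.J (Fin n) ℂ * αᴴ = 0) :
    (-(Matrix.J (Fin n) ℂ * αᴴ))ᴴ * Matrix.J (Fin n) ℂ * (-(Matrix.J (Fin n) ℂ * αᴴ)) = 0 := by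
  rw [conjTranspose_neg_J_mul, Matrix.mul_neg, Matrix.mul_assoc α, Matrix.J_squared,
    Matrix.mul_neg, Matrix.mul_one, Matrix.neg_mul, ← Matrix.mul_assoc, hαJ]
  simp

theorem initial_vu (hα : α * αᴴ = 1) :
    (αᴴ)ᴴ * Matrix.J (Fin n) ℂ * (-(Matrix.J (Fin n) ℂ * αᴴ)) = 1 := by
  rw [conjTranspose_conjTranspose, Matrix.mul_neg, Matrix.mul_assoc, ← Matrix.mul_assoc _ _ αᴴ,
    Matrix.J_squared, Matrix.neg_mul, Matrix.one_mul, Matrix.mul_neg, hα, neg_neg]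

theorem initial_uv (hα : α * αᴴ = 1) :
    (-(Matrix.J (Fin n) ℂ * αᴴ))ᴴ * Matrix.J (Fin n) ℂ * αᴴ = -1 := by
  rw [conjTranspose_neg_J_mul, Matrix.mul_assoc α, Matrix.J_squared, Matrix.mul_neg,
    Matrix.mul_one, Matrix.neg_mul, hα]

theorem initial_vv (hαJ : α * Matrix.J (Fin n) ℂ * αᴴ = 0) :
    (αᴴ)ᴴ * Matrix.J (Fin n) ℂ * αᴴ = 0 := by
  rw [conjTranspose_conjTranspose, hαJ]

/-- The kernel of `α` is isotropic: `frame_identity` at the initial values reads `J = α* α J + J α*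
α`, and each term vanishes between two vectors of the kernel. -/
theorem jform_eq_zero_of_ker (hα : α * αᴴ = 1) (hαJ : α * Matrix.J (Fin n) ℂ * αᴴ = 0)
    {a b : Vec n} (ha : α *ᵥ a = 0) (hb : α *ᵥ b = 0) : jform a b = 0 := by
  have h := frame_identity (initial_uu hαJ) (initial_vu hα) (initial_uv hα) (initial_vv hαJ)
  rw [conjTranspose_neg_J_mul, conjTranspose_conjTranspose, Matrix.neg_mul, sub_neg_eq_add] at h
  rw [jform, ← h, add_mulVec, Matrix.mul_assoc (Matrix.J (Fin n) ℂ),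
    ← mulVec_mulVec b (Matrix.J (Fin n) ℂ), ← mulVec_mulVec b αᴴ α, hb, mulVec_zero, mulVec_zero,
    add_zero, ← mulVec_mulVec, dotProduct_mulVec, ← star_mulVec, ha]
  simp

end Algebra

/-! ### Fundamental systems of solutions -/

/-- `U` and `V` are the solutions of `J y' = -z H y` with `U(0) = -J α*` and `V(0) = α*`. -/
structure Hamiltonian.IsFund (H : Hamiltonian n) (α : Matrix (Fin n) (Fin n ⊕ Fin n) ℂ) (z : ℂ)
    (U V : ℝ → Mat n) : Prop where
  u_solution : H.IsMatrixSolution z U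
  u_zero : U 0 = -(Matrix.J (Fin n) ℂ * αᴴ)
  v_solution : H.IsMatrixSolution z V
  v_zero : V 0 = αᴴ

section Fund

variable {H : Hamiltonian n} {α : Matrix (Fin n) (Fin n ⊕ Fin n) ℂ} {z : ℂ}

/-- At conjugate parameters the two terms of the Lagrange density cancel. -/
theorem Hamiltonian.Pair.jform_conj (hreg : H.RegularAtZero) {y y' : ℝ → Vec n}
    (hy : H.Pair y (z • y)) (hy' : H.Pair y' (starRingEnd ℂ z • y')) {x : ℝ} (hx : 0 ≤ x) :
    jform (y' x) (y x) = jform (y' 0) (y 0) := by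
  have h := hy'.lagrange hreg hy ((hy'.locL2 hreg).smul _) ((hy.locL2 hreg).smul _) le_rfl hx
  have h0 : ∀ t, H.ip (starRingEnd ℂ z • y') y t - H.ip y' (z • y) t = 0 := fun t => by
    simp [Hamiltonian.ip, star_smul, mulVec_smul]
  simp only [h0, intervalIntegral.integral_zero] at h
  exact (sub_eq_zero.1 h.symm)

theorem matrixSolution_form (hreg : H.RegularAtZero) {Y Y' : ℝ → Mat n}
    (hY : H.IsMatrixSolution z Y) (hY' : H.IsMatrixSolution (starRingEnd ℂ z) Y') {x : ℝ}
    (hx : 0 ≤ x) :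
    (Y' x)ᴴ * Matrix.J (Fin n) ℂ * Y x = (Y' 0)ᴴ * Matrix.J (Fin n) ℂ * Y 0 := by
  refine matrix_eq_of_forms fun a b => ?_
  rw [← jform_mulVec, ← jform_mulVec]
  exact (hY.pair b).jform_conj hreg (hY'.pair a) hx

/-- The Lagrange density of `y` with itself is `-2i Im z · y* H y`. The identity lets a sign of the
boundary form at a far point control the energy. -/
theorem Hamiltonian.Pair.energy (hreg : H.RegularAtZero) {y : ℝ → Vec n} (hy : H.Pair y (z • y))
    {a b : ℝ} (ha : 0 ≤ a) (hb : 0 ≤ b) :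
    (jform (y b) (y b)).im - (jform (y a) (y a)).im =
      -(2 * z.im * ∫ x in a..b, (H.ip y y x).re) := by
  have hl := hy.locL2 hreg
  have h := hy.lagrange hreg hy (hl.smul _) (hl.smul _) ha hb
  have h0 : ∀ᵐ x, x ∈ uIoc a b → H.ip (z • y) y x - H.ip y (z • y) x =
      -(2 * z.im * Complex.I) * ((H.ip y y x).re : ℂ) := by
    filter_upwards [ae_uIoc_of_ae_halfLine (ip_self_re H y) ha hb] with x hx hxab
    rw [hx hxab]
    simp only [Hamiltonian.ip, Pi.smul_apply, star_smul, mulVec_smul, smul_dotProduct,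
      dotProduct_smul, smul_eq_mul, Complex.star_def, ← sub_mul]
    rw [← neg_sub, Complex.sub_conj]
    push_cast
    ring
  rw [intervalIntegral.integral_congr_ae h0, intervalIntegral.integral_const_mul,
    intervalIntegral.integral_ofReal] at h
  rw [← Complex.sub_im, ← h]
  simp [Complex.mul_im]

namespace Hamiltonian.IsFund

variable {U V U' V' : ℝ → Mat n}

theorem form_uu (h : H.IsFund α z U V) (h' : H.IsFund α (starRingEnd ℂ z) U' V')
    (hreg : H.RegularAtZero) (hαJ : α * Matrix.J (Fin n) ℂ * αᴴ = 0) {x : ℝ} (hx : 0 ≤ x) :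
    (U' x)ᴴ * Matrix.J (Fin n) ℂ * U x = 0 := by
  rw [matrixSolution_form hreg h.u_solution h'.u_solution hx, h.u_zero, h'.u_zero, initial_uu hαJ]

theorem form_vu (h : H.IsFund α z U V) (h' : H.IsFund α (starRingEnd ℂ z) U' V')
    (hreg : H.RegularAtZero) (hα : α * αᴴ = 1) {x : ℝ} (hx : 0 ≤ x) :
    (V' x)ᴴ * Matrix.J (Fin n) ℂ * U x = 1 := by
  rw [matrixSolution_form hreg h.u_solution h'.v_solution hx, h.u_zero, h'.v_zero, initial_vu hα]

theorem form_uv (h : H.IsFund α z U V) (h' : H.IsFund α (starRingEnd ℂ z) U' V')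
    (hreg : H.RegularAtZero) (hα : α * αᴴ = 1) {x : ℝ} (hx : 0 ≤ x) :
    (U' x)ᴴ * Matrix.J (Fin n) ℂ * V x = -1 := by
  rw [matrixSolution_form hreg h.v_solution h'.u_solution hx, h.v_zero, h'.u_zero, initial_uv hα]

theorem form_vv (h : H.IsFund α z U V) (h' : H.IsFund α (starRingEnd ℂ z) U' V')
    (hreg : H.RegularAtZero) (hαJ : α * Matrix.J (Fin n) ℂ * αᴴ = 0) {x : ℝ} (hx : 0 ≤ x) :
    (V' x)ᴴ * Matrix.J (Fin n) ℂ * V x = 0 := by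
  rw [matrixSolution_form hreg h.v_solution h'.v_solution hx, h.v_zero, h'.v_zero, initial_vv hαJ]

theorem frame (h : H.IsFund α z U V) (h' : H.IsFund α (starRingEnd ℂ z) U' V')
    (hreg : H.RegularAtZero) (hα : α * αᴴ = 1) (hαJ : α * Matrix.J (Fin n) ℂ * αᴴ = 0) {x : ℝ}
    (hx : 0 ≤ x) : V x * (U' x)ᴴ - U x * (V' x)ᴴ = Matrix.J (Fin n) ℂ :=
  frame_identity (h.form_uu h' hreg hαJ hx) (h.form_vu h' hreg hα hx) (h.form_uv h' hreg hα hx)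
    (h.form_vv h' hreg hαJ hx)

theorem form_wu (h : H.IsFund α z U V) (h' : H.IsFund α (starRingEnd ℂ z) U' V')
    (hreg : H.RegularAtZero) (hα : α * αᴴ = 1) (hαJ : α * Matrix.J (Fin n) ℂ * αᴴ = 0)
    (m' : Matrix (Fin n) (Fin n) ℂ) {x : ℝ} (hx : 0 ≤ x) :
    (V' x + U' x * m')ᴴ * Matrix.J (Fin n) ℂ * U x = 1 := by
  rw [conjTranspose_add, conjTranspose_mul, Matrix.add_mul, Matrix.add_mul, h.form_vu h' hreg hα hx,
    Matrix.mul_assoc, Matrix.mul_assoc, ← Matrix.mul_assoc _ _ (U x), h.form_uu h' hreg hαJ hx]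
  simp

theorem form_uw (h : H.IsFund α z U V) (h' : H.IsFund α (starRingEnd ℂ z) U' V')
    (hreg : H.RegularAtZero) (hα : α * αᴴ = 1) (hαJ : α * Matrix.J (Fin n) ℂ * αᴴ = 0)
    (m : Matrix (Fin n) (Fin n) ℂ) {x : ℝ} (hx : 0 ≤ x) :
    (U' x)ᴴ * Matrix.J (Fin n) ℂ * (V x + U x * m) = -1 := by
  rw [Matrix.mul_add, h.form_uv h' hreg hα hx, ← Matrix.mul_assoc, h.form_uu h' hreg hαJ hx]
  simp

/-- The value does not depend on `x`, so a boundary condition at `R` or a limit at infinity decides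
whether `m'` is the adjoint of `m`. -/
theorem form_ww (h : H.IsFund α z U V) (h' : H.IsFund α (starRingEnd ℂ z) U' V')
    (hreg : H.RegularAtZero) (hα : α * αᴴ = 1) (hαJ : α * Matrix.J (Fin n) ℂ * αᴴ = 0)
    (m m' : Matrix (Fin n) (Fin n) ℂ) {x : ℝ} (hx : 0 ≤ x) :
    (V' x + U' x * m')ᴴ * Matrix.J (Fin n) ℂ * (V x + U x * m) = m - m'ᴴ := by
  rw [conjTranspose_add, conjTranspose_mul, Matrix.add_mul, Matrix.add_mul,
    Matrix.mul_assoc m'ᴴ, Matrix.mul_assoc m'ᴴ, h.form_uw h' hreg hα hαJ m hx, Matrix.mul_add,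
    h.form_vv h' hreg hαJ hx, ← Matrix.mul_assoc _ _ m, h.form_vu h' hreg hα hx]
  simp [sub_eq_add_neg]

theorem alpha_w_zero (h : H.IsFund α z U V) (hα : α * αᴴ = 1)
    (hαJ : α * Matrix.J (Fin n) ℂ * αᴴ = 0) (m : Matrix (Fin n) (Fin n) ℂ) :
    α * (V 0 + U 0 * m) = 1 := by
  rw [h.u_zero, h.v_zero, Matrix.mul_add, hα, Matrix.neg_mul, Matrix.mul_neg, Matrix.mul_assoc,
    ← Matrix.mul_assoc, ← Matrix.mul_assoc, hαJ]
  simp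

theorem alpha_u_zero (h : H.IsFund α z U V) (hαJ : α * Matrix.J (Fin n) ℂ * αᴴ = 0) :
    α * U 0 = 0 := by
  rw [h.u_zero, Matrix.mul_neg, ← Matrix.mul_assoc, hαJ, neg_zero]

theorem w_solution (h : H.IsFund α z U V) (m : Matrix (Fin n) (Fin n) ℂ) (c : Fin n → ℂ) :
    H.Pair (fun x => (V x + U x * m) *ᵥ c) (z • fun x => (V x + U x * m) *ᵥ c) := by
  have h1 := (h.v_solution.pair c).add (h.u_solution.pair (m *ᵥ c))
  rw [← smul_add] at h1
  convert h1 using 1 <;> · funext x; simp [add_mulVec]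

end Hamiltonian.IsFund

end Fund

end CanonicalSystem

namespace CanonicalSystem

variable {n : ℕ}

/-! ### Weyl matrices with a definite boundary form -/

/-- The boundary form of the columns of `W` is semidefinite, with the sign of `Im z`. -/
def SignDefinite (z : ℂ) (W : ℝ → Mat n) : Prop :=
  ∀ c : Fin n → ℂ, ∀ x : ℝ, 0 ≤ x → 0 ≤ z.im * (jform (W x *ᵥ c) (W x *ᵥ c)).im

/-- By homogeneity the minimum over the compact unit sphere serves as `δ`. The sphere is empty when
the space is zero, which happens for `n = 0`. -/
theorem exists_quadratic_lower_bound {E : Type*} [NormedAddCommGroup E] [NormedSpace ℝ E]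
    [ProperSpace E] {q : E → ℝ} (hq : Continuous q) (hs : ∀ (t : ℝ) d, q (t • d) = t ^ 2 * q d)
    (hpos : ∀ d, d ≠ 0 → 0 < q d) : ∃ δ > 0, ∀ d, δ * ‖d‖ ^ 2 ≤ q d := by
  rcases (Metric.sphere (0 : E) 1).eq_empty_or_nonempty with hE | hE
  · refine ⟨1, one_pos, fun d => ?_⟩
    by_cases hd : d = 0
    · have := hs 0 d
      rw [zero_smul] at this
      rw [hd, this]; simp
    · have h1 : ‖d‖⁻¹ • d ∈ Metric.sphere (0 : E) 1 := by
        rw [mem_sphere_zero_iff_norm, norm_smul, norm_inv, norm_norm,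
          inv_mul_cancel₀ (norm_ne_zero_iff.2 hd)]
      rw [hE] at h1
      exact h1.elim
  · obtain ⟨d₀, hd₀, hmin⟩ := (isCompact_sphere (0 : E) 1).exists_isMinOn hE hq.continuousOn
    have h0 : d₀ ≠ 0 := fun h => by simp [h] at hd₀
    refine ⟨q d₀, hpos d₀ h0, fun d => ?_⟩
    by_cases hd : d = 0
    · have := hs 0 d
      rw [zero_smul] at this
      rw [hd, this]; simp
    · have h1 : ‖d‖⁻¹ • d ∈ Metric.sphere (0 : E) 1 := by
        rw [mem_sphere_zero_iff_norm, norm_smul, norm_inv, norm_norm,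
          inv_mul_cancel₀ (norm_ne_zero_iff.2 hd)]
      have h2 : q d₀ ≤ q (‖d‖⁻¹ • d) := hmin h1
      have h3 : d = ‖d‖ • (‖d‖⁻¹ • d) := by
        rw [smul_smul, mul_inv_cancel₀ (norm_ne_zero_iff.2 hd), one_smul]
      conv_rhs => rw [h3, hs]
      nlinarith [sq_nonneg ‖d‖]

section Weyl

variable {H : Hamiltonian n} {α : Matrix (Fin n) (Fin n ⊕ Fin n) ℂ} {z : ℂ}
  {U V U' V' : ℝ → Mat n}

theorem integral_ip_self_nonneg (H : Hamiltonian n) (y : ℝ → Vec n) {a b : ℝ} (ha : 0 ≤ a)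
    (hab : a ≤ b) : 0 ≤ ∫ x in a..b, (H.ip y y x).re := by
  refine intervalIntegral.integral_nonneg_of_ae_restrict hab ?_
  rw [Filter.EventuallyLE, ae_restrict_iff' measurableSet_Icc]
  have h := ae_uIcc_of_ae_halfLine (ip_self_nonneg H y) ha (ha.trans hab)
  rwa [uIcc_of_le hab] at h

namespace Hamiltonian.IsFund

/-- The equation for `m` is solvable because `α U(R)` is invertible: if it annihilated `c`, the
boundary form of `U c` would vanish at both ends, and for nonreal `z` this leaves no energy on `[0,
R]`. -/
theorem exists_boundary_matrix (h : H.IsFund α z U V) (hreg : H.RegularAtZero) (hz : z.im ≠ 0)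
    (hα : α * αᴴ = 1) (hαJ : α * Matrix.J (Fin n) ℂ * αᴴ = 0) {R : ℝ} (hR : 0 ≤ R)
    (hRd : ∀ v : Vec n, (∀ᵐ x, x ∈ Ioc 0 R → H x *ᵥ v = 0) → v = 0) :
    ∃ m : Matrix (Fin n) (Fin n) ℂ, α * (V R + U R * m) = 0 := by
  have hinj : Function.Injective (α * U R).mulVec := by
    rw [← coe_mulVecLin, ← LinearMap.ker_eq_bot, LinearMap.ker_eq_bot']
    intro c hc
    have hp := h.u_solution.pair c
    have hc' : α *ᵥ (U R *ᵥ c) = 0 := by rw [mulVec_mulVec]; exact hc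
    have hc0 : α *ᵥ (U 0 *ᵥ c) = 0 := by rw [mulVec_mulVec, h.alpha_u_zero hαJ, zero_mulVec]
    have he := hp.energy hreg le_rfl hR
    simp only [jform_eq_zero_of_ker hα hαJ hc' hc', jform_eq_zero_of_ker hα hαJ hc0 hc0] at he
    have he' : ∫ x in 0..R, (H.ip (fun x => U x *ᵥ c) (fun x => U x *ᵥ c) x).re = 0 := by
      have h2 : 2 * z.im ≠ 0 := by simpa using hz
      simpa [hz] using he
    have h0 : U 0 *ᵥ c = 0 := hp.eq_zero_of_integral hreg hR hRd he'
    have h1 : (αᴴᴴ * Matrix.J (Fin n) ℂ) *ᵥ (U 0 *ᵥ c) = c := by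
      rw [mulVec_mulVec, h.u_zero, initial_vu hα, one_mulVec]
    rw [← h1, h0, mulVec_zero]
  have hu : IsUnit (α * U R).det := by
    rw [← Matrix.isUnit_iff_isUnit_det]
    exact Matrix.mulVec_injective_iff_isUnit.1 hinj
  refine ⟨-((α * U R)⁻¹ * (α * V R)), ?_⟩
  rw [Matrix.mul_add, ← Matrix.mul_assoc, Matrix.mul_neg, ← Matrix.mul_assoc,
    Matrix.mul_nonsing_inv _ hu, Matrix.one_mul, add_neg_cancel]

theorem sign_of_boundary (h : H.IsFund α z U V) (hreg : H.RegularAtZero) (hα : α * αᴴ = 1)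
    (hαJ : α * Matrix.J (Fin n) ℂ * αᴴ = 0) {R : ℝ} {m : Matrix (Fin n) (Fin n) ℂ}
    (hm : α * (V R + U R * m) = 0) (c : Fin n → ℂ) {x : ℝ} (hx : 0 ≤ x) (hxR : x ≤ R) :
    (jform ((V x + U x * m) *ᵥ c) ((V x + U x * m) *ᵥ c)).im =
      2 * z.im * ∫ t in x..R, (H.ip (fun x => (V x + U x * m) *ᵥ c)
        (fun x => (V x + U x * m) *ᵥ c) t).re := by
  have he := (h.w_solution m c).energy hreg hx (hx.trans hxR)
  have h0 : α *ᵥ ((V R + U R * m) *ᵥ c) = 0 := by rw [mulVec_mulVec, hm, zero_mulVec]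
  simp only [jform_eq_zero_of_ker hα hαJ h0 h0, Complex.zero_im] at he
  linarith

/-- At `R` both matrix solutions take values in the isotropic kernel of `α`, so the constant `m -
m'*` is zero. -/
theorem boundary_matrix_conj (h : H.IsFund α z U V) (h' : H.IsFund α (starRingEnd ℂ z) U' V')
    (hreg : H.RegularAtZero) (hα : α * αᴴ = 1) (hαJ : α * Matrix.J (Fin n) ℂ * αᴴ = 0) {R : ℝ}
    (hR : 0 ≤ R) {m m' : Matrix (Fin n) (Fin n) ℂ} (hm : α * (V R + U R * m) = 0)
    (hm' : α * (V' R + U' R * m') = 0) : m' = mᴴ := by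
  have h1 : m - m'ᴴ = 0 := by
    rw [← h.form_ww h' hreg hα hαJ m m' hR]
    refine matrix_eq_of_forms fun a b => ?_
    rw [← jform_mulVec, jform_eq_zero_of_ker hα hαJ
      (by rw [mulVec_mulVec, hm', zero_mulVec]) (by rw [mulVec_mulVec, hm, zero_mulVec])]
    simp
  rw [sub_eq_zero.1 h1, conjTranspose_conjTranspose]

/-- The energy on `[0, R₀]` is a positive definite quadratic form in the initial coefficients, so it
is at least `δ t²`, where `t` is the norm of the `j`-th column of `m`. The energy on `[0, R]` equals
`Im m_jj / Im z`, at most `t / |Im z|`. Hence `t ≤ 1 / (δ |Im z|)`, whatever `R` is. -/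
theorem exists_boundary_matrix_bound (h : H.IsFund α z U V) (hreg : H.RegularAtZero)
    (hz : z.im ≠ 0) (hα : α * αᴴ = 1) (hαJ : α * Matrix.J (Fin n) ℂ * αᴴ = 0) {R₀ : ℝ}
    (hR₀ : 0 ≤ R₀) (hRd : ∀ v : Vec n, (∀ᵐ x, x ∈ Ioc 0 R₀ → H x *ᵥ v = 0) → v = 0) :
    ∃ K : ℝ, ∀ R ≥ R₀, ∀ m : Matrix (Fin n) (Fin n) ℂ, α * (V R + U R * m) = 0 →
      ∀ i j, ‖m i j‖ ≤ K := by
  let Y : (Fin n → ℂ) × (Fin n → ℂ) → ℝ → Vec n := fun d x => V x *ᵥ d.1 + U x *ᵥ d.2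
  have hY : ∀ d, H.Pair (Y d) (z • Y d) := fun d => by
    have := (h.v_solution.pair d.1).add (h.u_solution.pair d.2)
    rwa [← smul_add] at this
  -- Written through boundary values the energy is visibly continuous in `d`; written as an
  -- integral, in `hqi`, it is visibly nonnegative.
  let q : (Fin n → ℂ) × (Fin n → ℂ) → ℝ := fun d =>
    ((jform (Y d 0) (Y d 0)).im - (jform (Y d R₀) (Y d R₀)).im) / (2 * z.im)
  have hqi : ∀ d, q d = ∫ x in 0..R₀, (H.ip (Y d) (Y d) x).re := fun d => by
    have he := (hY d).energy hreg le_rfl hR₀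
    have h2 : 2 * z.im ≠ 0 := by simpa using hz
    simp only [q]
    rw [div_eq_iff h2]
    linarith
  have hYc : ∀ x, Continuous fun d => Y d x := fun x =>
    (continuous_const.matrix_mulVec continuous_fst).add
      (continuous_const.matrix_mulVec continuous_snd)
  have hjc : ∀ x, Continuous fun d => (jform (Y d x) (Y d x)).im := fun x =>
    Complex.continuous_im.comp
      ((hYc x).star.dotProduct (continuous_const.matrix_mulVec (hYc x)))
  have hqc : Continuous q := ((hjc 0).sub (hjc R₀)).div_const _
  have hqs : ∀ (t : ℝ) d, q (t • d) = t ^ 2 * q d := fun t d => by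
    have h1 : ∀ x, Y (t • d) x = (t : ℂ) • Y d x := fun x => by
      have : ∀ c : Fin n → ℂ, t • c = (t : ℂ) • c := fun c => by
        funext i; simp
      simp only [Y, Prod.smul_fst, Prod.smul_snd, this, mulVec_smul, smul_add]
    rw [hqi, hqi, ← intervalIntegral.integral_const_mul]
    refine intervalIntegral.integral_congr fun x _ => ?_
    simp only [Hamiltonian.ip, h1, re_form_smul]
    simp
  have hqp : ∀ d, d ≠ 0 → 0 < q d := fun d hd => by
    have h0 : 0 ≤ q d := by rw [hqi]; exact integral_ip_self_nonneg H _ le_rfl hR₀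
    refine lt_of_le_of_ne h0 fun hq0 => hd ?_
    have h1 : Y d 0 = 0 := (hY d).eq_zero_of_integral hreg hR₀ hRd (by rw [← hqi, ← hq0])
    have h1' : αᴴ *ᵥ d.1 + (-(Matrix.J (Fin n) ℂ * αᴴ)) *ᵥ d.2 = 0 := by
      have h2 := h1
      simp only [Y, h.v_zero, h.u_zero] at h2
      exact h2
    have h2 := congrArg (fun w => (αᴴᴴ * Matrix.J (Fin n) ℂ) *ᵥ w) h1'
    have h3 := congrArg (fun w => ((-(Matrix.J (Fin n) ℂ * αᴴ))ᴴ * Matrix.J (Fin n) ℂ) *ᵥ w) h1'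
    simp only [mulVec_add, mulVec_mulVec, initial_vv hαJ, initial_vu hα, zero_mulVec, one_mulVec,
      zero_add, mulVec_zero] at h2
    simp only [mulVec_add, mulVec_mulVec, initial_uv hα, initial_uu hαJ, zero_mulVec, add_zero,
      mulVec_zero] at h3
    rw [neg_mulVec, one_mulVec, neg_eq_zero] at h3
    exact Prod.ext h3 h2
  obtain ⟨δ, hδ, hlow⟩ := exists_quadratic_lower_bound hqc hqs hqp
  refine ⟨(δ * |z.im|)⁻¹, fun R hR m hm i j => ?_⟩
  set c : Fin n → ℂ := Pi.single j 1
  have hmc : ∀ k, (m *ᵥ c) k = m k j := fun k => by simp [c]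
  have hYw : Y (c, m *ᵥ c) = fun x => (V x + U x * m) *ᵥ c := by
    funext x; simp [Y, add_mulVec]
  have hs := h.sign_of_boundary hreg hα hαJ hm c le_rfl (hR₀.trans hR)
  rw [jform_mulVec, h.v_zero, h.u_zero] at hs
  have hform : (αᴴ + -(Matrix.J (Fin n) ℂ * αᴴ) * m)ᴴ * Matrix.J (Fin n) ℂ *
      (αᴴ + -(Matrix.J (Fin n) ℂ * αᴴ) * m) = m - mᴴ := by
    simp only [conjTranspose_add, conjTranspose_mul, Matrix.add_mul, Matrix.mul_add]
    rw [initial_vv hαJ, ← Matrix.mul_assoc _ _ m, initial_vu hα, Matrix.mul_assoc mᴴ,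
      Matrix.mul_assoc mᴴ, initial_uv hα, Matrix.mul_assoc mᴴ,
      ← Matrix.mul_assoc _ _ m, initial_uu hαJ]
    simp [sub_eq_add_neg, add_comm]
  have hjj : star c ⬝ᵥ ((m - mᴴ) *ᵥ c) = m j j - star (m j j) := by
    simp [c]
  rw [hform, hjj, ← hYw] at hs
  have him : (m j j - star (m j j)).im = 2 * (m j j).im := by
    rw [Complex.star_def, Complex.sub_im, Complex.conj_im]; ring
  rw [him] at hs
  have hle : q (c, m *ᵥ c) ≤ ∫ t in 0..R, (H.ip (Y (c, m *ᵥ c)) (Y (c, m *ᵥ c)) t).re := by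
    have hl := (hY (c, m *ᵥ c)).locL2 hreg
    have hi : ∀ a b : ℝ, 0 ≤ a → 0 ≤ b → IntervalIntegrable
        (fun t => (H.ip (Y (c, m *ᵥ c)) (Y (c, m *ᵥ c)) t).re) volume a b := fun a b ha hb => by
      have := hl.intervalIntegrable_ip hl ha hb
      exact ⟨this.1.re, this.2.re⟩
    rw [hqi, ← intervalIntegral.integral_add_adjacent_intervals (hi 0 R₀ le_rfl hR₀)
      (hi R₀ R hR₀ (hR₀.trans hR))]
    have := integral_ip_self_nonneg H (Y (c, m *ᵥ c)) hR₀ hR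
    linarith
  set t := ‖m *ᵥ c‖
  have ht : ∀ k, ‖m k j‖ ≤ t := fun k => by rw [← hmc k]; exact norm_le_pi_norm _ k
  refine (ht i).trans ?_
  have h1 : δ * t ^ 2 ≤ q (c, m *ᵥ c) := by
    refine le_trans ?_ (hlow _)
    have : t ≤ ‖(c, m *ᵥ c)‖ := le_max_right _ _
    gcongr
  have h2 : |z.im| * (δ * t ^ 2) ≤ t := by
    refine (mul_le_mul_of_nonneg_left (h1.trans hle) (abs_nonneg _)).trans ?_
    have h3 : z.im * ∫ t in 0..R, (H.ip (Y (c, m *ᵥ c)) (Y (c, m *ᵥ c)) t).re = (m j j).im := by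
      linarith
    rw [← abs_of_nonneg (integral_ip_self_nonneg H (Y (c, m *ᵥ c)) le_rfl (hR₀.trans hR)),
      ← abs_mul, h3]
    exact (Complex.abs_im_le_norm _).trans (ht j)
  have hz' : 0 < |z.im| := abs_pos.2 hz
  rcases (norm_nonneg (m *ᵥ c)).eq_or_lt with h0 | h0
  · show t ≤ _
    rw [show t = 0 from h0.symm]; positivity
  · have h0' : 0 < t := h0
    rw [le_inv_comm₀ h0' (by positivity), inv_eq_one_div, le_div_iff₀ h0']
    nlinarith

/-- Weyl's nesting argument: the bounded matrices whose signs are correct on `[0, k]` form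
decreasing compact nonempty sets. Imposing the condition at both parameters at once makes the limits
there adjoint to each other. -/
theorem exists_signDefinite (h : H.IsFund α z U V) (h' : H.IsFund α (starRingEnd ℂ z) U' V')
    (hdef : H.IsDefinite) (hreg : H.RegularAtZero) (hz : z.im ≠ 0) (hα : α * αᴴ = 1)
    (hαJ : α * Matrix.J (Fin n) ℂ * αᴴ = 0) :
    ∃ m : Matrix (Fin n) (Fin n) ℂ, SignDefinite z (fun x => V x + U x * m) ∧
      SignDefinite (starRingEnd ℂ z) (fun x => V' x + U' x * mᴴ) := by
  obtain ⟨R₀, hR₀, hRd⟩ := exists_definite_interval hdef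
  have hRd' : ∀ R ≥ R₀, ∀ v : Vec n, (∀ᵐ x, x ∈ Ioc 0 R → H x *ᵥ v = 0) → v = 0 :=
    fun R hR v hv => hRd v (by
      filter_upwards [hv] with x hx hxR
      exact hx ⟨hxR.1, hxR.2.trans hR⟩)
  obtain ⟨K, hK⟩ := h.exists_boundary_matrix_bound hreg hz hα hαJ hR₀.le hRd
  have hz' : (starRingEnd ℂ z).im ≠ 0 := by simpa using hz
  let P : Matrix (Fin n) (Fin n) ℂ → ℝ → (Fin n → ℂ) → Prop := fun m x c =>
    0 ≤ z.im * (jform ((V x + U x * m) *ᵥ c) ((V x + U x * m) *ᵥ c)).im ∧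
    0 ≤ (starRingEnd ℂ z).im * (jform ((V' x + U' x * mᴴ) *ᵥ c) ((V' x + U' x * mᴴ) *ᵥ c)).im
  let C : ℕ → Set (Matrix (Fin n) (Fin n) ℂ) := fun k =>
    {m | (∀ i j, ‖m i j‖ ≤ K) ∧ ∀ x : ℝ, 0 ≤ x → x ≤ k → ∀ c, P m x c}
  have hcj : ∀ (W : Matrix (Fin n) (Fin n) ℂ → Mat n), Continuous W → ∀ (s : ℝ) (c : Fin n → ℂ),
      IsClosed {m | 0 ≤ s * (jform (W m *ᵥ c) (W m *ᵥ c)).im} := fun W hW s c => by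
    have h1 : Continuous fun m => W m *ᵥ c := hW.matrix_mulVec continuous_const
    exact isClosed_le continuous_const (continuous_const.mul (Complex.continuous_im.comp
      (h1.star.dotProduct (continuous_const.matrix_mulVec h1))))
  have hclosed : ∀ k, IsClosed (C k) := fun k => by
    have h1 : C k = (⋂ i, ⋂ j, {m | ‖m i j‖ ≤ K}) ∩
        ⋂ x : ℝ, ⋂ (_ : 0 ≤ x), ⋂ (_ : x ≤ k), ⋂ c, {m | P m x c} := by
      ext m
      simp [C]
    rw [h1]
    refine IsClosed.inter (isClosed_iInter fun i => isClosed_iInter fun j =>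
      isClosed_le (continuous_id.matrix_elem i j).norm continuous_const) ?_
    refine isClosed_iInter fun x => isClosed_iInter fun _ => isClosed_iInter fun _ =>
      isClosed_iInter fun c => ?_
    exact IsClosed.inter
      (hcj _ (continuous_const.add (continuous_const.matrix_mul continuous_id)) _ c)
      (hcj _ (continuous_const.add
        (continuous_const.matrix_mul continuous_id.matrix_conjTranspose)) _ c)
  have hcompact : IsCompact (C 0) := by
    have h1 : IsCompact (Set.pi univ fun _ : Fin n => Set.pi univ fun _ : Fin n =>
        Metric.closedBall (0 : ℂ) K) :=
      isCompact_univ_pi fun _ => isCompact_univ_pi fun _ => isCompact_closedBall _ _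
    refine IsCompact.of_isClosed_subset h1 (hclosed 0) fun m hm => ?_
    exact fun i _ j _ => by simpa using hm.1 i j
  have hne : ∀ k, (C k).Nonempty := fun k => by
    -- Beyond `R₀` the bound `K` and definiteness are available; beyond `k` the endpoint condition
    -- gives the sign on all of `[0, k]`.
    set R : ℝ := max R₀ k
    have hR : R₀ ≤ R := le_max_left _ _
    have hR0 : 0 ≤ R := hR₀.le.trans hR
    obtain ⟨m, hm⟩ := h.exists_boundary_matrix hreg hz hα hαJ hR0 (hRd' R hR)
    obtain ⟨m', hm'⟩ := h'.exists_boundary_matrix hreg hz' hα hαJ hR0 (hRd' R hR)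
    obtain rfl := h.boundary_matrix_conj h' hreg hα hαJ hR0 hm hm'
    refine ⟨m, hK R hR m hm, fun x hx hxk c => ?_⟩
    have hxR : x ≤ R := hxk.trans (le_max_right _ _)
    have hsq : ∀ (w : ℂ) (y : ℝ → Vec n),
        0 ≤ w.im * (2 * w.im * ∫ t in x..R, (H.ip y y t).re) := fun w y => by
      have h1 := integral_ip_self_nonneg H y hx hxR
      have h2 : 0 ≤ w.im * w.im := mul_self_nonneg _
      have h3 := mul_nonneg h2 h1
      linarith
    exact ⟨by rw [h.sign_of_boundary hreg hα hαJ hm c hx hxR]; exact hsq _ _,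
      by rw [h'.sign_of_boundary hreg hα hαJ hm' c hx hxR]; exact hsq _ _⟩
  have hmono : ∀ k, C (k + 1) ⊆ C k := fun k m hm =>
    ⟨hm.1, fun x hx hxk => hm.2 x hx (hxk.trans (by push_cast; linarith))⟩
  obtain ⟨m, hm⟩ := IsCompact.nonempty_iInter_of_sequence_nonempty_isCompact_isClosed C hmono hne
    hcompact hclosed
  have hP : ∀ c x, 0 ≤ x → P m x c := fun c x hx => by
    obtain ⟨k, hk⟩ := exists_nat_ge x
    exact (mem_iInter.1 hm k).2 x hx hk c
  exact ⟨m, fun c x hx => (hP c x hx).1, fun c x hx => (hP c x hx).2⟩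

end Hamiltonian.IsFund

end Weyl

end CanonicalSystem

namespace CanonicalSystem

variable {n : ℕ}

/-! ### Convergence in `L²_H` -/

section Fatou

open Filter Topology

variable {H : Hamiltonian n}

theorem LocL2.aestronglyMeasurable {f : ℝ → Vec n} (hf : LocL2 H f) :
    AEStronglyMeasurable f halfLine := by
  refine aestronglyMeasurable_of_tendsto_ae atTop (fun k : ℕ => (hf k).1)
    (Eventually.of_forall fun x => ?_)
  obtain ⟨k, hk⟩ := exists_nat_ge x
  refine tendsto_const_nhds.congr' ?_
  filter_upwards [eventually_ge_atTop k] with l hl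
  have : x ∈ Iic (l : ℝ) := hk.trans (by exact_mod_cast hl)
  rw [indicator_of_mem this]

/-- Fatou's lemma for the cut-off functions: each `w k` needs to be controlled only up to `k`. -/
theorem sqNorm_le_of_tendsto {f : ℝ → Vec n} {w : ℕ → ℝ → Vec n} {C : ENNReal}
    (hw : ∀ k, LocL2 H (w k)) (h : ∀ k : ℕ, H.sqNorm ((Iic (k : ℝ)).indicator (w k)) ≤ C)
    (hlim : ∀ x, 0 < x → Tendsto (fun k => w k x) atTop (𝓝 (f x))) : H.sqNorm f ≤ C := by
  let F : ℕ → ℝ → ENNReal := fun k x => ENNReal.ofReal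
    (star ((Iic (k : ℝ)).indicator (w k) x) ⬝ᵥ (H x *ᵥ (Iic (k : ℝ)).indicator (w k) x)).re
  have h1 : H.sqNorm f = ∫⁻ x, liminf (fun k => F k x) atTop ∂halfLine := by
    refine lintegral_congr_ae ?_
    filter_upwards [ae_restrict_mem measurableSet_Ioi] with x hx
    refine (Tendsto.liminf_eq ?_).symm
    obtain ⟨k, hk⟩ := exists_nat_ge x
    have hc : Continuous fun v : Vec n => ENNReal.ofReal (star v ⬝ᵥ (H x *ᵥ v)).re :=
      ENNReal.continuous_ofReal.comp (Complex.continuous_re.comp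
        (continuous_id.star.dotProduct (continuous_const.matrix_mulVec continuous_id)))
    refine ((hc.tendsto (f x)).comp (hlim x hx)).congr' ?_
    filter_upwards [eventually_ge_atTop k] with l hl
    have : x ∈ Iic (l : ℝ) := hk.trans (by exact_mod_cast hl)
    simp only [F, indicator_of_mem this, Function.comp]
  rw [h1]
  refine (lintegral_liminf_le' fun k => aemeasurable_form H (hw k k).1).trans ?_
  exact liminf_le_of_frequently_le' (Frequently.of_forall h)

theorem sqNorm_indicator_eq {f : ℝ → Vec n} (hf : LocL2 H f) {R : ℝ} (hR : 0 ≤ R) :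
    H.sqNorm ((Iic R).indicator f) = ENNReal.ofReal (∫ x in 0..R, (H.ip f f x).re) := by
  rw [sqNorm_eq_ofReal H (hf R), intervalIntegral.integral_of_le hR]
  simp only [ip_indicator]
  have h1 : (fun x => ((Iic R).indicator (H.ip f f) x).re) =
      (Iic R).indicator fun x => (H.ip f f x).re := by
    funext x
    by_cases hx : x ∈ Iic R <;> simp [hx]
  rw [h1, integral_indicator measurableSet_Iic, Measure.restrict_restrict measurableSet_Iic,
    Iic_inter_Ioi]

theorem mem_preL2_of_integral_le {f : ℝ → Vec n} (hf : LocL2 H f) {B : ℝ}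
    (h : ∀ R : ℝ, 0 ≤ R → ∫ x in 0..R, (H.ip f f x).re ≤ B) : f ∈ H.preL2 := by
  refine ⟨hf.aestronglyMeasurable, lt_of_le_of_lt (sqNorm_le_of_tendsto (fun _ => hf)
    (C := ENNReal.ofReal B) (fun k => ?_) fun x _ => tendsto_const_nhds) ENNReal.ofReal_lt_top⟩
  rw [sqNorm_indicator_eq hf (Nat.cast_nonneg k)]
  exact ENNReal.ofReal_le_ofReal (h k (Nat.cast_nonneg k))

/-! ### Energy bounds for the homogeneous and the inhomogeneous equation -/

theorem Hamiltonian.Pair.mem_preL2_of_sign (hreg : H.RegularAtZero) {z : ℂ} (hz : z.im ≠ 0)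
    {y : ℝ → Vec n} (hy : H.Pair y (z • y))
    (hs : ∀ x, 0 ≤ x → 0 ≤ z.im * (jform (y x) (y x)).im) : y ∈ H.preL2 := by
  refine mem_preL2_of_integral_le (hy.locL2 hreg) (B := (z.im * (jform (y 0) (y 0)).im) /
    (2 * z.im ^ 2)) fun R hR => ?_
  rw [le_div_iff₀ (by positivity)]
  have h1 := hy.energy hreg le_rfl hR
  have h2 := hs R hR
  have h3 : (jform (y R) (y R)).im = (jform (y 0) (y 0)).im -
      (2 * z.im * ∫ x in 0..R, (H.ip y y x).re) := by linarith
  rw [h3] at h2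
  linarith

/-- The inequality holds pointwise: `Im z` times the imaginary part of the Lagrange density is at
most `h* H h - (Im z)² w* H w`. Its integral is `Im z · Im (w* J w)(R)`, which is nonnegative. -/
theorem Hamiltonian.Pair.energy_inhom (hreg : H.RegularAtZero) {z : ℂ} {w h : ℝ → Vec n}
    (hw : H.Pair w (z • w + h)) (hh : LocL2 H h) {R : ℝ} (hR : 0 ≤ R)
    (h0 : jform (w 0) (w 0) = 0) (hs : 0 ≤ z.im * (jform (w R) (w R)).im) :
    z.im ^ 2 * ∫ x in 0..R, (H.ip w w x).re ≤ ∫ x in 0..R, (H.ip h h x).re := by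
  have hl := hw.locL2 hreg
  have hzl : LocL2 H (z • w + h) := (hl.smul z).add hh
  have he := hw.lagrange hreg hw hzl hzl le_rfl hR
  rw [h0, sub_zero] at he
  have hi : IntervalIntegrable (fun x => H.ip (z • w + h) w x - H.ip w (z • w + h) x)
      volume 0 R :=
    (hzl.intervalIntegrable_ip hl le_rfl hR).sub (hl.intervalIntegrable_ip hzl le_rfl hR)
  have him : ∫ x in 0..R, (H.ip (z • w + h) w x - H.ip w (z • w + h) x).im =
      (jform (w R) (w R)).im := by
    rw [← he]
    exact Complex.imCLM.intervalIntegral_comp_comm hi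
  have hre : ∀ {f : ℝ → Vec n}, LocL2 H f →
      IntervalIntegrable (fun x => (H.ip f f x).re) volume 0 R := fun hf =>
    ⟨(hf.intervalIntegrable_ip hf le_rfl hR).1.re, (hf.intervalIntegrable_ip hf le_rfl hR).2.re⟩
  have hii : IntervalIntegrable (fun x => z.im *
      (H.ip (z • w + h) w x - H.ip w (z • w + h) x).im) volume 0 R :=
    IntervalIntegrable.const_mul ⟨hi.1.im, hi.2.im⟩ _
  have key : ∫ x in 0..R, z.im * (H.ip (z • w + h) w x - H.ip w (z • w + h) x).im ≤
      ∫ x in 0..R, ((H.ip h h x).re - z.im ^ 2 * (H.ip w w x).re) := by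
    refine intervalIntegral.integral_mono_ae_restrict hR hii
      ((hre hh).sub ((hre hl).const_mul _)) ?_
    rw [Filter.EventuallyLE, ae_restrict_iff' measurableSet_Icc, ← uIcc_of_le hR]
    filter_upwards [ae_uIcc_of_ae_halfLine H.posSemidef le_rfl hR] with x hx hxR
    have hM := hx hxR
    -- Scaling `w` by `Im z` lets the cross term `2 Im z Im (h* H w)` absorb exactly half of `2 (Im
    -- z)² w* H w`.
    have h1 := norm_form_le hM (h x) (((z.im : ℂ)) • w x)
    rw [re_form_smul] at h1
    simp only [Hamiltonian.ip, Pi.add_apply, Pi.smul_apply, star_add, star_smul, add_dotProduct,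
      mulVec_add, dotProduct_add, mulVec_smul, smul_dotProduct, dotProduct_smul, smul_eq_mul]
      at h1 ⊢
    have h2 : star (w x) ⬝ᵥ (H x *ᵥ h x) = star (star (h x) ⬝ᵥ (H x *ᵥ w x)) :=
      (star_form hM.isHermitian _ _).symm
    have h3 : (star (w x) ⬝ᵥ (H x *ᵥ w x)).im = 0 := by
      have := star_form hM.isHermitian (w x) (w x)
      rw [Complex.star_def] at this
      exact Complex.conj_eq_iff_im.1 this
    rw [h2]
    set p := star (h x) ⬝ᵥ (H x *ᵥ w x)
    set a := star (w x) ⬝ᵥ (H x *ᵥ w x)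
    have h4 : z.im * p.im ≤ ‖(z.im : ℂ) * p‖ := by
      rw [norm_mul, Complex.norm_real, Real.norm_eq_abs]
      refine (le_abs_self _).trans ?_
      rw [abs_mul]
      exact mul_le_mul_of_nonneg_left (Complex.abs_im_le_norm p) (abs_nonneg _)
    rw [Complex.norm_real, Real.norm_eq_abs, sq_abs] at h1
    simp only [Complex.star_def, Complex.sub_im, Complex.add_im, Complex.mul_im, Complex.conj_im,
      Complex.conj_re, h3]
    nlinarith
  rw [intervalIntegral.integral_const_mul, him,
    intervalIntegral.integral_sub (hre hh) ((hre hl).const_mul _),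
    intervalIntegral.integral_const_mul] at key
  linarith

end Fatou

/-! ### Variation of constants -/

section Variation

variable {H : Hamiltonian n}

theorem Hamiltonian.Pair.congr_left {y y' w : ℝ → Vec n} (h : H.Pair y w)
    (he : EqOn y' y (Ici 0)) : H.Pair y' w := by
  refine ⟨fun a b hab hs => ac_congr (h.1 a b hab hs) fun x hx => he (hs ?_), ?_⟩
  · rwa [uIcc_of_le hab] at hx
  · filter_upwards [h.2, ae_restrict_mem measurableSet_Ioi] with x ⟨d, hd, hd'⟩ hx
    refine ⟨d, hd.congr_of_eventuallyEq ?_, hd'⟩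
    filter_upwards [Ioi_mem_nhds hx] with t ht
    exact he (mem_Ici.2 (mem_Ioi.1 ht).le)

/-- The product rule, applied column by column because only the columns of `U` are known to solve
the equation. -/
theorem variation_of_constants {z : ℂ} {U : ℝ → Mat n}
    (hU : ∀ c, H.Pair (fun x => U x *ᵥ c) (z • fun x => U x *ᵥ c)) {c c' : ℝ → Fin n → ℂ}
    (hc : ∀ b, 0 ≤ b → AbsolutelyContinuousOnInterval c 0 b)
    (hc' : ∀ᵐ x ∂halfLine, HasDerivAt c (c' x) x) :
    LocACOn (fun x => U x *ᵥ c x) (Ici 0) ∧ JDerivEq (fun x => U x *ᵥ c x)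
      (fun x => -(z • (H x *ᵥ (U x *ᵥ c x))) + Matrix.J (Fin n) ℂ *ᵥ (U x *ᵥ c' x)) := by
  have hsum : ∀ x (d : Fin n → ℂ), U x *ᵥ d = ∑ j, d j • (U x *ᵥ Pi.single j 1) := fun x d => by
    funext i
    simp [mulVec, dotProduct, Finset.sum_apply, mul_comm]
  constructor
  · intro a b hab hs
    have ha : 0 ≤ a := hs (left_mem_Icc.2 hab)
    have hb : 0 ≤ b := ha.trans hab
    have hsub : uIcc a b ⊆ uIcc 0 b := by
      rw [uIcc_of_le hab, uIcc_of_le hb]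
      exact Icc_subset_Icc_left ha
    simp only [hsum _ (c _)]
    refine ac_sum _ fun j _ => ?_
    have h1 : AbsolutelyContinuousOnInterval (fun x => c x j) a b :=
      ac_of_dist_le (K := 1) ((hc b hb).mono hsub) fun x _ y _ => by
        rw [one_mul]; exact dist_le_pi_dist (c x) (c y) j
    have h2 := (hU (Pi.single j 1)).1 a b hab hs
    exact AbsolutelyContinuousOnInterval.fun_smul (M := ℂ) (F := Vec n) h1 h2
  · have hd := ae_all_iff.2 fun j : Fin n => (hU (Pi.single j 1)).2
    filter_upwards [hd, hc'] with x hx hcx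
    choose e he he' using hx
    refine ⟨∑ j, (c x j • e j + c' x j • (U x *ᵥ Pi.single j 1)), ?_, ?_⟩
    · simp only [hsum _ (c _)]
      exact HasDerivAt.fun_sum fun j _ => (hasDerivAt_pi.1 hcx j).smul (he j)
    · rw [Finset.sum_add_distrib, ← hsum x (c' x), mulVec_add]
      congr 1
      have h1 : Matrix.J (Fin n) ℂ *ᵥ ∑ j, c x j • e j =
          ∑ j, c x j • (Matrix.J (Fin n) ℂ *ᵥ e j) := by
        have := map_sum (Matrix.J (Fin n) ℂ).mulVecLin (fun j => c x j • e j) Finset.univ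
        simpa only [mulVecLin_apply, mulVec_smul] using this
      have h2 : H x *ᵥ (U x *ᵥ c x) = ∑ j, c x j • (H x *ᵥ (U x *ᵥ Pi.single j 1)) := by
        have := map_sum (H x).mulVecLin (fun j => c x j • (U x *ᵥ Pi.single j 1)) Finset.univ
        rw [hsum x (c x)]
        simpa only [mulVecLin_apply, mulVec_smul] using this
      rw [h1, h2, Finset.smul_sum, ← Finset.sum_neg_distrib]
      refine Finset.sum_congr rfl fun j _ => ?_
      rw [he' j, Pi.smul_apply, mulVec_smul, smul_neg, smul_comm]

end Variation

end CanonicalSystem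

namespace CanonicalSystem

variable {n : ℕ}

/-! ### The Green operator -/

/-- Fundamental systems at `z` and at the conjugate of `z`, and a matrix `m` for which the boundary
forms of `V + U m` and `V' + U' m*` have the right sign. -/
structure Hamiltonian.WeylData (H : Hamiltonian n) (α : Matrix (Fin n) (Fin n ⊕ Fin n) ℂ) (z : ℂ)
    (U V U' V' : ℝ → Mat n) (m : Matrix (Fin n) (Fin n) ℂ) : Prop where
  fund : H.IsFund α z U V
  fund' : H.IsFund α (starRingEnd ℂ z) U' V'
  sign : SignDefinite z (fun x => V x + U x * m)
  sign' : SignDefinite (starRingEnd ℂ z) (fun x => V' x + U' x * mᴴ)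

/-- The function `W* H h`. -/
def Hamiltonian.pairing (H : Hamiltonian n) (W : ℝ → Mat n) (h : ℝ → Vec n) (y : ℝ) : Fin n → ℂ :=
  (W y)ᴴ *ᵥ (H y *ᵥ h y)

/-- The function `U(x) ∫ₓ^∞ W'* H h + W(x) ∫₀ˣ U'* H h`. -/
def Hamiltonian.greenSol (H : Hamiltonian n) (U W U' W' : ℝ → Mat n) (h : ℝ → Vec n) (x : ℝ) :
    Vec n :=
  U x *ᵥ ((∫ y in Ioi 0, H.pairing W' h y) - ∫ y in 0..x, H.pairing W' h y) +
    W x *ᵥ ∫ y in 0..x, H.pairing U' h y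

section Pairing

variable {H : Hamiltonian n} {W : ℝ → Mat n} {h : ℝ → Vec n}

theorem pairing_apply (y : ℝ) (j : Fin n) :
    H.pairing W h y j = H.ip (fun y => W y *ᵥ Pi.single j 1) h y := by
  simp only [Hamiltonian.pairing, Hamiltonian.ip, star_mulVec, ← dotProduct_mulVec]
  simp

theorem integrableOn_pairing (hW : ∀ c, LocL2 H fun y => W y *ᵥ c) (hh : LocL2 H h) (R : ℝ) :
    IntegrableOn (H.pairing W h) (Ioc 0 R) volume := by
  refine Integrable.of_eval fun j => ?_
  simp only [pairing_apply]
  exact (hW _).integrableOn_ip hh R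

theorem intervalIntegrable_pairing (hW : ∀ c, LocL2 H fun y => W y *ᵥ c) (hh : LocL2 H h)
    {a b : ℝ} (ha : 0 ≤ a) (hb : 0 ≤ b) : IntervalIntegrable (H.pairing W h) volume a b := by
  rw [intervalIntegrable_iff]
  exact (integrableOn_pairing hW hh (max a b)).mono_set (Ioc_subset_Ioc_left (le_min ha hb))

theorem integrable_pairing (hW : ∀ c, (fun y => W y *ᵥ c) ∈ H.preL2) (hh : h ∈ H.preL2) :
    IntegrableOn (H.pairing W h) (Ioi 0) volume := by
  refine Integrable.of_eval fun j => ?_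
  simp only [pairing_apply]
  exact integrable_ip H (hW _) hh

end Pairing

namespace Hamiltonian.WeylData

variable {H : Hamiltonian n} {α : Matrix (Fin n) (Fin n ⊕ Fin n) ℂ} {z : ℂ}
  {U V U' V' : ℝ → Mat n} {m : Matrix (Fin n) (Fin n) ℂ} {h : ℝ → Vec n}

theorem symm (D : H.WeylData α z U V U' V' m) :
    H.WeylData α (starRingEnd ℂ z) U' V' U V mᴴ :=
  ⟨D.fund', by rw [Complex.conj_conj]; exact D.fund, D.sign', by
    rw [Complex.conj_conj, conjTranspose_conjTranspose]; exact D.sign⟩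

theorem mem_preL2 (D : H.WeylData α z U V U' V' m) (hreg : H.RegularAtZero) (hz : z.im ≠ 0)
    (c : Fin n → ℂ) : (fun x => (V x + U x * m) *ᵥ c) ∈ H.preL2 :=
  (D.fund.w_solution m c).mem_preL2_of_sign hreg hz fun x hx => D.sign c x hx

theorem mem_preL2' (D : H.WeylData α z U V U' V' m) (hreg : H.RegularAtZero) (hz : z.im ≠ 0)
    (c : Fin n → ℂ) : (fun x => (V' x + U' x * mᴴ) *ᵥ c) ∈ H.preL2 :=
  D.symm.mem_preL2 hreg (by simpa using hz) c

/-- The terms in `m` cancel because the matrix at the conjugate parameter is `m*`. -/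
theorem frame_w (D : H.WeylData α z U V U' V' m) (hreg : H.RegularAtZero) (hα : α * αᴴ = 1)
    (hαJ : α * Matrix.J (Fin n) ℂ * αᴴ = 0) {x : ℝ} (hx : 0 ≤ x) :
    (V x + U x * m) * (U' x)ᴴ - U x * (V' x + U' x * mᴴ)ᴴ = Matrix.J (Fin n) ℂ := by
  rw [← D.fund.frame D.fund' hreg hα hαJ hx, conjTranspose_add, conjTranspose_mul,
    conjTranspose_conjTranspose, Matrix.mul_add, Matrix.add_mul, ← Matrix.mul_assoc]
  abel

theorem greenSol_pair (D : H.WeylData α z U V U' V' m) (hreg : H.RegularAtZero) (hz : z.im ≠ 0)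
    (hα : α * αᴴ = 1) (hαJ : α * Matrix.J (Fin n) ℂ * αᴴ = 0) (hh : h ∈ H.preL2) :
    H.Pair (H.greenSol U (fun x => V x + U x * m) U' (fun x => V' x + U' x * mᴴ) h)
      (z • H.greenSol U (fun x => V x + U x * m) U' (fun x => V' x + U' x * mᴴ) h + h) := by
  have hhl := locL2_of_mem H hh
  set W : ℝ → Mat n := fun x => V x + U x * m with hW
  set W' : ℝ → Mat n := fun x => V' x + U' x * mᴴ with hW'
  have hUl : ∀ c, LocL2 H fun y => U' y *ᵥ c := fun c => (D.fund'.u_solution.pair c).locL2 hreg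
  have hWl : ∀ c, LocL2 H fun y => W' y *ᵥ c := fun c => locL2_of_mem H (D.mem_preL2' hreg hz c)
  have hprim : ∀ {Y : ℝ → Mat n}, (∀ c, LocL2 H fun y => Y y *ᵥ c) →
      (∀ b, 0 ≤ b → AbsolutelyContinuousOnInterval (fun x => ∫ y in 0..x, H.pairing Y h y) 0 b) ∧
      ∀ᵐ x ∂halfLine, HasDerivAt (fun x => ∫ y in 0..x, H.pairing Y h y) (H.pairing Y h x) x := by
    intro Y hY
    refine ⟨fun b hb => ac_integral (intervalIntegrable_pairing hY hhl le_rfl hb) left_mem_uIcc, ?_⟩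
    have h1 : ∀ᵐ x, ∀ k : ℕ, x ∈ uIcc (0 : ℝ) k →
        HasDerivAt (fun x => ∫ y in 0..x, H.pairing Y h y) (H.pairing Y h x) x := by
      refine ae_all_iff.2 fun k => ?_
      filter_upwards [(intervalIntegrable_pairing hY hhl le_rfl
        (Nat.cast_nonneg k)).ae_hasDerivAt_integral] with x hx hxk
      exact hx hxk 0 left_mem_uIcc
    filter_upwards [ae_restrict_of_ae h1, ae_restrict_mem measurableSet_Ioi] with x hx hx0
    obtain ⟨k, hk⟩ := exists_nat_ge x
    exact hx k (by rw [uIcc_of_le (by positivity)]; exact ⟨le_of_lt hx0, hk⟩)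
  obtain ⟨hc1, hc2⟩ := hprim hUl
  obtain ⟨hd1, hd2⟩ := hprim hWl
  have h1 := variation_of_constants (fun c => D.fund.u_solution.pair c)
    (c := fun x => (∫ y in Ioi 0, H.pairing W' h y) - ∫ y in 0..x, H.pairing W' h y)
    (c' := fun x => -H.pairing W' h x) (fun b hb => (ac_const _ 0 b).fun_sub (hd1 b hb)) (by
      filter_upwards [hd2] with x hx
      exact hx.const_sub _)
  have h2 := variation_of_constants (D.fund.w_solution m) hc1 hc2
  refine ⟨h1.1.add h2.1, ?_⟩
  have h3 := h1.2.add h2.2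
  filter_upwards [h3, ae_restrict_mem measurableSet_Ioi] with x ⟨d, hd, hd'⟩ hx
  refine ⟨d, hd, hd'.trans ?_⟩
  have hx0 : 0 ≤ x := le_of_lt hx
  -- The derivatives of the coefficients combine to `(W U'* - U W'*) H h = J H h`, and one more `J`
  -- gives `-H h`.
  have h4 : Matrix.J (Fin n) ℂ *ᵥ (U x *ᵥ (-H.pairing W' h x)) +
      Matrix.J (Fin n) ℂ *ᵥ (W x *ᵥ H.pairing U' h x) = -(H x *ᵥ h x) := by
    rw [← mulVec_add, Hamiltonian.pairing, Hamiltonian.pairing, mulVec_neg, mulVec_mulVec _ (U x),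
      mulVec_mulVec _ (W x), ← J_mulVec_J_mulVec (H x *ᵥ h x)]
    congr 1
    rw [← D.frame_w hreg hα hαJ hx0, sub_mulVec]
    abel
  simp only [Pi.add_apply, Pi.smul_apply, Hamiltonian.greenSol, mulVec_add, mulVec_smul, smul_add,
    neg_add]
  rw [← h4]
  abel

theorem greenSol_zero (D : H.WeylData α z U V U' V' m)
    (hαJ : α * Matrix.J (Fin n) ℂ * αᴴ = 0) :
    α *ᵥ H.greenSol U (fun x => V x + U x * m) U' (fun x => V' x + U' x * mᴴ) h 0 = 0 := by
  simp [Hamiltonian.greenSol, mulVec_mulVec, D.fund.alpha_u_zero hαJ]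

/-- Subtracting `U` times the tail integral at `k` gives a solution that equals a Weyl solution at
the point `k` and keeps the condition at `0`. The sign at `k` and the energy inequality bound it on
`[0, k]`; the tails tend to zero and Fatou's lemma passes to the limit. -/
theorem greenSol_sqNorm_le (D : H.WeylData α z U V U' V' m) (hreg : H.RegularAtZero)
    (hz : z.im ≠ 0) (hα : α * αᴴ = 1) (hαJ : α * Matrix.J (Fin n) ℂ * αᴴ = 0)
    (hh : h ∈ H.preL2) :
    H.sqNorm (H.greenSol U (fun x => V x + U x * m) U' (fun x => V' x + U' x * mᴴ) h) ≤
      ENNReal.ofReal ((∫ x, (H.ip h h x).re ∂halfLine) / z.im ^ 2) := by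
  have hhl := locL2_of_mem H hh
  set g := H.greenSol U (fun x => V x + U x * m) U' (fun x => V' x + U' x * mᴴ) h with hg
  have hgp : H.Pair g (z • g + h) := D.greenSol_pair hreg hz hα hαJ hh
  let d : ℝ → Fin n → ℂ := fun R => (∫ y in Ioi 0, H.pairing (fun x => V' x + U' x * mᴴ) h y) -
    ∫ y in 0..R, H.pairing (fun x => V' x + U' x * mᴴ) h y
  have hd : Filter.Tendsto (fun k : ℕ => d k) Filter.atTop (nhds 0) := by
    rw [← sub_self (∫ y in Ioi 0, H.pairing (fun x => V' x + U' x * mᴴ) h y)]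
    exact tendsto_const_nhds.sub (intervalIntegral_tendsto_integral_Ioi 0
      (integrable_pairing (D.mem_preL2' hreg hz) hh) tendsto_natCast_atTop_atTop)
  let w : ℕ → ℝ → Vec n := fun k => g - fun x => U x *ᵥ d k
  have hw : ∀ k, H.Pair (w k) (z • w k + h) := fun k => by
    have h1 := hgp.sub (D.fund.u_solution.pair (d k))
    convert h1 using 1
    simp only [w, smul_sub]
    abel
  refine sqNorm_le_of_tendsto (w := w) (fun k => (hw k).locL2 hreg) (fun k => ?_) fun x hx => ?_
  · have hk : (0 : ℝ) ≤ k := Nat.cast_nonneg k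
    have h0 : α *ᵥ w k 0 = 0 := by
      simp only [w, Pi.sub_apply, mulVec_sub, hg, D.greenSol_zero hαJ, mulVec_mulVec,
        D.fund.alpha_u_zero hαJ, zero_mulVec, sub_zero]
    have hwk : w k k = (V k + U k * m) *ᵥ ∫ y in 0..(k : ℝ), H.pairing U' h y := by
      simp only [w, Pi.sub_apply, hg, Hamiltonian.greenSol, d]
      abel
    have h1 := (hw k).energy_inhom hreg hhl hk (jform_eq_zero_of_ker hα hαJ h0 h0)
      (by rw [hwk]; exact D.sign _ _ hk)
    rw [sqNorm_indicator_eq ((hw k).locL2 hreg) hk]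
    refine ENNReal.ofReal_le_ofReal ?_
    rw [le_div_iff₀ (by positivity), mul_comm]
    refine h1.trans ?_
    rw [intervalIntegral.integral_of_le hk]
    exact setIntegral_mono_set (integrable_ip_self_re H hh) (ip_self_nonneg H h)
      (Filter.Eventually.of_forall fun x hx => hx.1)
  · have hc : Continuous fun c : Fin n → ℂ => g x - U x *ᵥ c :=
      continuous_const.sub (continuous_const.matrix_mulVec continuous_id)
    have := (hc.tendsto 0).comp hd
    simp only [mulVec_zero, sub_zero] at this
    exact this

theorem greenSol_mem (D : H.WeylData α z U V U' V' m) (hreg : H.RegularAtZero)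
    (hz : z.im ≠ 0) (hα : α * αᴴ = 1) (hαJ : α * Matrix.J (Fin n) ℂ * αᴴ = 0)
    (hh : h ∈ H.preL2) :
    H.greenSol U (fun x => V x + U x * m) U' (fun x => V' x + U' x * mᴴ) h ∈ H.preL2 :=
  ⟨((D.greenSol_pair hreg hz hα hαJ hh).locL2 hreg).aestronglyMeasurable,
    (D.greenSol_sqNorm_le hreg hz hα hαJ hh).trans_lt ENNReal.ofReal_lt_top⟩

end Hamiltonian.WeylData

/-! ### The Green function -/

section Green

variable {H : Hamiltonian n} {u v : ℝ → ℂ → Mat n} {m : ℂ → Matrix (Fin n) (Fin n) ℂ} {z : ℂ}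
  {h : ℝ → Vec n}

theorem integrableOn_greenFunction
    (hu : ∀ c, LocL2 H fun y => u y (starRingEnd ℂ z) *ᵥ c)
    (hw : ∀ c, (fun y => weylSolution u v m y (starRingEnd ℂ z) *ᵥ c) ∈ H.preL2)
    (hh : h ∈ H.preL2) {x : ℝ} (hx : 0 ≤ x) :
    IntegrableOn (fun y => greenFunction u v m x y z *ᵥ (H y *ᵥ h y)) (Ioi 0) volume ∧
      ∫ y in Ioi 0, greenFunction u v m x y z *ᵥ (H y *ᵥ h y) =
        H.greenSol (fun x => u x z) (fun x => weylSolution u v m x z)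
          (fun x => u x (starRingEnd ℂ z)) (fun x => weylSolution u v m x (starRingEnd ℂ z)) h x := by
  have hp := integrable_pairing hw hh
  have hq := integrableOn_pairing hu (locL2_of_mem H hh) x
  set p := H.pairing (fun x => weylSolution u v m x (starRingEnd ℂ z)) h
  set q := H.pairing (fun x => u x (starRingEnd ℂ z)) h
  have hsplit : Ioc 0 x ∪ Ioi x = Ioi 0 := Ioc_union_Ioi_eq_Ioi hx
  have e1 : (fun y => greenFunction u v m x y z *ᵥ (H y *ᵥ h y)) =ᵐ[volume.restrict (Ioc 0 x)]
      fun y => (weylSolution u v m x z).mulVecLin.toContinuousLinearMap (q y) := by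
    -- At `y = x` the Green function takes its other branch; that point has measure zero.
    filter_upwards [ae_restrict_mem measurableSet_Ioc, Measure.ae_ne _ x] with y hy hyx
    have : ¬ x ≤ y := not_le.2 (lt_of_le_of_ne hy.2 hyx)
    simp [greenFunction, this, q, Hamiltonian.pairing, mulVec_mulVec, Matrix.mul_assoc]
  have e2 : (fun y => greenFunction u v m x y z *ᵥ (H y *ᵥ h y)) =ᵐ[volume.restrict (Ioi x)]
      fun y => (u x z).mulVecLin.toContinuousLinearMap (p y) := by
    filter_upwards [ae_restrict_mem measurableSet_Ioi] with y hy
    have : x ≤ y := le_of_lt hy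
    simp [greenFunction, this, p, Hamiltonian.pairing, mulVec_mulVec, Matrix.mul_assoc]
  have hp' : IntegrableOn p (Ioi x) volume := hp.mono_set (Ioi_subset_Ioi hx)
  have i1 : IntegrableOn (fun y => greenFunction u v m x y z *ᵥ (H y *ᵥ h y)) (Ioc 0 x) volume :=
    (ContinuousLinearMap.integrable_comp _ hq).congr e1.symm
  have i2 : IntegrableOn (fun y => greenFunction u v m x y z *ᵥ (H y *ᵥ h y)) (Ioi x) volume :=
    (ContinuousLinearMap.integrable_comp _ hp').congr e2.symm
  refine ⟨by rw [← hsplit]; exact i1.union i2, ?_⟩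
  rw [← hsplit, setIntegral_union (Ioc_disjoint_Ioi le_rfl) measurableSet_Ioi i1 i2,
    integral_congr_ae e1, integral_congr_ae e2, ContinuousLinearMap.integral_comp_comm _ hq,
    ContinuousLinearMap.integral_comp_comm _ hp', add_comm]
  have h3 : ∫ y in Ioi x, p y = (∫ y in Ioi 0, p y) - ∫ y in 0..x, p y := by
    rw [intervalIntegral.integral_of_le hx, ← hsplit,
      setIntegral_union (Ioc_disjoint_Ioi le_rfl) measurableSet_Ioi
        (hp.mono_set Ioc_subset_Ioi_self) hp', add_sub_cancel_left]
  rw [h3, ← intervalIntegral.integral_of_le hx]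
  rfl

end Green

end CanonicalSystem

namespace CanonicalSystem

variable {n : ℕ}

/-! ### The deficiency spaces -/

section Deficiency

variable {H : Hamiltonian n}

theorem mem_relKer_relSub {E : Type*} [AddCommGroup E] [Module ℂ E] {R : Submodule ℂ (E × E)}
    {z : ℂ} {F : E} : F ∈ relKer (relSub R z) ↔ (F, z • F) ∈ R := by
  simp only [relKer, relSub, Submodule.mem_comap, Submodule.mem_map, LinearMap.inl_apply]
  constructor
  · rintro ⟨⟨f, g⟩, hfg, h⟩
    have h1 : f = F := congrArg Prod.fst h
    have h2 : g - z • f = 0 := congrArg Prod.snd h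
    rw [← h1, ← sub_eq_zero.1 h2]
    exact hfg
  · intro h
    exact ⟨_, h, by simp⟩

theorem mem_relResolvent {E : Type*} [AddCommGroup E] [Module ℂ E] {R : Submodule ℂ (E × E)}
    {z : ℂ} {F K : E} : (F, K) ∈ relResolvent R z ↔ (K, F + z • K) ∈ R := by
  simp only [relResolvent, relInv, relSub, Submodule.mem_map]
  constructor
  · rintro ⟨_, ⟨⟨f, g⟩, hfg, rfl⟩, h⟩
    have h1 : g - z • f = F := congrArg Prod.fst h
    have h2 : f = K := congrArg Prod.snd h
    rw [← h1, ← h2, sub_add_cancel]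
    exact hfg
  · intro h
    exact ⟨_, ⟨_, h, rfl⟩, by simp⟩

theorem mkQ_eq_mkQ_iff {f g : ℝ → Vec n} (hf : f ∈ H.preL2) (hg : g ∈ H.preL2) :
    H.null.mkQ ⟨f, hf⟩ = H.null.mkQ ⟨g, hg⟩ ↔ H.sqNorm (f - g) = 0 := by
  rw [Submodule.mkQ_apply, Submodule.mkQ_apply, Submodule.Quotient.eq]
  exact Iff.rfl

/-- The columns of `W` give `n` independent classes in an `n`-dimensional kernel, so they span it.
Definiteness turns equality of classes of solutions into equality of functions. -/
theorem solution_eq_of_rank (hdef : H.IsDefinite) {z : ℂ}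
    (hrank : Module.rank ℂ (relKer (relSub H.maximalRelation z)) = n) {W : ℝ → Mat n}
    (hW : ∀ c, H.Pair (fun x => W x *ᵥ c) (z • fun x => W x *ᵥ c))
    (hWm : ∀ c, (fun x => W x *ᵥ c) ∈ H.preL2) (hW0 : Function.Injective (W 0).mulVec)
    {y : ℝ → Vec n} (hy : H.Pair y (z • y)) (hym : y ∈ H.preL2) :
    ∃ c, ∀ x, 0 ≤ x → y x = W x *ᵥ c := by
  let Φ : (Fin n → ℂ) →ₗ[ℂ] H.preL2 :=
    { toFun := fun c => ⟨fun x => W x *ᵥ c, hWm c⟩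
      map_add' := fun a b => Subtype.ext (funext fun x => mulVec_add (W x) a b)
      map_smul' := fun a b => Subtype.ext (funext fun x => mulVec_smul (W x) a b) }
  have hker : ∀ (f : ℝ → Vec n) (hf : f ∈ H.preL2), H.Pair f (z • f) →
      H.null.mkQ ⟨f, hf⟩ ∈ relKer (relSub H.maximalRelation z) := by
    intro f hf hp
    rw [mem_relKer_relSub]
    have hr : H.Represents f (H.null.mkQ ⟨f, hf⟩) := ⟨hf, rfl⟩
    exact ⟨f, z • f, hr, hr.smul z, fun a b hab hs =>
      hp.1 a b hab (hs.trans Ioi_subset_Ici_self), hp.2, trivial⟩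
  have heq : ∀ (f g : ℝ → Vec n) (hf : f ∈ H.preL2) (hg : g ∈ H.preL2), H.Pair f (z • f) →
      H.Pair g (z • g) → H.null.mkQ ⟨f, hf⟩ = H.null.mkQ ⟨g, hg⟩ → ∀ x, 0 ≤ x → f x = g x := by
    intro f g hf hg hpf hpg h x hx
    have h1 : H.sqNorm (f - g) = 0 := (mkQ_eq_mkQ_iff hf hg).1 h
    have h2 := hpf.sub hpg
    rw [← smul_sub] at h2
    exact sub_eq_zero.1 (h2.eq_zero_of_sqNorm hdef (sub_mem hf hg) h1 hx)
  let Ψ : (Fin n → ℂ) →ₗ[ℂ] H.L2 := H.null.mkQ ∘ₗ Φ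
  have hinj : Function.Injective Ψ := fun a b hab =>
    hW0 (heq _ _ (hWm a) (hWm b) (hW a) (hW b) hab 0 le_rfl)
  have hle : LinearMap.range Ψ ≤ relKer (relSub H.maximalRelation z) := by
    rintro _ ⟨c, rfl⟩
    exact hker _ (hWm c) (hW c)
  have : Module.Finite ℂ (relKer (relSub H.maximalRelation z)) :=
    Module.finite_of_rank_eq_nat hrank
  have hfin : Module.finrank ℂ (LinearMap.range Ψ) =
      Module.finrank ℂ (relKer (relSub H.maximalRelation z)) := by
    rw [LinearMap.finrank_range_of_inj hinj, Module.finrank_eq_of_rank_eq hrank]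
    simp
  have hrange := Submodule.eq_of_le_of_finrank_eq hle hfin
  have hmem := hker y hym hy
  rw [← hrange] at hmem
  obtain ⟨c, hc⟩ := hmem
  exact ⟨c, heq y _ hym (hWm c) hy (hW c) hc.symm⟩

end Deficiency

/-! ### The boundary form at infinity -/

section LimitPoint

open Filter Topology

variable {H : Hamiltonian n}

/-- With `t = s²`, this is `norm_form_le` for `s a` and `s⁻¹ b`, integrated. A large `t` later pairs
with a small `a`. -/
theorem norm_integral_ip_le {a b : ℝ → Vec n} (ha : a ∈ H.preL2) (hb : b ∈ H.preL2) {t : ℝ}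
    (ht : 0 < t) :
    ‖∫ x, H.ip a b x ∂halfLine‖ ≤
      (t * (∫ x, (H.ip a a x).re ∂halfLine) + t⁻¹ * ∫ x, (H.ip b b x).re ∂halfLine) / 2 := by
  have hia := integrable_ip_self_re H ha
  have hib := integrable_ip_self_re H hb
  rw [← integral_const_mul, ← integral_const_mul, ← integral_add (hia.const_mul _)
    (hib.const_mul _), ← integral_div]
  refine norm_integral_le_of_norm_le (((hia.const_mul _).add (hib.const_mul _)).div_const 2) ?_
  filter_upwards [H.posSemidef] with x hx
  obtain ⟨s, hs, rfl⟩ : ∃ s : ℝ, 0 < s ∧ t = s ^ 2 :=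
    ⟨√t, Real.sqrt_pos.2 ht, (Real.sq_sqrt ht.le).symm⟩
  have h1 := norm_form_le hx ((s : ℂ) • a x) ((s : ℂ)⁻¹ • b x)
  rw [re_form_smul, re_form_smul] at h1
  have hs' : (s : ℂ) ≠ 0 := by exact_mod_cast hs.ne'
  have h2 : star ((s : ℂ) • a x) ⬝ᵥ (H x *ᵥ ((s : ℂ)⁻¹ • b x)) = H.ip a b x := by
    rw [star_smul, mulVec_smul, smul_dotProduct, dotProduct_smul, smul_smul, Complex.star_def,
      Complex.conj_ofReal, mul_inv_cancel₀ hs', one_smul, Hamiltonian.ip]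
  rw [h2, norm_inv, Complex.norm_real, Real.norm_of_nonneg hs.le, inv_pow] at h1
  exact h1

theorem greenSol_sub {U W U' W' : ℝ → Mat n} {h k : ℝ → Vec n}
    (hU' : ∀ c, LocL2 H fun y => U' y *ᵥ c) (hW' : ∀ c, (fun y => W' y *ᵥ c) ∈ H.preL2)
    (hh : h ∈ H.preL2) (hk : k ∈ H.preL2) {x : ℝ} (hx : 0 ≤ x) :
    H.greenSol U W U' W' (h - k) x = H.greenSol U W U' W' h x - H.greenSol U W U' W' k x := by
  have e : ∀ Y : ℝ → Mat n, H.pairing Y (h - k) = H.pairing Y h - H.pairing Y k := fun Y => by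
    funext y
    simp [Hamiltonian.pairing, mulVec_sub]
  have hh' := locL2_of_mem H hh
  have hk' := locL2_of_mem H hk
  have hW'' := fun c => locL2_of_mem H (hW' c)
  simp only [Hamiltonian.greenSol, e, Pi.sub_apply]
  rw [integral_sub (integrable_pairing hW' hh) (integrable_pairing hW' hk),
    intervalIntegral.integral_sub (intervalIntegrable_pairing hW'' hh' le_rfl hx)
      (intervalIntegrable_pairing hW'' hk' le_rfl hx),
    intervalIntegral.integral_sub (intervalIntegrable_pairing hU' hh' le_rfl hx)
      (intervalIntegrable_pairing hU' hk' le_rfl hx)]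
  simp only [mulVec_sub]
  abel

namespace Hamiltonian.WeylData

variable {α : Matrix (Fin n) (Fin n ⊕ Fin n) ℂ} {z : ℂ}
  {U V U' V' : ℝ → Mat n} {m : Matrix (Fin n) (Fin n) ℂ} {h h' : ℝ → Vec n}

/-- The Gram entry between the two Weyl solutions is `m* - m* = 0`, so in these coordinates the
boundary form is the standard symplectic one. -/
theorem jform_add_add (D : H.WeylData α z U V U' V' m) (hreg : H.RegularAtZero) (hα : α * αᴴ = 1)
    (hαJ : α * Matrix.J (Fin n) ℂ * αᴴ = 0) {x : ℝ} (hx : 0 ≤ x) (a b a' b' : Fin n → ℂ) :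
    jform (U x *ᵥ a + (V x + U x * m) *ᵥ b) (U' x *ᵥ a' + (V' x + U' x * mᴴ) *ᵥ b') =
      star b ⬝ᵥ a' - star a ⬝ᵥ b' := by
  have e := D.symm
  rw [jform_add_left, jform_add_right, jform_add_right, jform_mulVec, jform_mulVec, jform_mulVec,
    jform_mulVec]
  have h1 := e.fund.form_uu e.fund' hreg hαJ hx
  have h2 := e.fund.form_uw e.fund' hreg hα hαJ mᴴ hx
  have h3 := e.fund.form_wu e.fund' hreg hα hαJ m hx
  have h4 := e.fund.form_ww e.fund' hreg hα hαJ mᴴ m hx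
  rw [h1, h2, h3, h4]
  simp [neg_mulVec]
  ring

theorem tendsto_tail (D : H.WeylData α z U V U' V' m) (hreg : H.RegularAtZero) (hz : z.im ≠ 0)
    (hh : h ∈ H.preL2) :
    Tendsto (fun x => (∫ y in Ioi 0, H.pairing (fun x => V' x + U' x * mᴴ) h y) -
      ∫ y in 0..x, H.pairing (fun x => V' x + U' x * mᴴ) h y) atTop (𝓝 0) := by
  rw [← sub_self (∫ y in Ioi 0, H.pairing (fun x => V' x + U' x * mᴴ) h y)]
  exact tendsto_const_nhds.sub (intervalIntegral_tendsto_integral_Ioi 0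
    (integrable_pairing (D.mem_preL2' hreg hz) hh) tendsto_id)

theorem tendsto_tail' (D : H.WeylData α z U V U' V' m) (hreg : H.RegularAtZero) (hz : z.im ≠ 0)
    (hh : h ∈ H.preL2) :
    Tendsto (fun x => (∫ y in Ioi 0, H.pairing (fun x => V x + U x * m) h y) -
      ∫ y in 0..x, H.pairing (fun x => V x + U x * m) h y) atTop (𝓝 0) := by
  have := D.symm.tendsto_tail hreg (by simpa using hz) hh
  simpa only [conjTranspose_conjTranspose] using this

/-- By Lagrange's identity the limit exists and is additive in `h`. It is zero for data of bounded
support, and the norm bound of the Green operator extends this to all `h`. -/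
theorem tendsto_jform_greenSol (D : H.WeylData α z U V U' V' m) (hreg : H.RegularAtZero)
    (hz : z.im ≠ 0) (hα : α * αᴴ = 1) (hαJ : α * Matrix.J (Fin n) ℂ * αᴴ = 0)
    (hh : h ∈ H.preL2) (hh' : h' ∈ H.preL2) :
    Tendsto (fun x => jform
      (H.greenSol U (fun x => V x + U x * m) U' (fun x => V' x + U' x * mᴴ) h x)
      (H.greenSol U' (fun x => V' x + U' x * mᴴ) U (fun x => V x + U x * m) h' x))
      atTop (𝓝 0) := by
  have hz' : (starRingEnd ℂ z).im ≠ 0 := by simpa using hz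
  set G : (ℝ → Vec n) → ℝ → Vec n := fun h =>
    H.greenSol U (fun x => V x + U x * m) U' (fun x => V' x + U' x * mᴴ) h with hG
  set K : ℝ → Vec n := H.greenSol U' (fun x => V' x + U' x * mᴴ) U (fun x => V x + U x * m) h'
    with hK
  have hKp : H.Pair K (starRingEnd ℂ z • K + h') := by
    have := D.symm.greenSol_pair hreg hz' hα hαJ hh'
    rwa [conjTranspose_conjTranspose] at this
  have hKm : K ∈ H.preL2 := by
    have := D.symm.greenSol_mem hreg hz' hα hαJ hh'
    rwa [conjTranspose_conjTranspose] at this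
  have hK0 : α *ᵥ K 0 = 0 := by
    have := D.symm.greenSol_zero (h := h') hαJ
    rwa [conjTranspose_conjTranspose] at this
  have hGm : ∀ {r}, r ∈ H.preL2 → G r ∈ H.preL2 := fun hr => D.greenSol_mem hreg hz hα hαJ hr
  -- This is the Lagrange density of `G r` and `K`; the terms with `z` cancel because the parameters
  -- are conjugate.
  let L : (ℝ → Vec n) → ℂ := fun r => ∫ x in Ioi 0, (H.ip r K x - H.ip (G r) h' x)
  have hLi : ∀ {r}, r ∈ H.preL2 →
      IntegrableOn (fun x => H.ip r K x - H.ip (G r) h' x) (Ioi 0) volume := fun hr =>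
    (integrable_ip H hr hKm).sub (integrable_ip H (hGm hr) hh')
  have hlim : ∀ {r}, r ∈ H.preL2 →
      Tendsto (fun x => jform (G r x) (K x)) atTop (𝓝 (L r)) := by
    intro r hr
    refine (intervalIntegral_tendsto_integral_Ioi 0 (hLi hr) tendsto_id).congr' ?_
    filter_upwards [eventually_ge_atTop 0] with R hR
    have hp : H.Pair (G r) (z • G r + r) := D.greenSol_pair hreg hz hα hαJ hr
    have h1 := hp.lagrange hreg hKp
      (((locL2_of_mem H (hGm hr)).smul z).add (locL2_of_mem H hr))
      (((locL2_of_mem H hKm).smul _).add (locL2_of_mem H hh')) le_rfl hR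
    have hG0 : α *ᵥ G r 0 = 0 := D.greenSol_zero hαJ
    rw [jform_eq_zero_of_ker hα hαJ hG0 hK0, sub_zero] at h1
    rw [← h1]
    refine intervalIntegral.integral_congr fun x _ => ?_
    simp only [Hamiltonian.ip, Pi.add_apply, Pi.smul_apply, star_add, star_smul, add_dotProduct,
      smul_dotProduct, mulVec_add, mulVec_smul, dotProduct_add, dotProduct_smul, Complex.star_def]
    abel
  -- Beyond `k` the tail of the truncated data vanishes, so `G r` is a Weyl solution. It meets only
  -- the `U'` coefficient of `K`, a tail integral tending to zero.
  have hcut : ∀ k : ℕ, L ((Iic (k : ℝ)).indicator h) = 0 := by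
    intro k
    have hr := locL2_of_mem H hh k
    refine tendsto_nhds_unique (hlim hr) ?_
    set r := (Iic (k : ℝ)).indicator h with hrdef
    have hrz : ∀ (Y : ℝ → Mat n) y, (k : ℝ) < y → H.pairing Y r y = 0 := fun Y y hy => by
      have : y ∉ Iic (k : ℝ) := not_le.2 hy
      simp [Hamiltonian.pairing, r, this]
    have hUint : IntegrableOn (H.pairing U' r) (Ioi 0) volume := by
      have h1 := integrableOn_pairing (fun c => (D.fund'.u_solution.pair c).locL2 hreg)
        (locL2_of_mem H hr) (k : ℝ)
      refine h1.of_forall_sdiff_eq_zero measurableSet_Ioi fun y hy => hrz U' y ?_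
      by_contra hle
      exact hy.2 ⟨hy.1, not_lt.1 hle⟩
    have hc := intervalIntegral_tendsto_integral_Ioi 0 hUint tendsto_id
    have hd := D.tendsto_tail' hreg hz hh'
    have hcont : Continuous fun p : (Fin n → ℂ) × (Fin n → ℂ) => star p.1 ⬝ᵥ p.2 :=
      continuous_fst.star.dotProduct continuous_snd
    have h1 := (hcont.tendsto _).comp (hc.prodMk_nhds hd)
    simp only [dotProduct_zero] at h1
    refine h1.congr' ?_
    filter_upwards [eventually_ge_atTop (k : ℝ)] with x hx
    have hx0 : 0 ≤ x := (Nat.cast_nonneg k).trans hx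
    have htail : (∫ y in Ioi 0, H.pairing (fun x => V' x + U' x * mᴴ) r y) -
        ∫ y in 0..x, H.pairing (fun x => V' x + U' x * mᴴ) r y = 0 := by
      rw [intervalIntegral.integral_of_le hx0, sub_eq_zero]
      refine (setIntegral_eq_of_subset_of_forall_sdiff_eq_zero measurableSet_Ioi
        Ioc_subset_Ioi_self fun y hy => hrz _ y ?_)
      by_contra hle
      exact hy.2 ⟨hy.1, (not_lt.1 hle).trans hx⟩
    simp only [hG, hK, Hamiltonian.greenSol, htail, D.jform_add_add hreg hα hαJ hx0]
    simp
  have hsub : ∀ k : ℕ, L (h - (Iic (k : ℝ)).indicator h) = L h := by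
    intro k
    have hr := locL2_of_mem H hh k
    rw [← sub_zero (L h), ← hcut k]
    simp only [L]
    rw [← integral_sub (hLi hh) (hLi hr)]
    refine setIntegral_congr_fun measurableSet_Ioi fun x hx => ?_
    have h1 : G (h - (Iic (k : ℝ)).indicator h) x = G h x - G ((Iic (k : ℝ)).indicator h) x :=
      greenSol_sub (fun c => (D.fund'.u_solution.pair c).locL2 hreg) (D.mem_preL2' hreg hz) hh hr
        (le_of_lt hx)
    simp only [Hamiltonian.ip, h1, Pi.sub_apply, star_sub, sub_dotProduct]
    abel
  have hN : Tendsto (fun k : ℕ => ∫ x, (H.ip (h - (Iic (k : ℝ)).indicator h)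
      (h - (Iic (k : ℝ)).indicator h) x).re ∂halfLine) atTop (𝓝 0) := by
    have hi := integrable_ip_self_re H hh
    have h1 := (intervalIntegral_tendsto_integral_Ioi 0 (f := fun x => (H.ip h h x).re) hi
      tendsto_natCast_atTop_atTop).const_sub (∫ x in Ioi 0, (H.ip h h x).re)
    rw [sub_self] at h1
    refine h1.congr fun k => ?_
    rw [intervalIntegral.integral_of_le (Nat.cast_nonneg k), ← integral_indicator measurableSet_Ioi,
      ← integral_indicator measurableSet_Ioc, ← integral_indicator measurableSet_Ioi,
      ← integral_sub]
    · refine integral_congr_ae (Eventually.of_forall fun x => ?_)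
      by_cases h0 : 0 < x <;> by_cases hk : x ≤ k <;> simp [Hamiltonian.ip, h0, hk]
    · exact (integrable_indicator_iff measurableSet_Ioi).2 hi
    · exact (integrable_indicator_iff measurableSet_Ioc).2
        (IntegrableOn.mono_set hi Ioc_subset_Ioi_self)
  -- Each remainder of `h` has the same `L`. For fixed `t`, letting `k → ∞` removes the terms
  -- multiplied by `t`; afterwards `t → ∞` removes the rest.
  have hbound : ∀ t : ℝ, 0 < t → ‖L h‖ ≤ t⁻¹ *
      (((∫ x, (H.ip K K x).re ∂halfLine) + ∫ x, (H.ip h' h' x).re ∂halfLine) / 2) := by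
    intro t ht
    have hNt := ((hN.const_mul t).add ((hN.div_const (z.im ^ 2)).const_mul t)).div_const 2
    have hNt' := hNt.add_const (t⁻¹ *
      (((∫ x, (H.ip K K x).re ∂halfLine) + ∫ x, (H.ip h' h' x).re ∂halfLine) / 2))
    simp only [mul_zero, zero_div, add_zero, zero_add] at hNt'
    refine ge_of_tendsto' hNt' fun k => ?_
    rw [← hsub k]
    have hr : h - (Iic (k : ℝ)).indicator h ∈ H.preL2 := sub_mem hh (locL2_of_mem H hh k)
    set r := h - (Iic (k : ℝ)).indicator h
    have h1 := norm_integral_ip_le hr hKm ht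
    have h2 := norm_integral_ip_le (hGm hr) hh' ht
    have h3 : ∫ x, (H.ip (G r) (G r) x).re ∂halfLine ≤
        (∫ x, (H.ip r r x).re ∂halfLine) / z.im ^ 2 := by
      have h4 := D.greenSol_sqNorm_le hreg hz hα hαJ hr
      have h5 := sqNorm_eq_ofReal H (hGm hr)
      rw [h5] at h4
      exact (ENNReal.ofReal_le_ofReal_iff
        (div_nonneg (integral_nonneg_of_ae (ip_self_nonneg H r)) (sq_nonneg _))).1 h4
    have h6 : L r = (∫ x, H.ip r K x ∂halfLine) - ∫ x, H.ip (G r) h' x ∂halfLine :=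
      integral_sub (integrable_ip H hr hKm) (integrable_ip H (hGm hr) hh')
    rw [h6]
    refine (norm_sub_le _ _).trans ((add_le_add h1 h2).trans ?_)
    have h7 := mul_le_mul_of_nonneg_left h3 ht.le
    linarith
  have hL0 : L h = 0 := by
    rw [← norm_le_zero_iff]
    have h1 := tendsto_inv_atTop_zero.mul_const
      (((∫ x, (H.ip K K x).re ∂halfLine) + ∫ x, (H.ip h' h' x).re ∂halfLine) / 2)
    rw [zero_mul] at h1
    refine ge_of_tendsto h1 ?_
    filter_upwards [eventually_gt_atTop 0] with t ht using hbound t ht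
  rw [← hL0]
  exact hlim hh

/-- Take `h = g - z f`: the difference of `f` and its Green integral solves the homogeneous equation
and is square integrable, so the deficiency index makes it a Weyl solution. -/
theorem exists_decomposition (D : H.WeylData α z U V U' V' m) (hdef : H.IsDefinite)
    (hreg : H.RegularAtZero) (hz : z.im ≠ 0) (hα : α * αᴴ = 1)
    (hαJ : α * Matrix.J (Fin n) ℂ * αᴴ = 0)
    (hrank : Module.rank ℂ (relKer (relSub H.maximalRelation z)) = n)
    {f g : ℝ → Vec n} (hfg : H.Pair f g) (hf : f ∈ H.preL2) (hg : g ∈ H.preL2) :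
    ∃ h ∈ H.preL2, ∃ c, ∀ x, 0 ≤ x →
      f x = H.greenSol U (fun x => V x + U x * m) U' (fun x => V' x + U' x * mᴴ) h x +
        (V x + U x * m) *ᵥ c := by
  have hh : g - z • f ∈ H.preL2 := sub_mem hg (H.preL2.smul_mem z hf)
  refine ⟨g - z • f, hh, ?_⟩
  set G := H.greenSol U (fun x => V x + U x * m) U' (fun x => V' x + U' x * mᴴ) (g - z • f)
  have hp : H.Pair G (z • G + (g - z • f)) := D.greenSol_pair hreg hz hα hαJ hh
  have hy : H.Pair (f - G) (z • (f - G)) := by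
    have h1 := hfg.sub hp
    have h2 : g - (z • G + (g - z • f)) = z • (f - G) := by
      rw [smul_sub]; abel
    rwa [h2] at h1
  have hinj : Function.Injective (V 0 + U 0 * m).mulVec := fun a b hab => by
    have h1 := congrArg (α *ᵥ ·) hab
    simpa only [mulVec_mulVec, D.fund.alpha_w_zero hα hαJ, one_mulVec] using h1
  obtain ⟨c, hc⟩ := solution_eq_of_rank hdef hrank (W := fun x => V x + U x * m)
    (D.fund.w_solution m) (D.mem_preL2 hreg hz) hinj hy
    (sub_mem hf (D.greenSol_mem hreg hz hα hαJ hh))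
  refine ⟨c, fun x hx => ?_⟩
  rw [← hc x hx, Pi.sub_apply, add_sub_cancel]

/-- Decompose `f` at `z` and `k` at the conjugate. The added Weyl solutions do not pair with each
other; they pair only with tail integrals, which tend to zero. -/
theorem limit_point (D : H.WeylData α z U V U' V' m) (hdef : H.IsDefinite)
    (hreg : H.RegularAtZero) (hz : z.im ≠ 0) (hα : α * αᴴ = 1)
    (hαJ : α * Matrix.J (Fin n) ℂ * αᴴ = 0)
    (hrank : Module.rank ℂ (relKer (relSub H.maximalRelation z)) = n)
    (hrank' : Module.rank ℂ (relKer (relSub H.maximalRelation (starRingEnd ℂ z))) = n)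
    {f g k l : ℝ → Vec n} (hfg : H.Pair f g) (hf : f ∈ H.preL2) (hg : g ∈ H.preL2)
    (hkl : H.Pair k l) (hk : k ∈ H.preL2) (hl : l ∈ H.preL2) :
    Tendsto (fun x => jform (f x) (k x)) atTop (𝓝 0) := by
  have hz' : (starRingEnd ℂ z).im ≠ 0 := by simpa using hz
  obtain ⟨h, hh, c, hfc⟩ := D.exists_decomposition hdef hreg hz hα hαJ hrank hfg hf hg
  obtain ⟨h', hh', c', hkc⟩ := D.symm.exists_decomposition hdef hreg hz' hα hαJ hrank' hkl hk hl
  rw [conjTranspose_conjTranspose] at hkc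
  have h1 := D.tendsto_jform_greenSol hreg hz hα hαJ hh hh'
  have hcont : Continuous fun p : (Fin n → ℂ) × (Fin n → ℂ) => star p.1 ⬝ᵥ p.2 :=
    continuous_fst.star.dotProduct continuous_snd
  have h2 := (hcont.tendsto _).comp ((D.tendsto_tail hreg hz hh).prodMk_nhds
    (tendsto_const_nhds (x := c')))
  have h3 := (hcont.tendsto _).comp ((tendsto_const_nhds (x := c)).prodMk_nhds
    (D.tendsto_tail' hreg hz hh'))
  simp only [star_zero, zero_dotProduct, dotProduct_zero] at h2 h3
  have h4 := (h1.sub h2).add h3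
  rw [sub_zero, add_zero] at h4
  refine h4.congr' ?_
  filter_upwards [eventually_ge_atTop 0] with x hx
  rw [hfc x hx, hkc x hx]
  simp only [Hamiltonian.greenSol, Function.comp, add_assoc, ← mulVec_add,
    D.jform_add_add hreg hα hαJ hx]
  simp only [star_add, add_dotProduct, dotProduct_add]
  ring

end Hamiltonian.WeylData

end LimitPoint

end CanonicalSystem

namespace CanonicalSystem

variable {n : ℕ}

/-! ### Weyl systems -/

section Weyl

open Filter Topology

variable {H : Hamiltonian n} {α : Matrix (Fin n) (Fin n ⊕ Fin n) ℂ}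

theorem mulVec_mem_preL2 {W : ℝ → Mat n} (hW : ∀ j, (fun x => (W x).col j) ∈ H.preL2)
    (c : Fin n → ℂ) : (fun x => W x *ᵥ c) ∈ H.preL2 := by
  have h1 : (fun x => W x *ᵥ c) = ∑ j, c j • fun x => (W x).col j := by
    funext x i
    simp [mulVec, dotProduct, Finset.sum_apply, mul_comm]
  rw [h1]
  exact sum_mem fun j _ => H.preL2.smul_mem _ (hW j)

theorem Hamiltonian.IsWeylSystem.fund {u v : ℝ → ℂ → Mat n} {m : ℂ → Matrix (Fin n) (Fin n) ℂ}
    (h : H.IsWeylSystem α u v m) (z : ℂ) :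
    H.IsFund α z (fun x => u x z) (fun x => v x z) :=
  ⟨h.u_solution z, h.u_zero z, h.v_solution z, h.v_zero z⟩

theorem exists_fund (hreg : H.RegularAtZero) (α : Matrix (Fin n) (Fin n ⊕ Fin n) ℂ) :
    ∃ u v : ℝ → ℂ → Mat n, ∀ z, H.IsFund α z (fun x => u x z) (fun x => v x z) := by
  choose U hU hU0 using fun z =>
    exists_isMatrixSolution hreg z (-(Matrix.J (Fin n) ℂ * αᴴ))
  choose V hV hV0 using fun z => exists_isMatrixSolution hreg z αᴴ
  exact ⟨fun x z => U z x, fun x z => V z x, fun z => ⟨hU z, hU0 z, hV z, hV0 z⟩⟩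

theorem exists_weylData (hdef : H.IsDefinite) (hreg : H.RegularAtZero) (hα : α * αᴴ = 1)
    (hαJ : α * Matrix.J (Fin n) ℂ * αᴴ = 0) {u v : ℝ → ℂ → Mat n}
    (h : ∀ z, H.IsFund α z (fun x => u x z) (fun x => v x z)) {z : ℂ} (hz : z.im ≠ 0) :
    ∃ m, H.WeylData α z (fun x => u x z) (fun x => v x z) (fun x => u x (starRingEnd ℂ z))
      (fun x => v x (starRingEnd ℂ z)) m := by
  obtain ⟨m, h1, h2⟩ := (h z).exists_signDefinite (h (starRingEnd ℂ z)) hdef hreg hz hα hαJ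
  exact ⟨m, h z, h _, h1, h2⟩

theorem exists_isWeylSystem (hdef : H.IsDefinite) (hreg : H.RegularAtZero) (hα : α * αᴴ = 1)
    (hαJ : α * Matrix.J (Fin n) ℂ * αᴴ = 0) : ∃ u v m, H.IsWeylSystem α u v m := by
  obtain ⟨u, v, h⟩ := exists_fund hreg α
  choose m hm using fun z : {z : ℂ // z.im ≠ 0} => exists_weylData hdef hreg hα hαJ h z.2
  classical
  refine ⟨u, v, fun z => if hz : z.im ≠ 0 then m ⟨z, hz⟩ else 0, fun z => (h z).u_solution,
    fun z => (h z).u_zero, fun z => (h z).v_solution, fun z => (h z).v_zero, fun z hz j => ?_⟩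
  have h1 := (hm ⟨z, hz⟩).mem_preL2 hreg hz (Pi.single j 1)
  simp only [weylSolution, dif_pos hz]
  simpa only [mulVec_single_one] using h1

/-- The boundary forms of elements of the maximal relation vanish at infinity. -/
def Hamiltonian.IsLimitPoint (H : Hamiltonian n) : Prop :=
  ∀ f g k l : ℝ → Vec n, H.Pair f g → f ∈ H.preL2 → g ∈ H.preL2 → H.Pair k l → k ∈ H.preL2 →
    l ∈ H.preL2 → Tendsto (fun x => jform (f x) (k x)) atTop (𝓝 0)

/-- The deficiency indices enter here, through the single pair of parameters `±i`; the conclusion is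
free of `z` and serves every nonreal parameter. -/
theorem isLimitPoint (hdef : H.IsDefinite) (hreg : H.RegularAtZero)
    (hindices : H.DeficiencyIndicesEq n) (hα : α * αᴴ = 1)
    (hαJ : α * Matrix.J (Fin n) ℂ * αᴴ = 0) : H.IsLimitPoint := by
  obtain ⟨u, v, h⟩ := exists_fund hreg α
  have hI : Complex.I.im ≠ 0 := by simp
  obtain ⟨m, D⟩ := exists_weylData hdef hreg hα hαJ h hI
  intro f g k l hfg hf hg hkl hk hl
  exact D.limit_point hdef hreg hI hα hαJ hindices.1 (by rw [Complex.conj_I]; exact hindices.2)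
    hfg hf hg hkl hk hl

/-- Apply the energy identity on `[x, R]` and let `R → ∞`: the form at `x` is left with the sign of
`Im z`. -/
theorem Hamiltonian.IsLimitPoint.sign (hL : H.IsLimitPoint) (hreg : H.RegularAtZero) {z : ℂ}
    {y : ℝ → Vec n} (hy : H.Pair y (z • y)) (hym : y ∈ H.preL2) {x : ℝ} (hx : 0 ≤ x) :
    0 ≤ z.im * (jform (y x) (y x)).im := by
  have hzy := H.preL2.smul_mem z hym
  have h1 := (Complex.continuous_im.tendsto _).comp (hL y _ y _ hy hym hzy hy hym hzy)
  have h2 := h1.const_mul z.im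
  rw [Complex.zero_im, mul_zero] at h2
  refine le_of_tendsto h2 ?_
  filter_upwards [eventually_ge_atTop x] with R hR
  have h3 := hy.energy hreg hx (hx.trans hR)
  have h4 := integral_ip_self_nonneg H y hx hR
  simp only [Function.comp]
  rw [show (jform (y R) (y R)).im = (jform (y x) (y x)).im -
    (2 * z.im * ∫ x in x..R, (H.ip y y x).re) by linarith]
  have h5 := mul_nonneg (mul_self_nonneg z.im) h4
  nlinarith

/-- The boundary form between Weyl solutions at conjugate parameters is the constant `m(z) - m(z̄)*`
and tends to zero, so it is zero. Square integrability alone thus yields all that the Green operator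
needs. -/
theorem Hamiltonian.IsWeylSystem.weylData {u v : ℝ → ℂ → Mat n}
    {m : ℂ → Matrix (Fin n) (Fin n) ℂ} (h : H.IsWeylSystem α u v m) (hL : H.IsLimitPoint)
    (hreg : H.RegularAtZero) (hα : α * αᴴ = 1) (hαJ : α * Matrix.J (Fin n) ℂ * αᴴ = 0) {z : ℂ}
    (hz : z.im ≠ 0) :
    m (starRingEnd ℂ z) = (m z)ᴴ ∧
      H.WeylData α z (fun x => u x z) (fun x => v x z) (fun x => u x (starRingEnd ℂ z))
        (fun x => v x (starRingEnd ℂ z)) (m z) := by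
  have hm : ∀ w : ℂ, w.im ≠ 0 → ∀ c, (fun x => (v x w + u x w * m w) *ᵥ c) ∈ H.preL2 :=
    fun w hw c => mulVec_mem_preL2 (h.weyl w hw) c
  have hp : ∀ (w : ℂ) c, H.Pair (fun x => (v x w + u x w * m w) *ᵥ c)
      (w • fun x => (v x w + u x w * m w) *ᵥ c) := fun w c => (h.fund w).w_solution (m w) c
  have hz' : (starRingEnd ℂ z).im ≠ 0 := by simpa using hz
  have hconj : m (starRingEnd ℂ z) = (m z)ᴴ := by
    have h1 : m z - (m (starRingEnd ℂ z))ᴴ = 0 := by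
      refine matrix_eq_of_forms fun a b => ?_
      have h2 := hL _ _ _ _ (hp (starRingEnd ℂ z) a) (hm _ hz' a) (H.preL2.smul_mem _ (hm _ hz' a))
        (hp z b) (hm z hz b) (H.preL2.smul_mem _ (hm z hz b))
      rw [zero_mulVec, dotProduct_zero]
      refine tendsto_nhds_unique (tendsto_const_nhds.congr' ?_) h2
      filter_upwards [eventually_ge_atTop 0] with x hx
      rw [jform_mulVec, (h.fund z).form_ww (h.fund (starRingEnd ℂ z)) hreg hα hαJ _ _ hx]
    rw [sub_eq_zero.1 h1, conjTranspose_conjTranspose]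
  refine ⟨hconj, h.fund z, h.fund _, fun c x hx => hL.sign hreg (hp z c) (hm z hz c) hx, ?_⟩
  rw [← hconj]
  exact fun c x hx => hL.sign hreg (hp _ c) (hm _ hz' c) hx

/-- There are no nonreal eigenvalues: the form is zero at `0`, and positive energy would give it the
wrong sign at `k`. -/
theorem Hamiltonian.IsLimitPoint.sqNorm_eq_zero (hL : H.IsLimitPoint) (hreg : H.RegularAtZero)
    (hα : α * αᴴ = 1) (hαJ : α * Matrix.J (Fin n) ℂ * αᴴ = 0) {z : ℂ} (hz : z.im ≠ 0)
    {y : ℝ → Vec n} (hy : H.Pair y (z • y)) (hym : y ∈ H.preL2) (h0 : α *ᵥ y 0 = 0) :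
    H.sqNorm y = 0 := by
  rw [← nonpos_iff_eq_zero]
  refine sqNorm_le_of_tendsto (w := fun _ => y) (fun _ => locL2_of_mem H hym) (fun k => ?_)
    fun x _ => tendsto_const_nhds
  have hk : (0 : ℝ) ≤ k := Nat.cast_nonneg k
  rw [sqNorm_indicator_eq (locL2_of_mem H hym) hk, nonpos_iff_eq_zero, ENNReal.ofReal_eq_zero]
  have h1 := hy.energy hreg le_rfl hk
  rw [jform_eq_zero_of_ker hα hαJ h0 h0, Complex.zero_im, sub_zero] at h1
  have h2 := hL.sign hreg hy hym hk
  rw [h1] at h2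
  have h3 : 0 < z.im ^ 2 := by positivity
  nlinarith

end Weyl

/-! ### Uniqueness of the representative and identification of the resolvent -/

/-- Two representatives differ by a function annihilated by `H`, so the right-hand sides of their
equations coincide. The difference is constant on `(0, ∞)`, and definiteness makes it zero. -/
theorem eqOn_of_represents {H : Hamiltonian n} (hdef : H.IsDefinite) {z : ℂ}
    {k g h : ℝ → Vec n} {R : H.L2} (hk : H.Represents k R) (hg : H.Represents g R)
    (hkac : LocACOn k (Ioi 0)) (hgac : LocACOn g (Ici 0))
    (hkd : JDerivEq k (fun x => -(z • (H x *ᵥ k x)) - H x *ᵥ h x))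
    (hgd : JDerivEq g (fun x => -(z • (H x *ᵥ g x)) - H x *ᵥ h x)) : EqOn k g (Ioi 0) := by
  obtain ⟨hkm, hk⟩ := hk
  obtain ⟨hgm, hg⟩ := hg
  have h1 : H.sqNorm (k - g) = 0 := (mkQ_eq_mkQ_iff hkm hgm).1 (hk.trans hg.symm)
  have h2 := ae_mulVec_eq_zero_of_sqNorm H (sub_mem hkm hgm).1 h1
  have hder : ∀ᵐ x ∂halfLine, HasDerivAt (k - g) 0 x := by
    filter_upwards [hkd, hgd, h2] with x ⟨d, hd, hd'⟩ ⟨e, he, he'⟩ hx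
    have h3 : Matrix.J (Fin n) ℂ *ᵥ (d - e) = 0 := by
      rw [Pi.sub_apply, mulVec_sub, sub_eq_zero] at hx
      rw [mulVec_sub, hd', he', hx, sub_self]
    have h4 := J_mulVec_J_mulVec (d - e)
    rw [h3, mulVec_zero] at h4
    have h5 := hd.sub he
    rwa [neg_eq_zero.1 h4.symm] at h5
  have hconst : ∀ a b : ℝ, 0 < a → a ≤ b → (k - g) a = (k - g) b := by
    intro a b ha hab
    have hac := (hkac a b hab fun x hx => ha.trans_le hx.1).sub
      (hgac a b hab fun x hx => ha.le.trans hx.1)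
    obtain ⟨C, hC⟩ := hac.const_of_ae_hasDerivAt_zero
      (ae_uIcc_of_ae_halfLine hder ha.le (ha.le.trans hab))
    rw [hC a left_mem_uIcc, hC b right_mem_uIcc]
  have hone : ∀ x : ℝ, 0 < x → (k - g) x = (k - g) 1 := fun x hx => by
    rcases le_total x 1 with h | h
    · exact hconst x 1 hx h
    · exact (hconst 1 x one_pos h).symm
  intro x hx
  refine sub_eq_zero.1 ((hone x hx).trans (hdef _ ?_))
  filter_upwards [h2, ae_restrict_mem measurableSet_Ioi] with t ht ht0
  rwa [hone t ht0] at ht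

theorem resolvent_eq_greenIntegral {H : Hamiltonian n}
    (hreg : H.RegularAtZero) (hL : H.IsLimitPoint) {α : Matrix (Fin n) (Fin n ⊕ Fin n) ℂ}
    (hα : α * αᴴ = 1) (hαJ : α * Matrix.J (Fin n) ℂ * αᴴ = 0) {u v : ℝ → ℂ → Mat n}
    {m : ℂ → Matrix (Fin n) (Fin n) ℂ} (hS : H.IsWeylSystem α u v m) {z : ℂ} (hz : z.im ≠ 0)
    {h : ℝ → Vec n} {F : H.L2} (hF : H.Represents h F) :
    (∀ x : ℝ, 0 ≤ x → IntegrableOn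
      (fun y => greenFunction u v m x y z *ᵥ (H y *ᵥ h y)) (Ioi 0) volume) ∧
    ∃ R : H.L2, (∀ K : H.L2, (F, K) ∈ relResolvent (H.boundaryRelation α) z ↔ K = R) ∧
      H.Represents (H.greenIntegral u v m z h) R ∧
      H.Pair (H.greenIntegral u v m z h) (z • H.greenIntegral u v m z h + h) := by
  obtain ⟨hconj, D⟩ := hS.weylData hL hreg hα hαJ hz
  have hh : h ∈ H.preL2 := hF.1
  have hgreen := fun x (hx : 0 ≤ x) => integrableOn_greenFunction (m := m) (v := v)
    (fun c => ((hS.fund (starRingEnd ℂ z)).u_solution.pair c).locL2 hreg)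
    (fun c => mulVec_mem_preL2 (hS.weyl _ (by simpa using hz)) c) hh hx
  set G := H.greenSol (fun x => u x z) (fun x => v x z + u x z * m z)
    (fun x => u x (starRingEnd ℂ z))
    (fun x => v x (starRingEnd ℂ z) + u x (starRingEnd ℂ z) * (m z)ᴴ) h with hG
  -- The Green integral and the variation-of-constants formula are identified only for `x ≥ 0`, so
  -- regularity and the equation are transferred along this equality.
  have hGe : EqOn (H.greenIntegral u v m z h) G (Ici 0) := fun x hx => by
    have h1 := (hgreen x hx).2
    simp only [weylSolution, hconj] at h1
    exact h1
  set g := H.greenIntegral u v m z h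
  have hGp : H.Pair G (z • G + h) := D.greenSol_pair hreg hz hα hαJ hh
  have hGm : G ∈ H.preL2 := D.greenSol_mem hreg hz hα hαJ hh
  have hae : ∀ᵐ x ∂halfLine, G x = g x := by
    filter_upwards [ae_restrict_mem measurableSet_Ioi] with x hx using
      (hGe (mem_Ici.2 (mem_Ioi.1 hx).le)).symm
  have hgp : H.Pair g (z • g + h) := (hGp.congr_left hGe).congr (by
    filter_upwards [hae] with x hx
    simp only [Pi.add_apply, Pi.smul_apply, hx])
  have hgm : g ∈ H.preL2 := by
    refine ⟨hGm.1.congr hae, ?_⟩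
    have h1 : H.sqNorm g = H.sqNorm G := lintegral_congr_ae (by
      filter_upwards [hae] with x hx
      rw [hx])
    rw [h1]
    exact hGm.2
  have hg0 : α *ᵥ g 0 = 0 := by
    rw [hGe (mem_Ici.2 le_rfl)]
    exact D.greenSol_zero hαJ
  have hgR : H.Represents g (H.null.mkQ ⟨g, hgm⟩) := ⟨hgm, rfl⟩
  refine ⟨fun x hx => (hgreen x hx).1, H.null.mkQ ⟨g, hgm⟩, fun K => ?_, hgR, hgp⟩
  rw [mem_relResolvent]
  constructor
  · rintro ⟨f₀, g₀, ⟨hf₀m, hf₀⟩, ⟨hg₀m, hg₀⟩, hac, hd, h0⟩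
    have hpf : H.Pair f₀ g₀ := ⟨hac, hd⟩
    have hrep : H.Represents (h + z • f₀) (F + z • K) :=
      hF.add (Hamiltonian.Represents.smul z ⟨hf₀m, hf₀⟩)
    obtain ⟨hrm, hr⟩ := hrep
    -- The representative `g₀` supplied by the relation may differ from `h + z f₀` by a null
    -- function, but `H` annihilates it and the equation is unaffected.
    have h1 : H.sqNorm (g₀ - (h + z • f₀)) = 0 :=
      (mkQ_eq_mkQ_iff hg₀m hrm).1 (hg₀.trans hr.symm)
    have h2 := ae_mulVec_eq_zero_of_sqNorm H (sub_mem hg₀m hrm).1 h1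
    have hpf' : H.Pair f₀ (h + z • f₀) := hpf.congr (by
      filter_upwards [h2] with x hx
      rwa [Pi.sub_apply, mulVec_sub, sub_eq_zero] at hx)
    have hy : H.Pair (f₀ - g) (z • (f₀ - g)) := by
      have h3 := hpf'.sub hgp
      rwa [show h + z • f₀ - (z • g + h) = z • (f₀ - g) by rw [smul_sub]; abel] at h3
    have h3 : α *ᵥ (f₀ - g) 0 = 0 := by
      have h4 : α *ᵥ f₀ 0 = 0 := h0
      rw [Pi.sub_apply, mulVec_sub, h4, hg0, sub_zero]
    have h5 := hL.sqNorm_eq_zero hreg hα hαJ hz hy (sub_mem hf₀m hgm) h3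
    exact hf₀.symm.trans ((mkQ_eq_mkQ_iff hf₀m hgm).2 h5)
  · rintro rfl
    have h1 := hF.add (hgR.smul z)
    rw [add_comm h] at h1
    exact ⟨g, z • g + h, hgR, h1, hgp.1, hgp.2, hg0⟩

end CanonicalSystem

end

theorem mainTheorem6 {n : ℕ} (H : CanonicalSystem.Hamiltonian n)
    (hdef : H.IsDefinite) (hreg : H.RegularAtZero) (hindices : H.DeficiencyIndicesEq n)
    (α : Matrix (Fin n) (Fin n ⊕ Fin n) ℂ)
    (hα : α * αᴴ = 1) (hαJ : α * Matrix.J (Fin n) ℂ * αᴴ = 0) :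
    (∃ (u v : ℝ → ℂ → CanonicalSystem.Mat n) (m : ℂ → Matrix (Fin n) (Fin n) ℂ),
      H.IsWeylSystem α u v m) ∧
    ∀ (u v : ℝ → ℂ → CanonicalSystem.Mat n) (m : ℂ → Matrix (Fin n) (Fin n) ℂ),
      H.IsWeylSystem α u v m →
      ∀ z : ℂ, z.im ≠ 0 → ∀ (h : ℝ → CanonicalSystem.Vec n) (F : H.L2), H.Represents h F →
        (∀ x : ℝ, 0 ≤ x → IntegrableOn
          (fun y => CanonicalSystem.greenFunction u v m x y z *ᵥ (H y *ᵥ h y)) (Ioi 0) volume) ∧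
        ∀ g : ℝ → CanonicalSystem.Vec n, g = H.greenIntegral u v m z h →
          ∃ R : H.L2,
            -- `R` is the value of the resolvent at `F`, and `g` represents it
            (∀ K : H.L2,
              (F, K) ∈ CanonicalSystem.relResolvent (H.boundaryRelation α) z ↔ K = R) ∧
            H.Represents g R ∧
            -- `g` is absolutely continuous and solves `J g' = -z H g - H h`
            CanonicalSystem.LocACOn g (Ici 0) ∧
            CanonicalSystem.JDerivEq g (fun x => -(z • (H x *ᵥ g x)) - H x *ᵥ h x) ∧
            -- `g` is the only such representative
            ∀ k : ℝ → CanonicalSystem.Vec n, H.Represents k R →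
              CanonicalSystem.LocACOn k (Ioi 0) →
              CanonicalSystem.JDerivEq k (fun x => -(z • (H x *ᵥ k x)) - H x *ᵥ h x) →
              EqOn k g (Ioi 0) := by
  refine ⟨CanonicalSystem.exists_isWeylSystem hdef hreg hα hαJ, ?_⟩
  intro u v m hS z hz h F hF
  have hL := CanonicalSystem.isLimitPoint hdef hreg hindices hα hαJ
  obtain ⟨hint, R, hR, hrep, hp⟩ :=
    CanonicalSystem.resolvent_eq_greenIntegral hreg hL hα hαJ hS hz hF
  refine ⟨hint, fun g hg => ?_⟩
  subst hg
  have hd : CanonicalSystem.JDerivEq (H.greenIntegral u v m z h)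
      (fun x => -(z • (H x *ᵥ H.greenIntegral u v m z h x)) - H x *ᵥ h x) := by
    convert hp.2 using 1
    funext x
    simp only [Pi.add_apply, Pi.smul_apply, mulVec_add, mulVec_smul]
    abel
  exact ⟨R, hR, hrep, hp.1, hd, fun k hk hkac hkd =>
    CanonicalSystem.eqOn_of_represents hdef hk hrep hkac hp.1 hkd hd⟩
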